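/- Let $(M,\mathcal O)$ be a complex manifold of dimension $n$ with its sheaf $\mathcal O$ of holomorphic functions, let $\mathcal F$ be a locally free sheaf of $\mathcal O$-modules of rank $m$, and let $\widetilde{\mathcal O}=\Lambda_{\mathcal O}(\mathcal F)=\bigoplus_q\Lambda^q\mathcal F$ be the structure sheaf of the associated split complex supermanifold, a sheaf of $\mathbb Z$-graded supercommutative superalgebras (with $\Lambda^q\mathcal F=0$ for $q<0$). Let $\mathrm{Der}\,\widetilde{\mathcal O}$ be the sheaf of $\mathbb C$-linear superderivations of $\widetilde{\mathcal O}$ (sums of even and odd ones), and for $p\in\mathbb Z$ let $\mathrm{Der}_p\widetilde{\mathcal O}$ be the subsheaf of those $\delta$ with $\delta(\Lambda^q\mathcal F)\subset\Lambda^{q+p}\mathcal F$ for all $q\in\mathbb Z$; these are sheaves of $\mathcal O$-modules. Let $\mathcal T=\mathrm{Der}_{\mathbb C}\,\mathcal O$ be the tangent sheaf and $\mathcal F^*=\mathcal Hom_{\mathcal O}(\mathcal F,\mathcal O)$; all tensor products and exterior powers are over $\mathcal O$. 1) For every $p\in\mathbb Z$ the sheaf of $\mathcal O$-modules $\mathrm{Der}_p\widetilde{\mathcal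 O}$ is locally free of finite rank. Moreover, $\delta\mapsto\delta|_{\mathcal F}$ defines an isomorphism of sheaves of $\mathcal O$-modules $\mathrm{Der}_{-1}\widetilde{\mathcal O}\cong\mathcal F^*$. 2) For every integer $p\ge 0$ there is a short exact sequence of sheaves of $\mathcal O$-modules $$0\to\mathcal F^*\otimes\Lambda^{p+1}\mathcal F\xrightarrow{\ \beta\ }\mathrm{Der}_p\widetilde{\mathcal O}\xrightarrow{\ \alpha\ }\mathcal T\otimes\Lambda^p\mathcal F\to 0,$$ in which $\beta(\varphi\otimes\eta)$ is the derivation that vanishes on $\mathcal O$ and maps $s\in\mathcal F$ to $\varphi(s)\eta$, and $\alpha$ is the restriction of derivations to $\mathcal O$: for local sections, $\alpha(\delta)=\sum_k\xi_k\otimes\eta_k$ if and only if $\delta(g)=\sum_k\xi_k(g)\,\eta_k$ for all $g\in\mathcal O$. -/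

import Mathlib

open CategoryTheory TopologicalSpace Opposite
open scoped Manifold ContDiff TensorProduct MonoidalCategory

noncomputable section

namespace SplitSuper

/-! ### The exterior algebra of a module and its superderivations -/

section Algebra

variable (R N : Type) [CommRing R] [Algebra ℂ R] [AddCommGroup N] [Module R N] [Module ℂ N]
  [IsScalarTower ℂ R N]

/-- The homogeneous component of degree `q ∈ ℤ` of the exterior algebra (zero for `q < 0`). -/
def gr (q : ℤ) : Submodule R (ExteriorAlgebra R N) :=
  if 0 ≤ q then ⋀[R]^q.toNat N else ⊥

/-- The even (`i = 0`) and the odd (`i = 1`) part of the exterior algebra. -/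
def parityPart (i : ZMod 2) : Submodule R (ExteriorAlgebra R N) :=
  CliffordAlgebra.evenOdd (0 : QuadraticForm R N) i

/-- The `ℂ`-linear superderivations of parity `ε` of the exterior algebra: they shift the parity
by `ε` and satisfy `δ (a b) = (δ a) b + (-1) ^ (ε |a|) a (δ b)` for `a` of parity `|a|`. -/
def superDer (ε : ZMod 2) : Submodule R (Module.End ℂ (ExteriorAlgebra R N)) where
  carrier := {δ | (∀ i, ∀ a ∈ parityPart R N i, δ a ∈ parityPart R N (i + ε)) ∧
    ∀ i, ∀ a ∈ parityPart R N i, ∀ b,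
      δ (a * b) = δ a * b + (-1 : ℤ) ^ (ε.val * i.val) • (a * δ b)}
  zero_mem' := by
    refine ⟨fun i a _ => ?_, fun i a _ b => ?_⟩
    · simp
    · simp
  add_mem' := by
    rintro δ δ' ⟨h1, h2⟩ ⟨h1', h2'⟩
    refine ⟨fun i a ha => ?_, fun i a ha b => ?_⟩
    · exact add_mem (h1 i a ha) (h1' i a ha)
    · simp only [LinearMap.add_apply, h2 i a ha b, h2' i a ha b, add_mul, mul_add, smul_add]
      abel
  smul_mem' := by
    rintro r δ ⟨h1, h2⟩
    refine ⟨fun i a ha => ?_, fun i a ha b => ?_⟩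
    · exact Submodule.smul_mem _ r (h1 i a ha)
    · simp only [LinearMap.smul_apply, h2 i a ha b, smul_add, smul_mul_assoc, mul_smul_comm]
      rw [smul_comm]

/-- All `ℂ`-linear superderivations of the exterior algebra: sums of even and odd ones. -/
def allDer : Submodule R (Module.End ℂ (ExteriorAlgebra R N)) :=
  superDer R N 0 ⊔ superDer R N 1

/-- The superderivations of degree `p ∈ ℤ`, mapping the component of every degree `q` into the
component of degree `q + p`. -/
def derDeg (p : ℤ) : Submodule R (Module.End ℂ (ExteriorAlgebra R N)) where
  carrier := {δ | δ ∈ allDer R N ∧ ∀ q : ℤ, ∀ a ∈ gr R N q, δ a ∈ gr R N (q + p)}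
  zero_mem' := ⟨zero_mem _, fun q a _ => by simp⟩
  add_mem' := by
    rintro δ δ' ⟨h1, h2⟩ ⟨h1', h2'⟩
    exact ⟨add_mem h1 h1', fun q a ha => add_mem (h2 q a ha) (h2' q a ha)⟩
  smul_mem' := by
    rintro r δ ⟨h1, h2⟩
    exact ⟨Submodule.smul_mem _ r h1, fun q a ha => Submodule.smul_mem _ r (h2 q a ha)⟩

end Algebra

/-! ### Sheaves of modules on a ringed space -/

section RingedSpace

variable {X : TopCat.{0}}

/-- A sheaf of commutative rings, viewed as a sheaf of rings. -/
abbrev ringSheaf (O : TopCat.Sheaf CommRingCat.{0} X) : TopCat.Sheaf RingCat.{0} X where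
  obj := O.obj ⋙ forget₂ CommRingCat RingCat
  property := ((sheafCompose _ (forget₂ CommRingCat RingCat)).obj O).property

/-- Sheaves of `O`-modules. -/
abbrev ModSheaf (O : TopCat.Sheaf CommRingCat.{0} X) := SheafOfModules.{0} (ringSheaf O)

variable (O : TopCat.Sheaf CommRingCat.{0} X)

/-- The stalk `O_x`. -/
abbrev RStalk (x : X) : Type := (TopCat.Presheaf.stalk O.obj x : CommRingCat)

/-- The germ at `x` of a section of `O`. -/
def rgerm {U : Opens X} (x : U) : (O.obj.obj (op U) : CommRingCat) →+* RStalk O x.1 :=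
  (TopCat.Presheaf.germ O.obj U x.1 x.2).hom

variable {O}

/-- The stalk `F_x` of a sheaf of `O`-modules. -/
def Stalk (F : ModSheaf O) (x : X) : Type :=
  (TopCat.Presheaf.stalk (C := Ab.{0}) F.val.presheaf x : Ab)

instance (F : ModSheaf O) (x : X) : AddCommGroup (Stalk F x) :=
  inferInstanceAs (AddCommGroup (TopCat.Presheaf.stalk (C := Ab.{0}) F.val.presheaf x : Ab))

instance (F : ModSheaf O) (x : X) : Module (RStalk O x) (Stalk F x) :=
  inferInstanceAs (Module (TopCat.Presheaf.stalk O.obj x : CommRingCat)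
    (TopCat.Presheaf.stalk (C := Ab.{0}) (PresheafOfModules.presheaf
      (show PresheafOfModules.{0} (O.obj ⋙ forget₂ CommRingCat RingCat) from F.val)) x : Ab))

/-- The germ at `x` of a section of `F`. -/
def germ (F : ModSheaf O) {U : Opens X} (x : U) : (F.val.obj (op U)) →+ Stalk F x.1 :=
  (TopCat.Presheaf.germ (C := Ab.{0}) F.val.presheaf U x.1 x.2).hom


theorem germ_smul (F : ModSheaf O) {U : Opens X} (x : U) (g : (O.obj.obj (op U) : CommRingCat))
    (s : F.val.obj (op U)) : germ F x (g • s) = rgerm O x g • germ F x s :=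
  PresheafOfModules.germ_smul
    (show PresheafOfModules.{0} (O.obj ⋙ forget₂ CommRingCat RingCat) from F.val) x.1 U x.2 g s

theorem rgerm_res {U V : Opens X} (i : V ⟶ U) (x : V) (g : (O.obj.obj (op U) : CommRingCat)) :
    rgerm O x (O.obj.map i.op g) = rgerm O (⟨x.1, i.le x.2⟩ : U) g :=
  TopCat.Presheaf.germ_res_apply O.obj i x.1 x.2 g

theorem germ_res (F : ModSheaf O) {U V : Opens X} (i : V ⟶ U) (x : V) (s : F.val.obj (op U)) :
    germ F x (F.val.map i.op s) = germ F (⟨x.1, i.le x.2⟩ : U) s :=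
  TopCat.Presheaf.germ_res_apply (C := Ab.{0}) F.val.presheaf i x.1 x.2 s

variable (O) in
/-- A family of `O_x`-modules together with a local notion of section, closed under the module
operations; the sections over `U` are the functions `x ↦ f x ∈ fiber x` on `U` satisfying `sec`. -/
structure GermFamily where
  fiber : X → Type
  [grp : ∀ x, AddCommGroup (fiber x)]
  [mod : ∀ x, Module (RStalk O x) (fiber x)]
  sec : TopCat.LocalPredicate fiber
  zero_sec : ∀ U : Opens X, sec.pred (U := U) (fun _ => 0)
  add_sec : ∀ {U : Opens X} {f g : ∀ x : U, fiber x}, sec.pred f → sec.pred g →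
    sec.pred (fun x => f x + g x)
  smul_sec : ∀ {U : Opens X} (a : (O.obj.obj (op U) : CommRingCat)) {f : ∀ x : U, fiber x},
    sec.pred f → sec.pred (fun x => rgerm O x a • f x)

namespace GermFamily

attribute [instance] GermFamily.grp GermFamily.mod

variable (G : GermFamily O)

/-- The group of sections over `U`. -/
def sections (U : Opens X) : AddSubgroup (∀ x : U, G.fiber x) where
  carrier := {f | G.sec.pred f}
  zero_mem' := G.zero_sec U
  add_mem' := G.add_sec
  neg_mem' := by
    intro f hf
    have h := G.smul_sec (-1) hf
    simp only [map_neg, map_one, neg_smul, one_smul] at h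
    exact h

instance (U : Opens X) : Module (O.obj.obj (op U) : CommRingCat) (G.sections U) where
  smul a f := ⟨fun x => rgerm O x a • f.1 x, G.smul_sec a f.2⟩
  one_smul f := Subtype.ext <| funext fun x => by
    change rgerm O x 1 • f.1 x = f.1 x
    rw [map_one, one_smul]
  mul_smul a b f := Subtype.ext <| funext fun x => by
    change rgerm O x (a * b) • f.1 x = rgerm O x a • rgerm O x b • f.1 x
    rw [map_mul, mul_smul]
  smul_zero a := Subtype.ext <| funext fun x => smul_zero (rgerm O x a)
  smul_add a f g := Subtype.ext <| funext fun x => smul_add (rgerm O x a) (f.1 x) (g.1 x)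
  add_smul a b f := Subtype.ext <| funext fun x => by
    change rgerm O x (a + b) • f.1 x = rgerm O x a • f.1 x + rgerm O x b • f.1 x
    rw [map_add, add_smul]
  zero_smul f := Subtype.ext <| funext fun x => by
    change rgerm O x 0 • f.1 x = 0
    rw [map_zero, zero_smul]

/-- Restriction of sections. -/
def res {U V : Opens X} (i : V ⟶ U) : G.sections U →+ G.sections V where
  toFun f := ⟨fun x => f.1 (i x), G.sec.res i f.1 f.2⟩
  map_zero' := rfl
  map_add' _ _ := rfl

theorem res_smul {U V : Opens X} (i : V ⟶ U) (a : (O.obj.obj (op U) : CommRingCat))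
    (f : G.sections U) : G.res i (a • f) = (O.obj.map i.op a) • G.res i f :=
  Subtype.ext <| funext fun x => by
    change rgerm O (i x) a • f.1 (i x) = rgerm O x (O.obj.map i.op a) • f.1 (i x)
    rw [rgerm_res]
    rfl

/-- The presheaf of groups of sections. -/
def toPresheaf : TopCat.Presheaf Ab.{0} X where
  obj U := AddCommGrpCat.of (G.sections U.unop)
  map i := AddCommGrpCat.ofHom (G.res i.unop)

instance (U : (Opens X)ᵒᵖ) : Module ((ringSheaf O).obj.obj U) (G.toPresheaf.obj U) :=
  inferInstanceAs (Module (O.obj.obj (op U.unop) : CommRingCat) (G.sections U.unop))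

theorem toPresheaf_isSheaf : Presheaf.IsSheaf (Opens.grothendieckTopology X) G.toPresheaf := by
  rw [Presheaf.isSheaf_iff_isSheaf_forget _ _ (forget Ab.{0})]
  exact TopCat.subpresheafToTypes.isSheaf G.sec

/-- The sheaf of `O`-modules of sections. -/
def toModSheaf : ModSheaf O where
  val := PresheafOfModules.ofPresheaf G.toPresheaf (fun _ _ i a f => G.res_smul i.unop a f)
  isSheaf := G.toPresheaf_isSheaf

/-- The value at `x ∈ U` of a section over `U`. -/
def value {U : Opens X} (f : G.toModSheaf.val.obj (op U)) (x : U) : G.fiber x :=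
  (show G.sections U from f).1 x

end GermFamily

/-! ### The structure sheaf `Λ(F)` of a split supermanifold -/

/-- The stalk at `x` of the sheaf of superalgebras `Λ(F)`, the exterior algebra `Λ(F_x)` of the
`O_x`-module `F_x`. -/
abbrev ExtStalk (F : ModSheaf O) (x : X) : Type := ExteriorAlgebra (RStalk O x) (Stalk F x)

/-- The functions `x ↦ f x ∈ Λ(F_x)` on `U` given by an element of `Λ(F(U))`, i.e. the polynomial
expressions in the sections of `O` and of `F` over `U`. -/
def polySections (F : ModSheaf O) (U : Opens X) : Subring (∀ x : U, ExtStalk F x) :=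
  Subring.closure
    (Set.range (fun (g : (O.obj.obj (op U) : CommRingCat)) (x : U) =>
        algebraMap (RStalk O x) (ExtStalk F x) (rgerm O x g)) ∪
      Set.range (fun (s : F.val.obj (op U)) (x : U) =>
        ExteriorAlgebra.ι (RStalk O x) (germ F x s)))

/-- Restriction of arbitrary functions `x ↦ f x ∈ Λ(F_x)` to a smaller open set. -/
def extRes (F : ModSheaf O) {U V : Opens X} (i : V ⟶ U) :
    (∀ x : U, ExtStalk F x) →+* (∀ x : V, ExtStalk F x) where
  toFun f x := f (i x)
  map_one' := rfl
  map_mul' _ _ := rfl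
  map_zero' := rfl
  map_add' _ _ := rfl

theorem polySections_res (F : ModSheaf O) {U V : Opens X} (i : V ⟶ U)
    {f : ∀ x : U, ExtStalk F x} (hf : f ∈ polySections F U) :
    (fun x : V => f (i x)) ∈ polySections F V := by
  have h : polySections F U ≤ (polySections F V).comap (extRes F i) := by
    refine Subring.closure_le.2 ?_
    rintro _ (⟨g, rfl⟩ | ⟨s, rfl⟩)
    · refine Subring.subset_closure (Or.inl ⟨O.obj.map i.op g, ?_⟩)
      funext x
      exact congrArg (algebraMap (RStalk O x.1) (ExtStalk F x.1)) (rgerm_res i x g)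
    · refine Subring.subset_closure (Or.inr ⟨F.val.map i.op s, ?_⟩)
      funext x
      exact congrArg (ExteriorAlgebra.ι (RStalk O x.1)) (germ_res F i x s)
  exact h hf

/-- The sections of the sheaf of superalgebras `Λ(F)`, the sheaf associated with
`U ↦ Λ(F(U))`: functions `x ↦ f x ∈ Λ(F_x)` that are locally given by elements of `Λ(F(V))`. -/
def extSec (F : ModSheaf O) : TopCat.LocalPredicate (ExtStalk F) :=
  TopCat.PrelocalPredicate.sheafify
    { pred := fun {U} f => f ∈ polySections F U
      res := fun i _ hf => polySections_res F i hf }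

theorem extSec_of_poly (F : ModSheaf O) {U : Opens X} {f : ∀ x : U, ExtStalk F x}
    (hf : f ∈ polySections F U) : (extSec F).pred f :=
  TopCat.PrelocalPredicate.sheafifyOf hf

/-- The ring `Λ(F)(U)` of sections of `Λ(F)` over `U`. -/
def extSections (F : ModSheaf O) (U : Opens X) : Subring (∀ x : U, ExtStalk F x) where
  carrier := {f | (extSec F).pred f}
  zero_mem' := extSec_of_poly F (zero_mem _)
  one_mem' := extSec_of_poly F (one_mem _)
  neg_mem' := by
    intro f hf x
    obtain ⟨V, hV, i, h⟩ := hf x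
    exact ⟨V, hV, i, (polySections F V).neg_mem h⟩
  add_mem' := by
    intro f g hf hg x
    obtain ⟨V, hV, i, h⟩ := hf x
    obtain ⟨W, hW, j, h'⟩ := hg x
    exact ⟨V ⊓ W, ⟨hV, hW⟩, Opens.infLELeft V W ≫ i,
      add_mem (S := Subring (∀ x : (V ⊓ W : Opens X), ExtStalk F x))
        (polySections_res F (Opens.infLELeft V W) h)
        (polySections_res F (Opens.infLERight V W) h')⟩
  mul_mem' := by
    intro f g hf hg x
    obtain ⟨V, hV, i, h⟩ := hf x
    obtain ⟨W, hW, j, h'⟩ := hg x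
    exact ⟨V ⊓ W, ⟨hV, hW⟩, Opens.infLELeft V W ≫ i,
      mul_mem (S := Subring (∀ x : (V ⊓ W : Opens X), ExtStalk F x))
        (polySections_res F (Opens.infLELeft V W) h)
        (polySections_res F (Opens.infLERight V W) h')⟩

theorem extSec_zero (F : ModSheaf O) (U : Opens X) :
    (extSec F).pred (U := U) (fun _ => 0) := (extSections F U).zero_mem

theorem extSec_add (F : ModSheaf O) {U : Opens X} {f g : ∀ x : U, ExtStalk F x}
    (hf : (extSec F).pred f) (hg : (extSec F).pred g) : (extSec F).pred (fun x => f x + g x) :=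
  (extSections F U).add_mem hf hg

theorem extSec_smul (F : ModSheaf O) {U : Opens X} (a : (O.obj.obj (op U) : CommRingCat))
    {f : ∀ x : U, ExtStalk F x} (hf : (extSec F).pred f) :
    (extSec F).pred (fun x => rgerm O x a • f x) := by
  have h := (extSections F U).mul_mem
    (extSec_of_poly F (Subring.subset_closure (Or.inl ⟨a, rfl⟩))) hf
  have e : (fun x : U => rgerm O x a • f x) =
      (fun x : U => algebraMap (RStalk O x) (ExtStalk F x) (rgerm O x a)) * f :=
    funext fun x => Algebra.smul_def _ _
  rw [e]
  exact h

/-- The sheaf `Λ^p(F)`: the sections of `Λ(F)` with values in the components of degree `p`. -/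
def extPower (F : ModSheaf O) (p : ℕ) : GermFamily O where
  fiber x := ⋀[RStalk O x]^p (Stalk F x)
  sec :=
    { pred := fun f => (extSec F).pred (fun x => (f x : ExtStalk F x))
      res := fun i f h => (extSec F).res i _ h
      locality := fun f h => (extSec F).locality _ h }
  zero_sec U := extSec_zero F U
  add_sec := by
    intro U f g hf hg
    exact extSec_add F (f := fun x => (f x : ExtStalk F x)) (g := fun x => (g x : ExtStalk F x)) hf hg
  smul_sec := by
    intro U a f hf
    exact extSec_smul F a (f := fun x => (f x : ExtStalk F x)) hf

/-! ### Sheaves of homomorphisms and of derivations -/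

/-- The local predicate on families of maps `S x → T x`, parametrised by `h x : H x`, that carry
sections of `S` to sections of `T`, over all smaller open sets. -/
def carries {S T H : X → Type} (P : TopCat.LocalPredicate S) (Q : TopCat.LocalPredicate T)
    (ev : ∀ x, H x → S x → T x) : TopCat.LocalPredicate H where
  pred {U} h := ∀ (V : Opens X) (i : V ⟶ U) (s : ∀ x : V, S x), P.pred s →
    Q.pred (fun x : V => ev x (h (i x)) (s x))
  res i _ hh V j s hs := hh V (j ≫ i) s hs
  locality {U} h w V i s hs := by
    refine Q.locality _ fun x => ?_
    obtain ⟨W, hW, j, hj⟩ := w (i x)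
    exact ⟨V ⊓ W, ⟨x.2, hW⟩, Opens.infLELeft V W,
      hj (V ⊓ W) (Opens.infLERight V W) _ (P.res (Opens.infLELeft V W) s hs)⟩

variable (O) in
/-- The functions `x ↦ f x ∈ O_x` that are (locally) the germs of a section of `O`. -/
def ringSec : TopCat.LocalPredicate (RStalk O) :=
  TopCat.PrelocalPredicate.sheafify
    { pred := fun {U} f => ∃ g : (O.obj.obj (op U) : CommRingCat), ∀ x : U, f x = rgerm O x g
      res := fun i f ⟨g, hg⟩ => ⟨O.obj.map i.op g, fun x => by
        rw [rgerm_res]; exact hg (i x)⟩ }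

/-- The functions `x ↦ f x ∈ F_x` that are (locally) the germs of a section of `F`. -/
def modSec (F : ModSheaf O) : TopCat.LocalPredicate (Stalk F) :=
  TopCat.PrelocalPredicate.sheafify
    { pred := fun {U} f => ∃ s : F.val.obj (op U), ∀ x : U, f x = germ F x s
      res := fun i f ⟨s, hs⟩ => ⟨F.val.map i.op s, fun x => by
        rw [germ_res]; exact hs (i x)⟩ }

variable (O) in
theorem ringSec_zero (U : Opens X) : (ringSec O).pred (U := U) (fun _ => 0) :=
  fun x => ⟨U, x.2, 𝟙 U, 0, fun y => (map_zero (rgerm O y)).symm⟩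

theorem ringSec_add {U : Opens X} {f g : ∀ x : U, RStalk O x}
    (hf : (ringSec O).pred f) (hg : (ringSec O).pred g) :
    (ringSec O).pred (fun x => f x + g x) := by
  intro x
  obtain ⟨V, hV, i, a, ha⟩ := hf x
  obtain ⟨W, hW, j, b, hb⟩ := hg x
  refine ⟨V ⊓ W, ⟨hV, hW⟩, Opens.infLELeft V W ≫ i,
    O.obj.map (Opens.infLELeft V W).op a + O.obj.map (Opens.infLERight V W).op b, fun y => ?_⟩
  rw [map_add, rgerm_res, rgerm_res]
  exact congrArg₂ (· + ·) (ha ⟨y.1, y.2.1⟩) (hb ⟨y.1, y.2.2⟩)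

theorem ringSec_smul {U : Opens X} (a : (O.obj.obj (op U) : CommRingCat))
    {f : ∀ x : U, RStalk O x} (hf : (ringSec O).pred f) :
    (ringSec O).pred (fun x => rgerm O x a • f x) := by
  intro x
  obtain ⟨V, hV, i, b, hb⟩ := hf x
  refine ⟨V, hV, i, O.obj.map i.op a * b, fun y => ?_⟩
  rw [map_mul, rgerm_res]
  exact congrArg (rgerm O (i y) a * ·) (hb y)

/-- The dual sheaf `F^* = Hom_O(F, O)`: a section over `U` is a family of `O_x`-linear maps
`F_x → O_x`, `x ∈ U`, carrying sections of `F` to sections of `O`. -/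
def dual (F : ModSheaf O) : GermFamily O where
  fiber x := Module.Dual (RStalk O x) (Stalk F x)
  sec := carries (modSec F) (ringSec O) (fun _ φ s => φ s)
  zero_sec _ V _ _ _ := ringSec_zero O V
  add_sec hf hg V i s hs := ringSec_add (hf V i s hs) (hg V i s hs)
  smul_sec {_U} a _f hf V i s hs := by
    have h := ringSec_smul (O.obj.map i.op a) (hf V i s hs)
    simp only [rgerm_res] at h
    exact h

variable [∀ x, Algebra ℂ (RStalk O x)]

instance (F : ModSheaf O) (x : X) : Module ℂ (Stalk F x) :=
  Module.compHom _ (algebraMap ℂ (RStalk O x))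

instance (F : ModSheaf O) (x : X) : IsScalarTower ℂ (RStalk O x) (Stalk F x) where
  smul_assoc c r s := by
    change (c • r) • s = algebraMap ℂ (RStalk O x) c • r • s
    rw [Algebra.smul_def, mul_smul]

variable (O) in
/-- The tangent sheaf `T = Der O`: a section over `U` is a family of `ℂ`-linear derivations of the
rings `O_x`, `x ∈ U`, carrying sections of `O` to sections of `O`. -/
def tangent : GermFamily O where
  fiber x := Derivation ℂ (RStalk O x) (RStalk O x)
  sec := carries (ringSec O) (ringSec O) (fun _ D g => D g)
  zero_sec _ V _ _ _ := ringSec_zero O V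
  add_sec hf hg V i s hs := ringSec_add (hf V i s hs) (hg V i s hs)
  smul_sec {_U} a _f hf V i s hs := by
    have h := ringSec_smul (O.obj.map i.op a) (hf V i s hs)
    simp only [rgerm_res] at h
    exact h

/-- The homogeneous component `Der_p Λ(F)`, `p ∈ ℤ`, of the sheaf `Der Λ(F)`: a section over `U`
is a family of `ℂ`-linear superderivations of the superalgebras `Λ(F_x)`, `x ∈ U`, that carries
sections of `Λ(F)` to sections of `Λ(F)` and maps degree `q` to degree `q + p` for all `q`. -/
def derP (F : ModSheaf O) (p : ℤ) : GermFamily O where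
  fiber x := derDeg (RStalk O x) (Stalk F x) p
  sec := carries (extSec F) (extSec F) (fun _ δ a => δ.1 a)
  zero_sec _ V _ _ _ := extSec_zero F V
  add_sec hf hg V i s hs := extSec_add F (hf V i s hs) (hg V i s hs)
  smul_sec {_U} a _f hf V i s hs := by
    have h := extSec_smul F (O.obj.map i.op a) (hf V i s hs)
    simp only [rgerm_res] at h
    exact h

/-! ### The sheaves of modules, and evaluation of their sections at points -/

/-- `Λ^p(F)` as a sheaf of `O`-modules. -/
abbrev extPowerSheaf (F : ModSheaf O) (p : ℕ) : ModSheaf O := (extPower F p).toModSheaf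

/-- `F^*` as a sheaf of `O`-modules. -/
abbrev dualSheaf (F : ModSheaf O) : ModSheaf O := (dual F).toModSheaf

variable (O) in
/-- `T = Der O` as a sheaf of `O`-modules. -/
abbrev tangentSheaf : ModSheaf O := (tangent O).toModSheaf

/-- `Der_p Λ(F)` as a sheaf of `O`-modules. -/
abbrev derSheaf (F : ModSheaf O) (p : ℤ) : ModSheaf O := (derP F p).toModSheaf

/-- The germ `η_x ∈ Λ(F_x)` of a section `η` of `Λ^p(F)`. -/
def extAt {F : ModSheaf O} {p : ℕ} {U : Opens X} (η : (extPowerSheaf F p).val.obj (op U))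
    (x : U) : ExtStalk F x :=
  Subtype.val (p := (· ∈ ⋀[RStalk O x.1]^p (Stalk F x.1))) ((extPower F p).value η x)

/-- The linear map `φ_x : F_x → O_x` given by a section `φ` of `F^*`. -/
def dualAt {F : ModSheaf O} {U : Opens X} (φ : (dualSheaf F).val.obj (op U)) (x : U) :
    Module.Dual (RStalk O x.1) (Stalk F x.1) :=
  (dual F).value φ x

/-- The derivation `ξ_x` of `O_x` given by a section `ξ` of `T`. -/
def tangentAt {U : Opens X} (ξ : (tangentSheaf O).val.obj (op U)) (x : U) :
    Derivation ℂ (RStalk O x.1) (RStalk O x.1) :=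
  (tangent O).value ξ x

/-- The superderivation `δ_x` of `Λ(F_x)` given by a section `δ` of `Der_p Λ(F)`. -/
def derAt {F : ModSheaf O} {p : ℤ} {U : Opens X} (δ : (derSheaf F p).val.obj (op U)) (x : U) :
    Module.End ℂ (ExtStalk F x) :=
  Subtype.val (p := (· ∈ derDeg (RStalk O x.1) (Stalk F x.1) p)) ((derP F p).value δ x)

/-! ### Tensor products and local freeness -/

/-- The presheaf tensor product `U ↦ F(U) ⊗ G(U)`. -/
def preTensor (F G : ModSheaf O) : PresheafOfModules.{0} (O.obj ⋙ forget₂ CommRingCat RingCat) :=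
  PresheafOfModules.Monoidal.tensorObj (R := O.obj) F.val G.val

/-- The tensor product `F ⊗ G` of sheaves of modules, the sheaf associated with
`U ↦ F(U) ⊗ G(U)`. -/
def tensor (F G : ModSheaf O) : ModSheaf O :=
  (PresheafOfModules.sheafification (𝟙 (ringSheaf O).obj)).obj (preTensor F G)

/-- The section of `F ⊗ G` over `U` defined by an element of `F(U) ⊗ G(U)`. -/
def tensorSection (F G : ModSheaf O) (U : Opens X) :
    (F.val.obj (op U)) ⊗[(O.obj.obj (op U) : CommRingCat)] (G.val.obj (op U)) →+
      (tensor F G).val.obj (op U) := by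
  exact ((PresheafOfModules.sheafificationAdjunction (𝟙 (ringSheaf O).obj)).unit.app
    (preTensor F G) |>.app (op U)).hom.toAddMonoidHom

/-- `F` is locally free of rank `r`: every point has an open neighbourhood `U` and sections
`s_1, …, s_r` of `F` over `U` inducing an isomorphism `O|_U^r → F|_U`. -/
def IsLocallyFreeOfRank (F : ModSheaf O) (r : ℕ) : Prop :=
  ∀ x : X, ∃ U : Opens X, x ∈ U ∧ ∃ s : Fin r → F.val.obj (op U), ∀ (V : Opens X) (i : V ⟶ U),
    Function.Bijective (fun c : Fin r → (O.obj.obj (op V) : CommRingCat) =>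
      (∑ k, c k • F.val.map i.op (s k) : F.val.obj (op V)))

end RingedSpace

/-! ### Complex manifolds -/

section Manifold

variable (n : ℕ) (M : Type) [TopologicalSpace M] [ChartedSpace (EuclideanSpace ℂ (Fin n)) M]

/-- The sheaf of holomorphic (i.e. complex `C^∞`) functions on `M`. -/
def holSheaf : TopCat.Sheaf CommRingCat.{0} (TopCat.of M) :=
  smoothSheafCommRing 𝓘(ℂ, EuclideanSpace ℂ (Fin n)) 𝓘(ℂ) M ℂ

/-- The constant functions. -/
def holConst : ℂ →+* ((holSheaf n M).obj.obj (op ⊤) : CommRingCat) :=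
  algebraMap ℂ C^∞⟮𝓘(ℂ, EuclideanSpace ℂ (Fin n)), (⊤ : Opens M); 𝓘(ℂ), ℂ⟯

/-- The `ℂ`-algebra structure of `O_x`, given by the germs of constant functions. -/
instance (x : TopCat.of M) : Algebra ℂ (RStalk (holSheaf n M) x) :=
  ((rgerm (holSheaf n M) (⟨x, trivial⟩ : (⊤ : Opens (TopCat.of M)))).comp (holConst n M)).toAlgebra

end Manifold

end SplitSuper

end

open SplitSuper

/-! The question is local, and it is reduced to algebra in the stalks. A section of each sheaf
involved is a family of algebraic objects over the rings `O_x` that takes sections to sections. A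
`Frame` is a family of bases of the fibers such that the basis vectors, and the coordinates of every
section, are again sections. Frames near every point give local freeness (`isLocallyFree_of_frame`).
A pairing that takes products of frames to frames identifies a tensor product sheaf
(`IsPerfect.isIso_tensorMap`). Exactness becomes exactness in the fibers together with a local
lifting property (`shortExact_toHom`).

In a fiber, let `R` be the ring and `N` a free module with basis `e_k`. The monomials `e_I` form a
basis of the exterior algebra with integer structure constants, so a derivation `D` of `R` extends
to the algebra by acting on coefficients (`nabla`), while a linear form acts by contraction. A
superderivation of degree `p` has the parity of `p`, hence is determined by its values on `R` and on
the `e_k`. If `R` has coordinates `z_i` with a dual basis `∂_i` of derivations, then the `e_I ∂_i`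
with `|I| = p` and the `e_J ∂/∂e_k` with `|J| = p + 1` form a basis of the superderivations of
degree `p` (`derBasis`). The second family is a basis of those vanishing on `R`, a copy of `N^* ⊗
Λ^(p+1) N`; the first restricts to a basis of `Der(R, Λ^p N)`, a copy of `Der R ⊗ Λ^p N`. This is
the exact sequence. In degree `-1` only contractions remain, which gives the dual sheaf.

The analytic input is that the partial derivatives form a basis of all `ℂ`-derivations of `O_x`, no
continuity being assumed. By Hadamard's lemma every germ is a constant plus a combination of the
centered coordinates (`exists_expansion`), so a derivation that kills the coordinates has its values
in every power of the ideal they generate (`derivation_eq_zero_of_expansion`). A holomorphic germ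
vanishing to infinite order is zero, by the identity theorem on complex lines
(`eventually_eq_zero_of_isBigO`). -/

open CategoryTheory TopologicalSpace Opposite
open scoped Manifold ContDiff TensorProduct MonoidalCategory

noncomputable section

namespace SplitSuper

/-! ### The monomial basis of an exterior algebra -/

section ExteriorBasis

variable {R N : Type} [CommRing R] [AddCommGroup N] [Module R N] {m : ℕ}

/-- The structure constants of the exterior algebra on `m` generators. -/
def extConst {m : ℕ} (I J K : Finset (Fin m)) : ℤ :=
  if h : Disjoint I J then
    if I ∪ J = K then
      ((Set.powersetCard.permOfDisjoint (s := (⟨I, rfl⟩ : Set.powersetCard (Fin m) I.card))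
        (t := (⟨J, rfl⟩ : Set.powersetCard (Fin m) J.card)) h).sign : ℤ) else 0
  else 0

/-- The constants are integers independent of `R` and `b`: derivations of `R` kill them, and they
are sections of any sheaf of rings. Both facts are used later. -/
theorem basis_mul (b : Module.Basis (Fin m) R N) (I J : Finset (Fin m)) :
    b.ExteriorAlgebra I * b.ExteriorAlgebra J = ∑ K, extConst I J K • b.ExteriorAlgebra K := by
  by_cases h : Disjoint I J
  · have := ExteriorAlgebra.basis_mul_of_disjoint b
      (⟨I, rfl⟩ : Set.powersetCard (Fin m) I.card) (⟨J, rfl⟩ : Set.powersetCard (Fin m) J.card) h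
    simp only [extConst, h, dif_pos, ite_smul, zero_smul]
    rw [Finset.sum_ite_eq Finset.univ (I ∪ J), if_pos (Finset.mem_univ _)]
    simp only [Set.powersetCard.disjUnion, Finset.disjUnion_eq_union] at this
    exact this
  · have := ExteriorAlgebra.basis_mul_of_not_disjoint b
      (⟨I, rfl⟩ : Set.powersetCard (Fin m) I.card) (⟨J, rfl⟩ : Set.powersetCard (Fin m) J.card) h
    simpa [extConst, h] using this

theorem basis_empty (b : Module.Basis (Fin m) R N) : b.ExteriorAlgebra ∅ = 1 := by
  rw [ExteriorAlgebra.basis_apply_ofCard b (n := 0) rfl]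
  simp [ExteriorAlgebra.ιMulti_family]

theorem basis_singleton (b : Module.Basis (Fin m) R N) (i : Fin m) :
    b.ExteriorAlgebra {i} = ExteriorAlgebra.ι R (b i) := by
  rw [ExteriorAlgebra.basis_apply_ofCard b (n := 1) rfl]
  simp only [ExteriorAlgebra.ιMulti_family, ExteriorAlgebra.ιMulti_apply]
  simp only [List.ofFn_succ, List.ofFn_zero, List.prod_cons, List.prod_nil, mul_one, Function.comp]
  congr 2
  have : Set.powersetCard.ofFinEmbEquiv.symm (Set.powersetCard.ofCard (n := 1) (s := {i}) rfl) 0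
      ∈ ({i} : Finset (Fin m)) := by
    rw [Set.powersetCard.ofFinEmbEquiv_symm_apply]
    exact Finset.orderEmbOfFin_mem _ _ _
  simpa using this

theorem basis_mem (b : Module.Basis (Fin m) R N) (I : Finset (Fin m)) :
    b.ExteriorAlgebra I ∈ ⋀[R]^I.card N := by
  rw [ExteriorAlgebra.basis_eq_coe_basis b (⟨I, rfl⟩ : Set.powersetCard (Fin m) I.card)]
  exact Subtype.property _

/-- The expansion of `a` in the basis of the `q`-th exterior power involves only monomials with `q`
factors. -/
theorem repr_eq_zero_of_card_ne (b : Module.Basis (Fin m) R N) {q : ℕ} {a : ExteriorAlgebra R N}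
    (ha : a ∈ ⋀[R]^q N) {I : Finset (Fin m)} (hI : I.card ≠ q) :
    b.ExteriorAlgebra.repr a I = 0 := by
  have h := (b.exteriorPower q).sum_repr ⟨a, ha⟩
  have h' := congrArg Subtype.val h
  simp only [Submodule.coe_sum, Submodule.coe_smul] at h'
  rw [← h']
  simp only [map_sum, map_smul, Finsupp.coe_finsetSum, Finset.sum_apply, Finsupp.smul_apply]
  refine Finset.sum_eq_zero fun J _ => ?_
  rw [← ExteriorAlgebra.basis_eq_coe_basis, Module.Basis.repr_self, Finsupp.single_apply, if_neg,
    smul_zero]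
  rintro rfl
  exact hI J.2

theorem mul_repr (b : Module.Basis (Fin m) R N) (a c : ExteriorAlgebra R N)
    (K : Finset (Fin m)) : b.ExteriorAlgebra.repr (a * c) K =
      ∑ I, ∑ J, extConst I J K • (b.ExteriorAlgebra.repr a I * b.ExteriorAlgebra.repr c J) := by
  have h (I J : Finset (Fin m)) :
      b.ExteriorAlgebra.repr (b.ExteriorAlgebra I * b.ExteriorAlgebra J) K =
        (extConst I J K : R) := by
    rw [basis_mul]
    simp only [map_sum, map_zsmul, Module.Basis.repr_self, Finsupp.coe_finsetSum,
      Finset.sum_apply, Finsupp.smul_apply, Finsupp.single_apply, smul_ite, smul_zero]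
    rw [Finset.sum_ite_eq' Finset.univ K, if_pos (Finset.mem_univ _)]
    simp
  conv_lhs => rw [← b.ExteriorAlgebra.sum_repr a, ← b.ExteriorAlgebra.sum_repr c]
  simp only [Finset.sum_mul_sum, smul_mul_smul_comm, map_sum, map_smul, Finsupp.coe_finsetSum,
    Finset.sum_apply, Finsupp.smul_apply, h, smul_eq_mul, zsmul_eq_mul]
  exact Finset.sum_congr rfl fun I _ => Finset.sum_congr rfl fun J _ => mul_comm _ _

end ExteriorBasis

/-! ### Degree, parity and contraction -/

section Grading

variable {R N : Type} [CommRing R] [AddCommGroup N] [Module R N]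

theorem gr_natCast (q : ℕ) : gr R N q = ⋀[R]^q N := by simp [gr]

theorem gr_of_neg {q : ℤ} (hq : q < 0) : gr R N q = ⊥ := by simp [gr, not_le.2 hq]

theorem algebraMap_mem_gr (r : R) : algebraMap R (ExteriorAlgebra R N) r ∈ gr R N 0 := by
  rw [show (0 : ℤ) = (0 : ℕ) from rfl, gr_natCast]
  exact SetLike.algebraMap_mem_graded (fun q => ⋀[R]^q N) r

theorem ι_mem_gr (s : N) : ExteriorAlgebra.ι R s ∈ gr R N 1 := by
  rw [show (1 : ℤ) = (1 : ℕ) from rfl, gr_natCast]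
  simp [ExteriorAlgebra.exteriorPower]

theorem mul_mem_gr {p q : ℤ} {a b : ExteriorAlgebra R N} (ha : a ∈ gr R N p)
    (hb : b ∈ gr R N q) : a * b ∈ gr R N (p + q) := by
  obtain hp | hp := lt_or_ge p 0
  · rw [gr_of_neg hp, Submodule.mem_bot] at ha
    simp [ha]
  obtain hq | hq := lt_or_ge q 0
  · rw [gr_of_neg hq, Submodule.mem_bot] at hb
    simp [hb]
  lift p to ℕ using hp
  lift q to ℕ using hq
  rw [gr_natCast] at ha hb
  rw [← Nat.cast_add, gr_natCast]
  exact SetLike.mul_mem_graded (A := fun q => ⋀[R]^q N) ha hb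

theorem gr_le_parityPart (q : ℤ) : gr R N q ≤ parityPart R N (q : ZMod 2) := by
  obtain hq | hq := lt_or_ge q 0
  · rw [gr_of_neg hq]; exact bot_le
  lift q to ℕ using hq
  rw [gr_natCast]
  exact le_iSup (fun j : {n : ℕ // (n : ZMod 2) = ((q : ℤ) : ZMod 2)} =>
    LinearMap.range (CliffordAlgebra.ι (0 : QuadraticForm R N)) ^ (j : ℕ)) ⟨q, by simp⟩

theorem parityPart_disjoint {i j : ZMod 2} (h : i ≠ j) {a : ExteriorAlgebra R N}
    (ha : a ∈ parityPart R N i) (hb : a ∈ parityPart R N j) : a = 0 := by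
  have := (CliffordAlgebra.evenOdd_isCompl (0 : QuadraticForm R N)).disjoint
  have h0 := Submodule.disjoint_def.1 this a
  fin_cases i <;> fin_cases j
  · exact absurd rfl h
  · exact h0 ha hb
  · exact h0 hb ha
  · exact absurd rfl h

/-- Additive maps on the exterior algebra agreeing on all homogeneous components are equal. -/
theorem hom_ext_gr {A : Type} [AddCommGroup A] {f g : ExteriorAlgebra R N →+ A}
    (h : ∀ (q : ℕ), ∀ a ∈ ⋀[R]^q N, f a = g a) : f = g := by
  ext a
  induction a using DirectSum.Decomposition.inductionOn (fun q => ⋀[R]^q N) with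
  | zero => simp
  | homogeneous a => exact h _ _ a.2
  | add a b ha hb => rw [map_add, map_add, ha, hb]

/-- Contraction with a linear form. -/
abbrev contr (φ : Module.Dual R N) : ExteriorAlgebra R N →ₗ[R] ExteriorAlgebra R N :=
  CliffordAlgebra.contractLeft (Q := (0 : QuadraticForm R N)) φ

/-- The parity automorphism. -/
abbrev invol : ExteriorAlgebra R N →ₐ[R] ExteriorAlgebra R N :=
  CliffordAlgebra.involute (Q := (0 : QuadraticForm R N))

/-- With the sign encoded by the parity automorphism, the skew Leibniz rule needs no homogeneity and
follows by induction on the generators making up `a`. -/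
theorem contr_mul (φ : Module.Dual R N) (a b : ExteriorAlgebra R N) :
    contr φ (a * b) = contr φ a * b + invol a * contr φ b := by
  induction a using CliffordAlgebra.left_induction with
  | algebraMap r =>
    rw [CliffordAlgebra.contractLeft_algebraMap_mul, CliffordAlgebra.contractLeft_algebraMap,
      zero_mul, zero_add, AlgHom.commutes]
  | add a c ha hc => rw [add_mul, map_add, ha, hc, map_add, map_add, add_mul, add_mul]; abel
  | ι_mul a s ha =>
    rw [mul_assoc, CliffordAlgebra.contractLeft_ι_mul, ha, CliffordAlgebra.contractLeft_ι_mul,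
      map_mul, CliffordAlgebra.involute_ι, sub_mul, smul_mul_assoc, mul_add, neg_mul, neg_mul,
      mul_assoc, mul_assoc]
    abel

theorem contr_ι (φ : Module.Dual R N) (s : N) :
    contr φ (ExteriorAlgebra.ι R s) = algebraMap R _ (φ s) :=
  CliffordAlgebra.contractLeft_ι _ φ s

theorem contr_algebraMap (φ : Module.Dual R N) (r : R) :
    contr φ (algebraMap R (ExteriorAlgebra R N) r) = 0 :=
  CliffordAlgebra.contractLeft_algebraMap _ φ r

/-- Contracting `s * a` gives `φ s • a` minus `s` times the contraction of `a`, so the degree drops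
by one inductively. -/
theorem contr_mem_gr (φ : Module.Dual R N) {q : ℤ} {a : ExteriorAlgebra R N}
    (ha : a ∈ gr R N q) : contr φ a ∈ gr R N (q + -1) := by
  obtain hq | hq := lt_or_ge q 0
  · rw [gr_of_neg hq, Submodule.mem_bot] at ha
    simp [ha]
  lift q to ℕ using hq
  rw [gr_natCast] at ha
  induction ha using Submodule.pow_induction_on_left' with
  | algebraMap r => rw [contr_algebraMap]; exact zero_mem _
  | add a b i ha hb ha' hb' => rw [map_add]; exact add_mem ha' hb'
  | mem_mul s hs i a ha ha' =>
    obtain ⟨s, rfl⟩ := hs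
    rw [contr_mul, contr_ι, ← Algebra.smul_def]
    have hi : ((i.succ : ℕ) : ℤ) + -1 = i := by push_cast; ring
    rw [hi]
    refine add_mem (Submodule.smul_mem _ _ (by rw [gr_natCast]; exact ha)) ?_
    have h1 : invol (ExteriorAlgebra.ι R s) = -ExteriorAlgebra.ι R s :=
      CliffordAlgebra.involute_ι s
    rw [h1, neg_mul]
    refine neg_mem ?_
    have := mul_mem_gr (ι_mem_gr s) ha'
    rwa [add_comm (1 : ℤ), add_assoc, neg_add_cancel, add_zero] at this

theorem invol_of_parity {i : ZMod 2} {a : ExteriorAlgebra R N} (ha : a ∈ parityPart R N i) :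
    invol a = (-1 : ℤ) ^ i.val • a := by
  have h0 := @CliffordAlgebra.involute_eq_of_mem_even _ _ _ _ _ (0 : QuadraticForm R N) a
  have h1 := @CliffordAlgebra.involute_eq_of_mem_odd _ _ _ _ _ (0 : QuadraticForm R N) a
  have hi : ∀ j : ZMod 2, j = 0 ∨ j = 1 := by decide
  rcases hi i with rfl | rfl
  · rw [ZMod.val_zero, pow_zero, one_smul]
    exact h0 ha
  · rw [ZMod.val_one, pow_one, neg_one_smul]
    exact h1 ha

/-- Generators anticommute, so moving `s` past a product of generators costs one sign per factor,
which is what the parity automorphism records. -/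
theorem ι_mul_eq (s : N) (x : ExteriorAlgebra R N) :
    ExteriorAlgebra.ι R s * x = invol x * ExteriorAlgebra.ι R s := by
  induction x using CliffordAlgebra.left_induction with
  | algebraMap r => rw [AlgHom.commutes]; exact (Algebra.commutes _ _).symm
  | add a c ha hc => rw [mul_add, ha, hc, map_add, add_mul]
  | ι_mul a t ha =>
    have h2 : invol (CliffordAlgebra.ι (0 : QuadraticForm R N) t * a) =
      -(ExteriorAlgebra.ι R t) * invol a := by
      rw [map_mul]; congr 1; exact CliffordAlgebra.involute_ι t
    rw [h2, mul_assoc, ← ha, ← mul_assoc, ← mul_assoc]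
    congr 1
    have := ExteriorAlgebra.ι_add_mul_swap (R := R) s t
    rw [neg_mul]
    exact eq_neg_of_add_eq_zero_left this

/-- Supercommutativity: each of the `q` generators in `a` passes `x` at the cost of `(-1) ^ j`, and
the total sign depends only on `q` modulo 2. -/
theorem parity_mul_eq {i : ZMod 2} {a : ExteriorAlgebra R N} (ha : a ∈ parityPart R N i)
    {j : ZMod 2} {x : ExteriorAlgebra R N} (hx : x ∈ parityPart R N j) :
    a * x = (-1 : ℤ) ^ (i.val * j.val) • (x * a) := by
  induction ha using Submodule.iSup_induction' with
  | zero => simp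
  | add a b ha hb ha' hb' => rw [add_mul, ha', hb', ← smul_add, mul_add]
  | mem q a ha =>
    obtain ⟨q, rfl⟩ := q
    simp only at ha
    have h : a * x = (-1 : ℤ) ^ (q * j.val) • (x * a) := by
      induction ha using Submodule.pow_induction_on_left' with
      | algebraMap r => rw [zero_mul, pow_zero, one_smul]; exact Algebra.commutes _ _
      | add a b i ha hb ha' hb' => rw [add_mul, ha', hb', ← smul_add, mul_add]
      | mem_mul s hs i a ha ha' =>
        obtain ⟨s, rfl⟩ := hs
        have := ι_mul_eq s x
        rw [invol_of_parity hx] at this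
        have h3 : CliffordAlgebra.ι (0 : QuadraticForm R N) s * x =
          (-1 : ℤ) ^ j.val • (x * CliffordAlgebra.ι (0 : QuadraticForm R N) s) := by
          rw [← smul_mul_assoc]; exact this
        rw [mul_assoc, ha', mul_smul_comm, ← mul_assoc, h3, smul_mul_assoc, smul_smul, mul_assoc,
          Nat.succ_mul, pow_add]
    rw [h]
    congr 1
    rw [pow_mul, pow_mul]
    congr 1
    rw [ZMod.val_natCast, neg_one_pow_eq_pow_mod_two]

theorem map_parityPart {p : ℤ} (δ : ExteriorAlgebra R N →+ ExteriorAlgebra R N)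
    (h : ∀ q : ℤ, ∀ a ∈ gr R N q, δ a ∈ gr R N (q + p)) (i : ZMod 2)
    (a : ExteriorAlgebra R N) (ha : a ∈ parityPart R N i) :
    δ a ∈ parityPart R N (i + (p : ZMod 2)) := by
  induction ha using Submodule.iSup_induction' with
  | zero => rw [map_zero]; exact zero_mem _
  | add a b ha hb ha' hb' => rw [map_add]; exact add_mem ha' hb'
  | mem q a ha =>
    obtain ⟨q, rfl⟩ := q
    have := gr_le_parityPart _ (h q a (by rw [gr_natCast]; exact ha))
    simpa using this

end Grading

/-! ### Superderivations of a fixed degree -/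

section Super

variable {R N : Type} [CommRing R] [Algebra ℂ R] [AddCommGroup N] [Module R N] [Module ℂ N]
  [IsScalarTower ℂ R N] {m : ℕ}

/-- `allDer` only provides a sum of an even and an odd superderivation. The degree condition kills
the summand of the wrong parity, so that a single Leibniz rule becomes available. -/
theorem mem_superDer_of_mem_derDeg {p : ℤ} {δ : Module.End ℂ (ExteriorAlgebra R N)}
    (h : δ ∈ derDeg R N p) : δ ∈ superDer R N (p : ZMod 2) := by
  obtain ⟨h1, h2⟩ := h
  obtain ⟨δ₀, h₀, δ₁, h₁, rfl⟩ := Submodule.mem_sup.1 h1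
  -- On a homogeneous `a` of degree `q`, the value `d' a` has parity `q + ε'` by assumption, and
  -- parity `q + ε` as the difference of `(d + d') a` and `d a`. Hence it is zero.
  have key : ∀ (ε ε' : ZMod 2), ε ≠ ε' → ∀ d d' : Module.End ℂ (ExteriorAlgebra R N),
      d ∈ superDer R N ε → d' ∈ superDer R N ε' → (p : ZMod 2) = ε →
      (∀ q : ℤ, ∀ a ∈ gr R N q, (d + d') a ∈ gr R N (q + p)) → d' = 0 := by
    intro ε ε' hne d d' hd hd' hp hdeg
    have : d'.toAddMonoidHom = 0 := by
      refine hom_ext_gr fun q a ha => ?_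
      rw [← gr_natCast] at ha
      have e1 := gr_le_parityPart _ (hdeg q a ha)
      have ha' := gr_le_parityPart _ ha
      have e2 := hd.1 _ a ha'
      have e3 := hd'.1 _ a ha'
      push_cast at e1 e2 e3
      rw [hp] at e1
      refine parityPart_disjoint (i := (q : ZMod 2) + ε) (j := (q : ZMod 2) + ε')
        (fun h => hne (add_left_cancel h)) ?_ e3
      have := sub_mem e1 e2
      simpa using this
    ext a
    exact DFunLike.congr_fun this a
  have hp : (p : ZMod 2) = 0 ∨ (p : ZMod 2) = 1 := by
    generalize (p : ZMod 2) = i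
    revert i
    decide
  rcases hp with hp | hp
  · have := key 0 1 (by decide) δ₀ δ₁ h₀ h₁ hp h2
    rw [hp, this, add_zero]; exact h₀
  · have := key 1 0 (by decide) δ₁ δ₀ h₁ h₀ hp (by simpa only [add_comm δ₁] using h2)
    rw [hp, this, zero_add]; exact h₁

/-- The algebra is generated by `R` and `N`, and the Leibniz rule with an odd generator as left
factor carries the induction. -/
theorem superDer_eq_zero {ε : ZMod 2} {δ : Module.End ℂ (ExteriorAlgebra R N)}
    (h : δ ∈ superDer R N ε) (hR : ∀ r, δ (algebraMap R _ r) = 0)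
    (hN : ∀ s, δ (ExteriorAlgebra.ι R s) = 0) : δ = 0 := by
  ext a
  induction a using CliffordAlgebra.left_induction with
  | algebraMap r => exact hR r
  | add a b ha hb => simp [ha, hb]
  | ι_mul a s ha =>
    have := h.2 1 _ (CliffordAlgebra.ι_mem_evenOdd_one (0 : QuadraticForm R N) s) a
    rw [this, ha]
    simp only [LinearMap.zero_apply, mul_zero, smul_zero, add_zero]
    have := hN s
    rw [ExteriorAlgebra.ι] at this
    rw [this, zero_mul]

theorem derDeg_ext {p : ℤ} {δ δ' : Module.End ℂ (ExteriorAlgebra R N)}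
    (h : δ ∈ derDeg R N p) (h' : δ' ∈ derDeg R N p)
    (hR : ∀ r, δ (algebraMap R _ r) = δ' (algebraMap R _ r))
    (hN : ∀ s, δ (ExteriorAlgebra.ι R s) = δ' (ExteriorAlgebra.ι R s)) : δ = δ' := by
  rw [← sub_eq_zero]
  exact superDer_eq_zero (mem_superDer_of_mem_derDeg (sub_mem h h'))
    (fun r => by simp [hR]) (fun s => by simp [hN])

theorem derDeg_leibniz_algebraMap {p : ℤ} {δ : Module.End ℂ (ExteriorAlgebra R N)}
    (h : δ ∈ derDeg R N p) (r : R) (a : ExteriorAlgebra R N) :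
    δ (r • a) = δ (algebraMap R _ r) * a + r • δ a := by
  have := (mem_superDer_of_mem_derDeg h).2 0 (algebraMap R _ r)
    (by simpa using gr_le_parityPart _ (algebraMap_mem_gr (N := N) r)) a
  rw [Algebra.smul_def, this, ZMod.val_zero, mul_zero, pow_zero, one_smul, Algebra.smul_def]

/-- Criterion for membership: the shift of degree already implies the shift of parity, so only the
sign rule for the parity of `p` is left to check. -/
theorem mem_derDeg {p : ℤ} {δ : Module.End ℂ (ExteriorAlgebra R N)}
    (hδ : ∀ q : ℤ, ∀ a ∈ gr R N q, δ a ∈ gr R N (q + p))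
    (hl : ∀ i, ∀ a ∈ parityPart R N i, ∀ b,
      δ (a * b) = δ a * b + (-1 : ℤ) ^ ((p : ZMod 2).val * i.val) • (a * δ b)) :
    δ ∈ derDeg R N p := by
  have h : δ ∈ superDer R N (p : ZMod 2) := ⟨map_parityPart δ.toAddMonoidHom hδ, hl⟩
  refine ⟨?_, hδ⟩
  have hp : (p : ZMod 2) = 0 ∨ (p : ZMod 2) = 1 := by
    generalize (p : ZMod 2) = i
    revert i
    decide
  rcases hp with hp | hp <;> rw [hp] at h
  · exact Submodule.mem_sup_left h
  · exact Submodule.mem_sup_right h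

/-- The product of an element of the exterior algebra and a `ℂ`-linear endomorphism. -/
def mulEnd (η : ExteriorAlgebra R N) (δ : Module.End ℂ (ExteriorAlgebra R N)) :
    Module.End ℂ (ExteriorAlgebra R N) :=
  LinearMap.mulLeft ℂ η ∘ₗ δ

theorem mulEnd_apply (η : ExteriorAlgebra R N) (δ : Module.End ℂ (ExteriorAlgebra R N))
    (a : ExteriorAlgebra R N) : mulEnd η δ a = η * δ a := rfl

/-- In the second Leibniz term `η` has to pass `a`. The resulting sign multiplies the sign of `δ` to
the sign belonging to degree `p + q`. -/
theorem mulEnd_mem_derDeg {p q : ℤ} {η : ExteriorAlgebra R N} (hη : η ∈ gr R N p)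
    {δ : Module.End ℂ (ExteriorAlgebra R N)} (hδ : δ ∈ derDeg R N q) :
    mulEnd η δ ∈ derDeg R N (p + q) := by
  refine mem_derDeg (fun r a ha => ?_) (fun i a ha b => ?_)
  · rw [mulEnd_apply, add_left_comm]
    exact mul_mem_gr hη (hδ.2 r a ha)
  · rw [mulEnd_apply, mulEnd_apply, mulEnd_apply, (mem_superDer_of_mem_derDeg hδ).2 i a ha b,
      mul_add, mul_smul_comm, ← mul_assoc, ← mul_assoc, ← mul_assoc,
      parity_mul_eq (gr_le_parityPart _ hη) ha, smul_mul_assoc, smul_smul]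
    congr 2
    push_cast
    generalize (p : ZMod 2) = x
    generalize (q : ZMod 2) = y
    -- Only residues modulo 2 enter, so the sign identity is a finite check.
    have h : ∀ i x y : ZMod 2, (-1 : ℤ) ^ (y.val * i.val) * (-1) ^ (x.val * i.val) =
      (-1) ^ ((x + y).val * i.val) := by decide
    exact h i x y

theorem contr_mem_derDeg (φ : Module.Dual R N) :
    (contr φ).restrictScalars ℂ ∈ derDeg R N (-1) := by
  refine mem_derDeg (fun q a ha => contr_mem_gr φ ha) (fun i a ha b => ?_)
  simp only [LinearMap.coe_restrictScalars]
  rw [contr_mul, invol_of_parity ha, smul_mul_assoc]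
  have h : ∀ i : ZMod 2, (-1 : ℤ) ^ i.val = (-1) ^ ((((-1 : ℤ) : ZMod 2)).val * i.val) := by
    decide
  rw [h]

/-- The derivation of the exterior algebra extending the derivation `ξ` of `R` and vanishing on
the basis `b`. -/
def nabla (b : Module.Basis (Fin m) R N) (ξ : Derivation ℂ R R) :
    Module.End ℂ (ExteriorAlgebra R N) where
  toFun a := ∑ I, ξ (b.ExteriorAlgebra.repr a I) • b.ExteriorAlgebra I
  map_add' a c := by simp [add_smul, Finset.sum_add_distrib]
  map_smul' c a := by
    rw [RingHom.id_apply, Finset.smul_sum]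
    refine Finset.sum_congr rfl fun I _ => ?_
    rw [← algebraMap_smul R c a, map_smul, Finsupp.smul_apply, algebraMap_smul, Derivation.map_smul,
      smul_assoc]

theorem nabla_apply (b : Module.Basis (Fin m) R N) (ξ : Derivation ℂ R R)
    (a : ExteriorAlgebra R N) :
    nabla b ξ a = ∑ I, ξ (b.ExteriorAlgebra.repr a I) • b.ExteriorAlgebra I := rfl

theorem nabla_repr (b : Module.Basis (Fin m) R N) (ξ : Derivation ℂ R R)
    (a : ExteriorAlgebra R N) (I : Finset (Fin m)) :
    b.ExteriorAlgebra.repr (nabla b ξ a) I = ξ (b.ExteriorAlgebra.repr a I) := by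
  change b.ExteriorAlgebra.repr (∑ I, ξ (b.ExteriorAlgebra.repr a I) • b.ExteriorAlgebra I) I = _
  rw [Module.Basis.repr_sum_self]

/-- Each coefficient of a product is an integral bilinear expression in the coefficients of the
factors, and `ξ` obeys the Leibniz rule on it without touching the integers. -/
theorem nabla_mul (b : Module.Basis (Fin m) R N) (ξ : Derivation ℂ R R)
    (a c : ExteriorAlgebra R N) : nabla b ξ (a * c) = nabla b ξ a * c + a * nabla b ξ c := by
  refine b.ExteriorAlgebra.ext_elem fun K => ?_
  simp only [map_add, Finsupp.add_apply, nabla_repr, mul_repr, map_sum, map_zsmul,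
    Derivation.leibniz, smul_eq_mul, ← Finset.sum_add_distrib, ← smul_add]
  refine Finset.sum_congr rfl fun I _ => Finset.sum_congr rfl fun J _ => ?_
  rw [add_comm, mul_comm (b.ExteriorAlgebra.repr c J)]

theorem nabla_algebraMap (b : Module.Basis (Fin m) R N) (ξ : Derivation ℂ R R) (r : R) :
    nabla b ξ (algebraMap R _ r) = algebraMap R _ (ξ r) := by
  refine b.ExteriorAlgebra.ext_elem fun K => ?_
  rw [nabla_repr, Algebra.algebraMap_eq_smul_one, Algebra.algebraMap_eq_smul_one, ← basis_empty b]
  simp only [map_smul, Module.Basis.repr_self, Finsupp.smul_apply, Finsupp.single_apply]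
  split_ifs <;> simp

theorem nabla_ι (b : Module.Basis (Fin m) R N) (ξ : Derivation ℂ R R) (i : Fin m) :
    nabla b ξ (ExteriorAlgebra.ι R (b i)) = 0 := by
  refine b.ExteriorAlgebra.ext_elem fun K => ?_
  rw [nabla_repr, ← basis_singleton b]
  simp only [Module.Basis.repr_self, Finsupp.single_apply]
  split_ifs <;> simp

theorem nabla_mem_gr (b : Module.Basis (Fin m) R N) (ξ : Derivation ℂ R R) {q : ℤ}
    {a : ExteriorAlgebra R N} (ha : a ∈ gr R N q) : nabla b ξ a ∈ gr R N q := by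
  obtain hq | hq := lt_or_ge q 0
  · rw [gr_of_neg hq, Submodule.mem_bot] at ha
    simp [ha]
  lift q to ℕ using hq
  rw [gr_natCast] at ha ⊢
  change ∑ I, ξ (b.ExteriorAlgebra.repr a I) • b.ExteriorAlgebra I ∈ _
  refine Submodule.sum_mem _ fun I _ => ?_
  by_cases hI : I.card = q
  · subst hI
    exact Submodule.smul_mem _ _ (basis_mem b I)
  · rw [repr_eq_zero_of_card_ne b ha hI]
    simp

theorem nabla_mem_derDeg (b : Module.Basis (Fin m) R N) (ξ : Derivation ℂ R R) :
    nabla b ξ ∈ derDeg R N 0 := by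
  refine mem_derDeg (fun q a ha => ?_) (fun i a _ c => ?_)
  · rw [add_zero]; exact nabla_mem_gr b ξ ha
  · rw [nabla_mul]; simp

end Super

/-! ### Gluing germs to sections -/

section Gluing

/-- A family of germs that is locally given by sections is given by a section. -/
theorem exists_section_of_locally {X : TopCat.{0}} {C : Type 1} [Category.{0} C]
    {FC : C → C → Type} {CC : C → Type} [∀ A B, FunLike (FC A B) (CC A) (CC B)]
    [ConcreteCategory.{0} C FC] [Limits.HasColimits C]
    [Limits.PreservesFilteredColimits (forget C)] [Limits.HasLimits C]
    [Limits.PreservesLimits (forget C)] [(forget C).ReflectsIsomorphisms]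
    (P : TopCat.Sheaf C X) {U : Opens X}
    (f : ∀ x : U, ToType (TopCat.Presheaf.stalk P.obj x.1))
    (h : ∀ x : U, ∃ (V : Opens X) (_ : x.1 ∈ V) (i : V ⟶ U) (s : ToType (P.obj.obj (op V))),
      ∀ y : V, f (i y) = TopCat.Presheaf.germ P.obj V y.1 y.2 s) :
    ∃ s : ToType (P.obj.obj (op U)), ∀ x : U, f x = TopCat.Presheaf.germ P.obj U x.1 x.2 s := by
  choose V hV i s hs using h
  -- On overlaps the local sections have the same germs, namely the values of `f`, and a section of
  -- a sheaf is determined by its germs.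
  have hc : TopCat.Presheaf.IsCompatible P.1 V s := by
    intro x y
    refine TopCat.Presheaf.section_ext P _ _ _ fun z hz => ?_
    have e1 := TopCat.Presheaf.germ_res_apply P.obj (Opens.infLELeft (V x) (V y)) z hz (s x)
    have e2 := TopCat.Presheaf.germ_res_apply P.obj (Opens.infLERight (V x) (V y)) z hz (s y)
    refine e1.trans (Eq.trans ?_ e2.symm)
    rw [← hs x ⟨z, hz.1⟩, ← hs y ⟨z, hz.2⟩]
    rfl
  obtain ⟨t, ht, -⟩ := TopCat.Sheaf.existsUnique_gluing' P V U i
    (fun x hx => Opens.mem_iSup.2 ⟨⟨x, hx⟩, hV ⟨x, hx⟩⟩) s hc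
  refine ⟨t, fun x => ?_⟩
  have e := TopCat.Presheaf.germ_res_apply P.obj (i x) x.1 (hV x) t
  have e' := hs x ⟨x.1, hV x⟩
  rw [← ht x] at e'
  exact e'.trans e

end Gluing

/-! ### Sections of a sheaf as families of germs -/

section Sections

variable {X : TopCat.{0}} {O : TopCat.Sheaf CommRingCat.{0} X}

theorem pred_congr {T : X → Type} {P : TopCat.PrelocalPredicate T} {U : Opens X}
    {f g : ∀ x : U, T x} (hg : P.pred g) (h : ∀ x, f x = g x) : P.pred f :=
  (funext h : f = g) ▸ hg

theorem rgerm_injective {U : Opens X} {a b : (O.obj.obj (op U) : CommRingCat)}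
    (h : ∀ x : U, rgerm O x a = rgerm O x b) : a = b :=
  TopCat.Presheaf.section_ext O U a b fun x hx => h ⟨x, hx⟩

theorem exists_rgerm {U : Opens X} {f : ∀ x : U, RStalk O x} (hf : (ringSec O).pred f) :
    ∃ g : (O.obj.obj (op U) : CommRingCat), ∀ x : U, f x = rgerm O x g :=
  exists_section_of_locally O f fun x => by
    obtain ⟨V, hV, i, g, hg⟩ := hf x
    exact ⟨V, hV, i, g, hg⟩

theorem ringSec_rgerm {U : Opens X} (g : (O.obj.obj (op U) : CommRingCat)) :
    (ringSec O).pred (U := U) (fun x => rgerm O x g) :=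
  TopCat.PrelocalPredicate.sheafifyOf
    (P := { pred := fun {U} f => ∃ g : (O.obj.obj (op U) : CommRingCat), ∀ x : U, f x = rgerm O x g
            res := fun i f ⟨g, hg⟩ => ⟨O.obj.map i.op g, fun x => by
              rw [rgerm_res]; exact hg (i x)⟩ }) ⟨g, fun _ => rfl⟩

theorem ringSec_iff {U : Opens X} {f : ∀ x : U, RStalk O x} :
    (ringSec O).pred f ↔ ∃ g : (O.obj.obj (op U) : CommRingCat), ∀ x : U, f x = rgerm O x g :=
  ⟨exists_rgerm, fun ⟨g, hg⟩ => by
    rw [show f = fun x => rgerm O x g from funext hg]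
    exact ringSec_rgerm g⟩

theorem ringSec_mul {U : Opens X} {f g : ∀ x : U, RStalk O x}
    (hf : (ringSec O).pred f) (hg : (ringSec O).pred g) :
    (ringSec O).pred (fun x => f x * g x) := by
  obtain ⟨a, ha⟩ := exists_rgerm hf
  simpa only [ha, smul_eq_mul] using! ringSec_smul a hg

theorem ringSec_sum {U : Opens X} {κ : Type} (S : Finset κ) {f : κ → ∀ x : U, RStalk O x}
    (hf : ∀ k ∈ S, (ringSec O).pred (f k)) : (ringSec O).pred (fun x => ∑ k ∈ S, f k x) := by
  classical
  induction S using Finset.induction_on with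
  | empty => simpa using ringSec_zero O U
  | insert k S hk ih =>
    simp only [Finset.sum_insert hk]
    exact ringSec_add (hf k (Finset.mem_insert_self k S))
      (ih fun l hl => hf l (Finset.mem_insert_of_mem hl))

theorem ringSec_intCast (U : Opens X) (c : ℤ) :
    (ringSec O).pred (U := U) (fun _ => (c : RStalk O _)) := by
  have := ringSec_rgerm (O := O) (U := U) (c : (O.obj.obj (op U) : CommRingCat))
  simpa only [map_intCast] using this

/-- The `O`-module of sections of `F` as a sheaf of groups. -/
abbrev abSheaf (F : ModSheaf O) : TopCat.Sheaf Ab.{0} X where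
  obj := F.val.presheaf
  property := F.isSheaf

theorem germ_injective {F : ModSheaf O} {U : Opens X} {a b : F.val.obj (op U)}
    (h : ∀ x : U, germ F x a = germ F x b) : a = b :=
  TopCat.Presheaf.section_ext (abSheaf F) U a b fun x hx => h ⟨x, hx⟩

theorem exists_germ {F : ModSheaf O} {U : Opens X} {f : ∀ x : U, Stalk F x}
    (hf : (modSec F).pred f) : ∃ s : F.val.obj (op U), ∀ x : U, f x = germ F x s :=
  exists_section_of_locally (abSheaf F) f fun x => by
    obtain ⟨V, hV, i, g, hg⟩ := hf x
    exact ⟨V, hV, i, g, hg⟩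

theorem modSec_germ {F : ModSheaf O} {U : Opens X} (s : F.val.obj (op U)) :
    (modSec F).pred (U := U) (fun x => germ F x s) :=
  TopCat.PrelocalPredicate.sheafifyOf
    (P := { pred := fun {U} f => ∃ s : F.val.obj (op U), ∀ x : U, f x = germ F x s
            res := fun i f ⟨s, hs⟩ => ⟨F.val.map i.op s, fun x => by
              rw [germ_res]; exact hs (i x)⟩ }) ⟨s, fun _ => rfl⟩

theorem rgerm_surjective {x : X} {U : Opens X} (hx : x ∈ U) (r : RStalk O x) :
    ∃ (V : Opens X) (hV : x ∈ V) (_ : V ⟶ U) (g : (O.obj.obj (op V) : CommRingCat)),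
      rgerm O ⟨x, hV⟩ g = r := by
  obtain ⟨V, hVU, hV, g, hg⟩ := TopCat.Presheaf.exists_le_germ_eq O.obj r hx
  exact ⟨V, hV, homOfLE hVU, g, hg⟩

theorem germ_surjective {F : ModSheaf O} {x : X} {U : Opens X} (hx : x ∈ U) (r : Stalk F x) :
    ∃ (V : Opens X) (hV : x ∈ V) (_ : V ⟶ U) (s : F.val.obj (op V)), germ F ⟨x, hV⟩ s = r := by
  obtain ⟨V, hVU, hV, g, hg⟩ := TopCat.Presheaf.exists_le_germ_eq (C := Ab.{0}) F.val.presheaf r hx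
  exact ⟨V, hV, homOfLE hVU, g, hg⟩

theorem exists_res_eq_of_germ_eq {F : ModSheaf O} {U : Opens X} (x : U) {s t : F.val.obj (op U)}
    (h : germ F x s = germ F x t) :
    ∃ (W : Opens X) (_ : x.1 ∈ W) (i : W ⟶ U), F.val.map i.op s = F.val.map i.op t := by
  obtain ⟨W, hW, i, j, e⟩ := TopCat.Presheaf.germ_eq (C := Ab.{0}) F.val.presheaf x.1 x.2 x.2 s t h
  obtain rfl := Subsingleton.elim i j
  exact ⟨W, hW, i, e⟩

/-- Finitely many germs at a point are germs of sections over a common neighbourhood. -/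
theorem exists_rgerm_family {κ : Type} [Fintype κ] {x : X} {U : Opens X} (hx : x ∈ U)
    (r : κ → RStalk O x) :
    ∃ (V : Opens X) (hV : x ∈ V) (_ : V ⟶ U) (g : κ → (O.obj.obj (op V) : CommRingCat)),
      ∀ k, rgerm O ⟨x, hV⟩ (g k) = r k := by
  choose V hV i g hg using fun k => rgerm_surjective hx (r k)
  have hW : x ∈ U ⊓ Finset.univ.inf V := ⟨hx, Finset.inf_induction (p := fun W : Opens X => x ∈ W)
    trivial (fun _ h _ h' => ⟨h, h'⟩) (fun k _ => hV k)⟩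
  have hk : ∀ k, U ⊓ Finset.univ.inf V ≤ V k := fun k =>
    inf_le_right.trans (Finset.inf_le (Finset.mem_univ k))
  exact ⟨_, hW, homOfLE inf_le_left, fun k => O.obj.map (homOfLE (hk k)).op (g k),
    fun k => (rgerm_res (homOfLE (hk k)) ⟨x, hW⟩ (g k)).trans (hg k)⟩

end Sections

/-! ### Frames and local freeness -/

namespace GermFamily

variable {X : TopCat.{0}} {O : TopCat.Sheaf CommRingCat.{0} X}

theorem sum_sec (G : GermFamily O) {U : Opens X} {κ : Type} (S : Finset κ)
    {f : κ → ∀ x : U, G.fiber x} (hf : ∀ k ∈ S, G.sec.pred (f k)) :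
    G.sec.pred (fun x => ∑ k ∈ S, f k x) := by
  have := (G.sections U).sum_mem (t := S) (f := f) hf
  rw [Finset.sum_fn] at this
  exact this

theorem smul_sec' (G : GermFamily O) {U : Opens X} {a : ∀ x : U, RStalk O x}
    (ha : (ringSec O).pred a) {f : ∀ x : U, G.fiber x} (hf : G.sec.pred f) :
    G.sec.pred (fun x => a x • f x) := by
  obtain ⟨g, hg⟩ := exists_rgerm ha
  simpa only [hg] using G.smul_sec g hf

/-- A frame of `G` over `U`: sections that form a basis of every fiber, such that the coordinates
of sections of `G` are sections of `O`. -/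
structure Frame (G : GermFamily O) (U : Opens X) (κ : Type) where
  basis : ∀ x : U, Module.Basis κ (RStalk O x) (G.fiber x)
  sec_basis : ∀ k, G.sec.pred (fun x : U => basis x k)
  sec_repr : ∀ {V : Opens X} (j : V ⟶ U) {f : ∀ x : V, G.fiber x}, G.sec.pred f →
    ∀ k, (ringSec O).pred (fun x : V => (basis (j x)).repr (f x) k)

namespace Frame

variable {G : GermFamily O} {U : Opens X} {κ : Type} (e : G.Frame U κ)

/-- Restriction of a frame. -/
def restrict {V : Opens X} (j : V ⟶ U) : G.Frame V κ where
  basis x := e.basis (j x)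
  sec_basis k := G.sec.res j _ (e.sec_basis k)
  sec_repr i _ hf := e.sec_repr (i ≫ j) hf

/-- Reindexing of a frame. -/
def reindex {κ' : Type} (σ : κ ≃ κ') : G.Frame U κ' where
  basis x := (e.basis x).reindex σ
  sec_basis k := by
    simp only [Module.Basis.reindex_apply]
    exact e.sec_basis _
  sec_repr j _ hf k := by
    simp only [Module.Basis.repr_reindex_apply]
    exact e.sec_repr j hf _

end Frame

theorem value_add (G : GermFamily O) {U : Opens X} (f g : G.toModSheaf.val.obj (op U)) (x : U) :
    G.value (f + g) x = G.value f x + G.value g x := rfl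

theorem value_sum (G : GermFamily O) {U : Opens X} {κ : Type} (S : Finset κ)
    (f : κ → G.toModSheaf.val.obj (op U)) (x : U) :
    G.value (∑ k ∈ S, f k) x = ∑ k ∈ S, G.value (f k) x := by
  classical
  induction S using Finset.induction_on with
  | empty => rfl
  | insert k S hk ih => rw [Finset.sum_insert hk, Finset.sum_insert hk, value_add, ih]

theorem value_ext (G : GermFamily O) {U : Opens X} {f g : G.toModSheaf.val.obj (op U)}
    (h : ∀ x, G.value f x = G.value g x) : f = g :=
  Subtype.ext (funext h)

theorem value_sec (G : GermFamily O) {U : Opens X} (f : G.toModSheaf.val.obj (op U)) :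
    G.sec.pred (G.value f) := Subtype.property (p := (· ∈ G.sections U)) f

/-- The section given by a family. -/
def mkSec (G : GermFamily O) {U : Opens X} (f : ∀ x : U, G.fiber x) (hf : G.sec.pred f) :
    G.toModSheaf.val.obj (op U) := (⟨f, hf⟩ : G.sections U)

/-- Over every smaller open set, the coordinates of a section with respect to the frame glue to
elements of the ring of sections (existence), and they are determined germ by germ (uniqueness). -/
theorem isLocallyFree_of_frame (G : GermFamily O) {κ : Type} [Fintype κ]
    (h : ∀ x : X, ∃ U : Opens X, x ∈ U ∧ Nonempty (G.Frame U κ)) :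
    IsLocallyFreeOfRank G.toModSheaf (Fintype.card κ) := by
  intro x
  obtain ⟨U, hx, ⟨e₀⟩⟩ := h x
  let e := e₀.reindex (Fintype.equivFin κ)
  have key : ∀ (V : Opens X) (i : V ⟶ U)
      (c : Fin (Fintype.card κ) → (O.obj.obj (op V) : CommRingCat)) (x : V),
      G.value (∑ k, c k • G.toModSheaf.val.map i.op (G.mkSec _ (e.sec_basis k)) :
        G.toModSheaf.val.obj (op V)) x = ∑ k, rgerm O x (c k) • e.basis (i x) k := by
    intro V i c x
    exact (G.value_sum _ _ x).trans rfl
  refine ⟨U, hx, fun k => G.mkSec _ (e.sec_basis k), fun V i =>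
    ⟨fun c c' hc => ?_, fun f => ?_⟩⟩
  · funext k
    refine rgerm_injective fun x => ?_
    have := congrArg (fun f => (e.basis (i x)).repr (G.value f x) k) hc
    simp only [key] at this
    rwa [Module.Basis.repr_sum_self, Module.Basis.repr_sum_self] at this
  · choose c hc using fun k => exists_rgerm (e.sec_repr i (G.value_sec f) k)
    refine ⟨c, G.value_ext fun x => (key V i c x).trans ?_⟩
    refine Eq.trans ?_ ((e.basis (i x)).sum_repr (G.value f x))
    exact Finset.sum_congr rfl fun k _ => by rw [hc]

end GermFamily

/-! ### Frames of a locally free sheaf of modules -/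

section StalkFamily

variable {X : TopCat.{0}} {O : TopCat.Sheaf CommRingCat.{0} X}

theorem modSec_iff {F : ModSheaf O} {U : Opens X} {f : ∀ x : U, Stalk F x} :
    (modSec F).pred f ↔ ∃ s : F.val.obj (op U), ∀ x : U, f x = germ F x s :=
  ⟨exists_germ, fun ⟨g, hg⟩ => by
    rw [show f = fun x => germ F x g from funext hg]
    exact modSec_germ g⟩

/-- The family of stalks of `F`. -/
def stalkFamily (F : ModSheaf O) : GermFamily O where
  fiber x := Stalk F x
  sec := modSec F
  zero_sec U := modSec_iff.2 ⟨0, fun x => (map_zero (germ F x)).symm⟩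
  add_sec hf hg := by
    obtain ⟨s, hs⟩ := exists_germ hf
    obtain ⟨t, ht⟩ := exists_germ hg
    exact modSec_iff.2 ⟨s + t, fun x => by rw [map_add, hs, ht]⟩
  smul_sec a f hf := by
    obtain ⟨s, hs⟩ := exists_germ hf
    exact modSec_iff.2 ⟨a • s, fun x => by rw [germ_smul, hs]⟩

theorem germ_sum_smul (F : ModSheaf O) {U : Opens X} {κ : Type} (S : Finset κ) (x : U)
    (c : κ → (O.obj.obj (op U) : CommRingCat)) (s : κ → F.val.obj (op U)) :
    germ F x (∑ k ∈ S, c k • s k) = ∑ k ∈ S, rgerm O x (c k) • germ F x (s k) := by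
  rw [map_sum]
  exact Finset.sum_congr rfl fun k _ => germ_smul F x (c k) (s k)

/-- The germs of local generators form bases of the stalks: a relation, or an element to be
expressed, at one point is represented over a neighbourhood, where local freeness applies. -/
theorem exists_frame {F : ModSheaf O} {m : ℕ} (hF : IsLocallyFreeOfRank F m) (x : X) :
    ∃ U : Opens X, x ∈ U ∧ Nonempty ((stalkFamily F).Frame U (Fin m)) := by
  obtain ⟨U, hx, s, hs⟩ := hF x
  have hb : ∀ y : U, ∃ b : Module.Basis (Fin m) (RStalk O y.1) (Stalk F y.1),
      ∀ k, b k = germ F y (s k) := by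
    intro y
    have hli : LinearIndependent (RStalk O y.1) (fun k => germ F y (s k)) := by
      rw [Fintype.linearIndependent_iff]
      intro c hc
      obtain ⟨V, hV, i, g, hg⟩ := exists_rgerm_family y.2 c
      have h1 : germ F ⟨y.1, hV⟩ (∑ k, g k • F.val.map i.op (s k) : F.val.obj (op V)) =
          germ F ⟨y.1, hV⟩ 0 := by
        refine (germ_sum_smul F Finset.univ (⟨y.1, hV⟩ : V) g _).trans ?_
        rw [map_zero, ← hc]
        refine Finset.sum_congr rfl fun k _ => ?_
        rw [hg, germ_res]
      obtain ⟨W, hW, j, h2⟩ := exists_res_eq_of_germ_eq (⟨y.1, hV⟩ : V) h1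
      -- The relation holds at the germ, hence over a smaller `W`, where uniqueness of coefficients
      -- makes all of them vanish.
      have h3 : (fun k => O.obj.map j.op (g k)) = fun _ => 0 := by
        refine (hs W (j ≫ i)).1 (germ_injective fun z => ?_)
        beta_reduce
        have h4 := congrArg (germ F z) h2
        rw [germ_res, germ_res, map_zero] at h4
        have h5 := (germ_sum_smul F Finset.univ (⟨z.1, j.le z.2⟩ : V) g _).symm.trans h4
        refine (germ_sum_smul F Finset.univ z _ _).trans
          (Eq.trans ?_ (germ_sum_smul F Finset.univ z (fun _ => 0) _).symm)
        refine (Eq.trans ?_ h5).trans ?_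
        · refine Finset.sum_congr rfl fun k _ => ?_
          exact congrArg₂ (· • ·) (rgerm_res j z (g k)) ((germ_res F (j ≫ i) z (s k)).trans
            (germ_res F i ⟨z.1, j.le z.2⟩ (s k)).symm)
        · exact (Finset.sum_eq_zero fun k _ => by rw [map_zero]; exact zero_smul _ _).symm
      intro k
      have h4 := congrArg (rgerm O (⟨y.1, hW⟩ : W)) (congrFun h3 k)
      rw [map_zero, rgerm_res] at h4
      rw [← hg]
      exact h4
    have hsp : ⊤ ≤ Submodule.span (RStalk O y.1) (Set.range fun k => germ F y (s k)) := by
      rintro t -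
      obtain ⟨V, hV, i, t, rfl⟩ := germ_surjective y.2 t
      obtain ⟨c, rfl⟩ := (hs V i).2 t
      beta_reduce
      refine (germ_sum_smul F Finset.univ (⟨y.1, hV⟩ : V) c _) ▸ ?_
      refine Submodule.sum_mem _ fun k _ => Submodule.smul_mem _ _ (Submodule.subset_span ⟨k, ?_⟩)
      exact (germ_res F i ⟨y.1, hV⟩ (s k)).symm
    exact ⟨Module.Basis.mk hli hsp, fun k => Module.Basis.mk_apply hli hsp k⟩
  choose b hb using hb
  refine ⟨U, hx, ⟨b, fun k => ?_, fun {V} j f hf k => ?_⟩⟩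
  · exact (funext fun y => (hb y k).symm : (fun y => germ F y (s k)) = _) ▸ modSec_germ (s k)
  · obtain ⟨t, ht⟩ := exists_germ hf
    obtain ⟨c, rfl⟩ := (hs V j).2 t
    refine ringSec_iff.2 ⟨c k, fun y => ?_⟩
    beta_reduce at ht
    have h2 : f y = ∑ l, rgerm O y (c l) • b (j y) l := by
      rw [ht]
      refine (germ_sum_smul F Finset.univ y c _).trans ?_
      refine Finset.sum_congr rfl fun l _ => ?_
      rw [hb, germ_res]
      rfl
    exact (congrArg (fun v => (b (j y)).repr v k) h2).trans
      (congrFun ((b (j y)).repr_sum_self (fun l => rgerm O y (c l))) k)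

end StalkFamily

/-- The indices of the monomials of degree `q` in `m` odd variables. -/
abbrev GrIdx (m : ℕ) (q : ℤ) : Type := {I : Finset (Fin m) // (I.card : ℤ) = q}

/-! ### Bases from dual families of linear forms -/

section BasisOfDual

variable {R M κ : Type} [CommRing R] [AddCommGroup M] [Module R M] [Fintype κ]

theorem coord_sum_smul (s : κ → M) (c : κ → M →ₗ[R] R) (h₁ : ∀ i, c i (s i) = 1)
    (h₂ : ∀ i j, i ≠ j → c i (s j) = 0) (a : κ → R) (i : κ) : c i (∑ j, a j • s j) = a i := by
  classical
  rw [map_sum, Finset.sum_eq_single i]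
  · rw [map_smul, h₁, smul_eq_mul, mul_one]
  · intro j _ hj
    rw [map_smul, h₂ i j (Ne.symm hj), smul_zero]
  · simp

/-- The basis given by a family of vectors and a dual family of linear forms that separates
points. -/
def basisOfDual (s : κ → M) (c : κ → M →ₗ[R] R) (h₁ : ∀ i, c i (s i) = 1)
    (h₂ : ∀ i j, i ≠ j → c i (s j) = 0) (h₀ : ∀ v, (∀ i, c i v = 0) → v = 0) :
    Module.Basis κ R M :=
  Module.Basis.ofEquivFun
    { toFun := fun v i => c i v
      map_add' := fun f g => funext fun i => map_add _ f g
      map_smul' := fun a f => funext fun i => map_smul _ a f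
      invFun := fun a => ∑ i, a i • s i
      left_inv := fun v => by
        rw [← sub_eq_zero]
        refine h₀ _ fun i => ?_
        rw [map_sub, coord_sum_smul s c h₁ h₂, sub_self]
      right_inv := fun a => funext fun i => coord_sum_smul s c h₁ h₂ a i }

theorem basisOfDual_apply (s : κ → M) (c : κ → M →ₗ[R] R) (h₁ : ∀ i, c i (s i) = 1)
    (h₂ : ∀ i j, i ≠ j → c i (s j) = 0) (h₀ : ∀ v, (∀ i, c i v = 0) → v = 0) (i : κ) :
    basisOfDual s c h₁ h₂ h₀ i = s i := by
  classical
  rw [basisOfDual, Module.Basis.coe_ofEquivFun]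
  change ∑ j, (Pi.single i 1 : κ → R) j • s j = _
  simp [Pi.single_apply]

end BasisOfDual

/-! ### Bases of the homogeneous components -/

section GradedBases

variable {R N : Type} [CommRing R] [AddCommGroup N] [Module R N] {m : ℕ}

theorem basis_mem_gr (b : Module.Basis (Fin m) R N) {q : ℤ} (I : GrIdx m q) :
    b.ExteriorAlgebra I.1 ∈ gr R N q := by
  obtain ⟨I, rfl⟩ := I
  rw [gr_natCast]
  exact basis_mem b I

theorem repr_eq_zero_of_mem_gr (b : Module.Basis (Fin m) R N) {q : ℤ} {a : ExteriorAlgebra R N}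
    (ha : a ∈ gr R N q) {I : Finset (Fin m)} (hI : (I.card : ℤ) ≠ q) :
    b.ExteriorAlgebra.repr a I = 0 := by
  obtain hq | hq := lt_or_ge q 0
  · rw [gr_of_neg hq, Submodule.mem_bot] at ha
    simp [ha]
  lift q to ℕ using hq
  rw [gr_natCast] at ha
  exact repr_eq_zero_of_card_ne b ha (by exact_mod_cast hI)

theorem sum_repr_gr (b : Module.Basis (Fin m) R N) {q : ℤ} {a : ExteriorAlgebra R N}
    (ha : a ∈ gr R N q) :
    ∑ I : GrIdx m q, b.ExteriorAlgebra.repr a I.1 • b.ExteriorAlgebra I.1 = a := by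
  classical
  conv_rhs => rw [← b.ExteriorAlgebra.sum_repr a]
  rw [← Finset.sum_subtype (Finset.univ.filter fun I : Finset (Fin m) => (I.card : ℤ) = q)
    (by simp) (fun I => b.ExteriorAlgebra.repr a I • b.ExteriorAlgebra I), Finset.sum_filter]
  refine Finset.sum_congr rfl fun I _ => ?_
  split_ifs with hI
  · rfl
  · rw [repr_eq_zero_of_mem_gr b ha hI, zero_smul]

theorem gr_eq_zero (b : Module.Basis (Fin m) R N) {q : ℤ} {a : ExteriorAlgebra R N}
    (ha : a ∈ gr R N q) (h : ∀ I : GrIdx m q, b.ExteriorAlgebra.repr a I.1 = 0) : a = 0 := by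
  rw [← sum_repr_gr b ha]
  simp only [h, zero_smul, Finset.sum_const_zero]

/-- The basis of `⋀^p` indexed by the monomials of degree `q = p`. -/
def grBasis (b : Module.Basis (Fin m) R N) (p : ℕ) (q : ℤ) (hq : (p : ℤ) = q) :
    Module.Basis (GrIdx m q) R (⋀[R]^p N) :=
  (b.exteriorPower p).reindex (Equiv.subtypeEquivRight fun I => by
    rw [← hq, Nat.cast_inj]; exact Iff.rfl)

theorem grBasis_apply (b : Module.Basis (Fin m) R N) (p : ℕ) (q : ℤ) (hq : (p : ℤ) = q)
    (I : GrIdx m q) :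
    (grBasis b p q hq I : ExteriorAlgebra R N) = b.ExteriorAlgebra I.1 := by
  rw [grBasis, Module.Basis.reindex_apply, ← ExteriorAlgebra.basis_eq_coe_basis]
  rfl

theorem grBasis_repr (b : Module.Basis (Fin m) R N) (p : ℕ) (q : ℤ) (hq : (p : ℤ) = q)
    (a : ⋀[R]^p N) (I : GrIdx m q) :
    (grBasis b p q hq).repr a I = b.ExteriorAlgebra.repr (a : ExteriorAlgebra R N) I.1 := by
  have : (grBasis b p q hq).coord I = (b.ExteriorAlgebra.coord I.1) ∘ₗ (⋀[R]^p N).subtype := by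
    refine (grBasis b p q hq).ext fun J => ?_
    rw [LinearMap.comp_apply, Submodule.subtype_apply, grBasis_apply, Module.Basis.coord_apply,
      Module.Basis.coord_apply, Module.Basis.repr_self, Module.Basis.repr_self]
    classical
    simp only [Finsupp.single_apply, Subtype.ext_iff]
  exact DFunLike.congr_fun this a

theorem repr_basis_smul (b : Module.Basis (Fin m) R N) {q : ℤ} (a : R) (I J : GrIdx m q) :
    b.ExteriorAlgebra.repr (a • b.ExteriorAlgebra J.1) I.1 = if J = I then a else 0 := by
  rw [map_smul, Module.Basis.repr_self, Finsupp.smul_apply, Finsupp.single_apply]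
  simp only [Subtype.ext_iff, smul_eq_mul, mul_ite, mul_one, mul_zero]

end GradedBases

/-! ### Bases of superderivations in a stalk -/

section StalkBases

variable {R N : Type} [CommRing R] [Algebra ℂ R] [AddCommGroup N] [Module R N] [Module ℂ N]
  [IsScalarTower ℂ R N] {m n : ℕ}

/-- A superderivation that vanishes on `R` is `R`-linear by the Leibniz rule, so its values on a
basis of `N` control it on all of `N`. -/
theorem derDeg_eq_zero (b : Module.Basis (Fin m) R N) {p : ℤ}
    {δ : Module.End ℂ (ExteriorAlgebra R N)} (h : δ ∈ derDeg R N p)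
    (hR : ∀ r, δ (algebraMap R _ r) = 0) (hN : ∀ k, δ (ExteriorAlgebra.ι R (b k)) = 0) :
    δ = 0 := by
  refine superDer_eq_zero (mem_superDer_of_mem_derDeg h) hR fun s => ?_
  rw [← b.sum_repr s]
  simp only [map_sum, map_smul, derDeg_leibniz_algebraMap h, hR, hN, zero_mul, smul_zero,
    zero_add, Finset.sum_const_zero]

/-- The composite of `D` with `f` is a derivation of `R`, and by `hz` its coordinates in `B` are its
values at the `z i`. Applied to coordinate forms, this shows that values at the `z i` determine
derivations into free modules. -/
theorem derivation_expand {M : Type} [AddCommGroup M] [Module R M] [Module ℂ M]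
    [IsScalarTower ℂ R M] (B : Module.Basis (Fin n) R (Derivation ℂ R R)) (z : Fin n → R)
    (hz : ∀ D i, B.repr D i = D (z i)) (D : Derivation ℂ R M) (f : M →ₗ[R] R) (r : R) :
    f (D r) = ∑ i, f (D (z i)) * B i r := by
  have h := B.sum_repr (f.compDer D)
  have h' := DFunLike.congr_fun h r
  simp only [hz] at h'
  rw [← Derivation.coeFnAddMonoidHom_apply, map_sum, Finset.sum_apply] at h'
  exact h'.symm

theorem basis_apply_coord (B : Module.Basis (Fin n) R (Derivation ℂ R R)) (z : Fin n → R)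
    (hz : ∀ D i, B.repr D i = D (z i)) (i j : Fin n) : B j (z i) = if j = i then 1 else 0 := by
  rw [← hz, B.repr_self, Finsupp.single_apply]

/-- The restriction of a superderivation to `R`. -/
def resDer {p : ℤ} (δ : derDeg R N p) : Derivation ℂ R (ExteriorAlgebra R N) :=
  Derivation.mk' (δ.1 ∘ₗ (Algebra.linearMap R (ExteriorAlgebra R N)).restrictScalars ℂ) (by
    intro r s
    change δ.1 (algebraMap R _ (r * s)) = r • δ.1 (algebraMap R _ s) + s • δ.1 (algebraMap R _ r)
    rw [map_mul, ← Algebra.smul_def, derDeg_leibniz_algebraMap δ.2, add_comm, Algebra.smul_def s,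
      Algebra.commutes s])

theorem map_algebraMap_mem_gr {p : ℤ} {δ : Module.End ℂ (ExteriorAlgebra R N)}
    (h : δ ∈ derDeg R N p) (r : R) : δ (algebraMap R _ r) ∈ gr R N p := by
  have := h.2 0 _ (algebraMap_mem_gr r)
  rwa [zero_add] at this

theorem map_ι_mem_gr {p : ℤ} {δ : Module.End ℂ (ExteriorAlgebra R N)}
    (h : δ ∈ derDeg R N p) (s : N) : δ (ExteriorAlgebra.ι R s) ∈ gr R N (p + 1) := by
  have := h.2 1 _ (ι_mem_gr s)
  rwa [add_comm] at this

/-- The superderivation `e_I ∂` where the derivation `∂` of `R` is extended by zero on `b`. -/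
def horDer (b : Module.Basis (Fin m) R N) (D : Derivation ℂ R R) {p : ℤ} (I : GrIdx m p) :
    derDeg R N p :=
  ⟨mulEnd (b.ExteriorAlgebra I.1) (nabla b D), by
    have := mulEnd_mem_derDeg (basis_mem_gr b I) (nabla_mem_derDeg b D)
    rwa [add_zero] at this⟩

/-- The superderivation that is the product of `η` and the contraction with `φ`. -/
def vertDer (φ : Module.Dual R N) {p : ℤ} (η : gr R N (p + 1)) : derDeg R N p :=
  ⟨mulEnd η.1 ((contr φ).restrictScalars ℂ), by
    have := mulEnd_mem_derDeg η.2 (contr_mem_derDeg φ)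
    rwa [add_neg_cancel_right] at this⟩

theorem horDer_algebraMap (b : Module.Basis (Fin m) R N) (D : Derivation ℂ R R) {p : ℤ}
    (I : GrIdx m p) (r : R) :
    (horDer b D I).1 (algebraMap R _ r) = D r • b.ExteriorAlgebra I.1 := by
  change b.ExteriorAlgebra I.1 * nabla b D (algebraMap R _ r) = _
  rw [nabla_algebraMap, ← Algebra.commutes, Algebra.smul_def]

theorem horDer_ι (b : Module.Basis (Fin m) R N) (D : Derivation ℂ R R) {p : ℤ}
    (I : GrIdx m p) (k : Fin m) : (horDer b D I).1 (ExteriorAlgebra.ι R (b k)) = 0 := by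
  change b.ExteriorAlgebra I.1 * nabla b D _ = _
  rw [nabla_ι, mul_zero]

theorem vertDer_algebraMap (φ : Module.Dual R N) {p : ℤ} (η : gr R N (p + 1)) (r : R) :
    (vertDer φ η).1 (algebraMap R _ r) = 0 := by
  change η.1 * contr φ (algebraMap R _ r) = _
  rw [contr_algebraMap, mul_zero]

theorem vertDer_ι (φ : Module.Dual R N) {p : ℤ} (η : gr R N (p + 1)) (s : N) :
    (vertDer φ η).1 (ExteriorAlgebra.ι R s) = φ s • η.1 := by
  change η.1 * contr φ (ExteriorAlgebra.ι R s) = _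
  rw [contr_ι, ← Algebra.commutes, Algebra.smul_def]

/-- The monomial of index `I`, as an element of the component of degree `q`. -/
def grMono (b : Module.Basis (Fin m) R N) {q : ℤ} (I : GrIdx m q) : gr R N q :=
  ⟨b.ExteriorAlgebra I.1, basis_mem_gr b I⟩

variable (R N) in
/-- The superderivations of degree `p` that vanish on `R`. -/
def vertDeg (p : ℤ) : Submodule R (Module.End ℂ (ExteriorAlgebra R N)) where
  carrier := {δ | δ ∈ derDeg R N p ∧ ∀ r, δ (algebraMap R _ r) = 0}
  zero_mem' := ⟨zero_mem _, fun _ => rfl⟩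
  add_mem' h h' := ⟨add_mem h.1 h'.1, fun r => by rw [LinearMap.add_apply, h.2, h'.2, add_zero]⟩
  smul_mem' r _ h := ⟨Submodule.smul_mem _ r h.1, fun s => by
    rw [LinearMap.smul_apply, h.2, smul_zero]⟩

theorem vertDer_mem_vertDeg (φ : Module.Dual R N) {p : ℤ} (η : gr R N (p + 1)) :
    (vertDer φ η).1 ∈ vertDeg R N p := ⟨(vertDer φ η).2, vertDer_algebraMap φ η⟩

/-- The coefficient of a monomial in the value of a superderivation at an odd coordinate. -/
def oddCoord (b : Module.Basis (Fin m) R N) (k : Fin m) (K : Finset (Fin m)) :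
    Module.End ℂ (ExteriorAlgebra R N) →ₗ[R] R where
  toFun δ := b.ExteriorAlgebra.repr (δ (ExteriorAlgebra.ι R (b k))) K
  map_add' δ δ' := by simp
  map_smul' r δ := by simp

/-- The coefficient of a monomial in the value of a superderivation at an element of `R`. -/
def evenCoord (b : Module.Basis (Fin m) R N) (z : R) (K : Finset (Fin m)) :
    Module.End ℂ (ExteriorAlgebra R N) →ₗ[R] R where
  toFun δ := b.ExteriorAlgebra.repr (δ (algebraMap R _ z)) K
  map_add' δ δ' := by simp
  map_smul' r δ := by simp

theorem oddCoord_vertDer (b : Module.Basis (Fin m) R N) {p : ℤ} (k l : Fin m)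
    (K L : GrIdx m (p + 1)) : oddCoord b k K.1 (vertDer (b.coord l) (grMono b L)).1 =
      if L = K then (if l = k then 1 else 0) else 0 := by
  change b.ExteriorAlgebra.repr ((vertDer (b.coord l) (grMono b L)).1 _) K.1 = _
  rw [vertDer_ι, grMono, repr_basis_smul, Module.Basis.coord_apply, Module.Basis.repr_self,
    Finsupp.single_apply]
  simp only [eq_comm]

/-- The coefficient of a monomial in the value of a vertical superderivation at an odd
coordinate. -/
def vertCoord (b : Module.Basis (Fin m) R N) (p : ℤ) (k : Fin m × GrIdx m (p + 1)) :
    vertDeg R N p →ₗ[R] R := oddCoord b k.1 k.2.1 ∘ₗ (vertDeg R N p).subtype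

theorem vertCoord_apply (b : Module.Basis (Fin m) R N) (p : ℤ) (k : Fin m × GrIdx m (p + 1))
    (δ : vertDeg R N p) : vertCoord b p k δ =
      b.ExteriorAlgebra.repr (δ.1 (ExteriorAlgebra.ι R (b k.1))) k.2.1 := rfl

theorem vertDeg_eq_zero (b : Module.Basis (Fin m) R N) (p : ℤ) (δ : vertDeg R N p)
    (h : ∀ k, vertCoord b p k δ = 0) : δ = 0 := by
  refine Subtype.ext (derDeg_eq_zero b δ.2.1 δ.2.2 fun k => ?_)
  refine gr_eq_zero b (map_ι_mem_gr δ.2.1 (b k)) fun K => ?_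
  rw [← h (k, K), vertCoord_apply]

/-- The product of a monomial and the partial derivative with respect to an odd coordinate. -/
def vertVec (b : Module.Basis (Fin m) R N) (p : ℤ) (k : Fin m × GrIdx m (p + 1)) :
    vertDeg R N p := ⟨_, vertDer_mem_vertDeg (b.coord k.1) (grMono b k.2)⟩

theorem vertCoord_vertVec (b : Module.Basis (Fin m) R N) (p : ℤ) (k l : Fin m × GrIdx m (p + 1)) :
    vertCoord b p k (vertVec b p l) = if l = k then 1 else 0 := by
  obtain ⟨k, K⟩ := k
  obtain ⟨l, L⟩ := l
  refine (oddCoord_vertDer b k l K L).trans ?_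
  simp only [Prod.mk.injEq]
  split_ifs <;> simp_all

/-- The basis of the superderivations of degree `p` that vanish on `R`. -/
def vertBasis (b : Module.Basis (Fin m) R N) (p : ℤ) :
    Module.Basis (Fin m × GrIdx m (p + 1)) R (vertDeg R N p) :=
  basisOfDual (vertVec b p) (vertCoord b p)
    (fun k => by rw [vertCoord_vertVec, if_pos rfl])
    (fun k l h => by rw [vertCoord_vertVec, if_neg (Ne.symm h)])
    (vertDeg_eq_zero b p)

theorem vertBasis_apply (b : Module.Basis (Fin m) R N) (p : ℤ) (k : Fin m × GrIdx m (p + 1)) :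
    (vertBasis b p k).1 = (vertDer (b.coord k.1) (grMono b k.2)).1 := by
  rw [vertBasis, basisOfDual_apply]
  rfl

/-- The basis of the superderivations of degree `p`. -/
def derBasis (b : Module.Basis (Fin m) R N) (B : Module.Basis (Fin n) R (Derivation ℂ R R))
    (z : Fin n → R) (hz : ∀ D i, B.repr D i = D (z i)) (p : ℤ) :
    Module.Basis ((Fin n × GrIdx m p) ⊕ (Fin m × GrIdx m (p + 1))) R (derDeg R N p) :=
  basisOfDual (Sum.elim (fun i => horDer b (B i.1) i.2)
      (fun k => vertDer (b.coord k.1) (grMono b k.2)))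
    (Sum.elim (fun i => evenCoord b (z i.1) i.2.1 ∘ₗ (derDeg R N p).subtype)
      (fun k => oddCoord b k.1 k.2.1 ∘ₗ (derDeg R N p).subtype))
    (by
      rintro (⟨i, I⟩ | ⟨k, K⟩)
      · change b.ExteriorAlgebra.repr ((horDer b (B i) I).1 (algebraMap R _ (z i))) I.1 = 1
        rw [horDer_algebraMap, repr_basis_smul, basis_apply_coord B z hz]
        simp
      · exact (oddCoord_vertDer b k k K K).trans (by simp))
    (by
      rintro (⟨i, I⟩ | ⟨k, K⟩) (⟨j, J⟩ | ⟨l, L⟩) h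
      · change b.ExteriorAlgebra.repr ((horDer b (B j) J).1 (algebraMap R _ (z i))) I.1 = 0
        rw [horDer_algebraMap, repr_basis_smul, basis_apply_coord B z hz]
        split_ifs with h1 h2
        · subst h1 h2; exact absurd rfl h
        · rfl
        · rfl
      · change b.ExteriorAlgebra.repr ((vertDer (b.coord l) (grMono b L)).1
          (algebraMap R _ (z i))) I.1 = 0
        rw [vertDer_algebraMap, map_zero, Finsupp.zero_apply]
      · change b.ExteriorAlgebra.repr ((horDer b (B j) J).1 _) K.1 = 0
        rw [horDer_ι, map_zero, Finsupp.zero_apply]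
      · refine (oddCoord_vertDer b k l K L).trans ?_
        split_ifs with h1 h2
        · subst h1 h2; exact absurd rfl h
        · rfl
        · rfl)
    -- Separation of points: the even coordinates determine `δ` at the `z i`, hence on all of `R` by
    -- `derivation_expand`; the odd coordinates determine it on the basis of `N`.
    (fun δ h => Subtype.ext (derDeg_eq_zero b δ.2
      (fun r => gr_eq_zero b (map_algebraMap_mem_gr δ.2 r) fun I =>
        (derivation_expand B z hz (resDer δ) (b.ExteriorAlgebra.coord I.1) r).trans
          (Finset.sum_eq_zero fun i _ => mul_eq_zero_of_left (h (Sum.inl (i, I))) _))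
      (fun k => gr_eq_zero b (map_ι_mem_gr δ.2 (b k)) fun K => h (Sum.inr (k, K)))))

theorem derBasis_inl (b : Module.Basis (Fin m) R N)
    (B : Module.Basis (Fin n) R (Derivation ℂ R R)) (z : Fin n → R)
    (hz : ∀ D i, B.repr D i = D (z i)) (p : ℤ) (i : Fin n × GrIdx m p) :
    derBasis b B z hz p (Sum.inl i) = horDer b (B i.1) i.2 := by
  rw [derBasis, basisOfDual_apply]
  rfl

theorem derBasis_inr (b : Module.Basis (Fin m) R N)
    (B : Module.Basis (Fin n) R (Derivation ℂ R R)) (z : Fin n → R)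
    (hz : ∀ D i, B.repr D i = D (z i)) (p : ℤ) (k : Fin m × GrIdx m (p + 1)) :
    derBasis b B z hz p (Sum.inr k) = vertDer (b.coord k.1) (grMono b k.2) := by
  rw [derBasis, basisOfDual_apply]
  rfl

/-- The derivation `r ↦ D r • η` with values in a module. -/
def smulDer {M : Type} [AddCommGroup M] [Module R M] [Module ℂ M] [IsScalarTower ℂ R M]
    (D : Derivation ℂ R R) (η : M) : Derivation ℂ R M :=
  (LinearMap.toSpanSingleton R M η).compDer D

theorem smulDer_apply {M : Type} [AddCommGroup M] [Module R M] [Module ℂ M]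
    [IsScalarTower ℂ R M] (D : Derivation ℂ R R) (η : M) (r : R) :
    smulDer D η r = D r • η := rfl

/-- The basis of the derivations with values in a free module. -/
def modDerBasis {M κ : Type} [AddCommGroup M] [Module R M] [Module ℂ M] [IsScalarTower ℂ R M]
    [Fintype κ] (e : Module.Basis κ R M) (B : Module.Basis (Fin n) R (Derivation ℂ R R))
    (z : Fin n → R) (hz : ∀ D i, B.repr D i = D (z i)) :
    Module.Basis (Fin n × κ) R (Derivation ℂ R M) :=
  basisOfDual (fun i => smulDer (B i.1) (e i.2))
    (fun i =>
      { toFun := fun D => e.repr (D (z i.1)) i.2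
        map_add' := fun D D' => by simp
        map_smul' := fun r D => by simp })
    (fun i => by simp [smulDer_apply, basis_apply_coord B z hz])
    (fun i j h => by
      classical
      simp only [LinearMap.coe_mk, AddHom.coe_mk, smulDer_apply, basis_apply_coord B z hz,
        map_smul, Module.Basis.repr_self, Finsupp.smul_apply, Finsupp.single_apply]
      by_cases h1 : j.1 = i.1
      · rw [if_neg fun h2 => h (Prod.ext h1 h2).symm, smul_zero]
      · rw [if_neg h1, zero_smul])
    (fun D h => by
      ext r
      refine e.ext_elem fun K => ?_
      refine (derivation_expand B z hz D (e.coord K) r).trans ?_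
      simp only [Derivation.zero_apply, map_zero, Finsupp.zero_apply]
      exact Finset.sum_eq_zero fun i _ => mul_eq_zero_of_left (h (i, K)) _)

theorem modDerBasis_apply {M κ : Type} [AddCommGroup M] [Module R M] [Module ℂ M]
    [IsScalarTower ℂ R M] [Fintype κ] (e : Module.Basis κ R M)
    (B : Module.Basis (Fin n) R (Derivation ℂ R R)) (z : Fin n → R)
    (hz : ∀ D i, B.repr D i = D (z i)) (i : Fin n × κ) :
    modDerBasis e B z hz i = smulDer (B i.1) (e i.2) := by
  rw [modDerBasis, basisOfDual_apply]

end StalkBases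

/-! ### Sections of the exterior algebra sheaf -/

section ExtSections

variable {X : TopCat.{0}} {O : TopCat.Sheaf CommRingCat.{0} X} {F : ModSheaf O}

theorem extSec_mul {U : Opens X} {f g : ∀ x : U, ExtStalk F x}
    (hf : (extSec F).pred f) (hg : (extSec F).pred g) : (extSec F).pred (fun x => f x * g x) :=
  (extSections F U).mul_mem hf hg

theorem extSec_algebraMap {U : Opens X} {a : ∀ x : U, RStalk O x} (ha : (ringSec O).pred a) :
    (extSec F).pred (fun x => algebraMap (RStalk O x) (ExtStalk F x) (a x)) := by
  obtain ⟨g, hg⟩ := exists_rgerm ha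
  refine extSec_of_poly F (Subring.subset_closure (Or.inl ⟨g, ?_⟩))
  funext x
  rw [hg]

theorem extSec_ι {U : Opens X} {s : ∀ x : U, Stalk F x} (hs : (modSec F).pred s) :
    (extSec F).pred (fun x => ExteriorAlgebra.ι (RStalk O x) (s x)) := by
  obtain ⟨t, ht⟩ := exists_germ hs
  refine extSec_of_poly F (Subring.subset_closure (Or.inr ⟨t, ?_⟩))
  funext x
  rw [ht]

theorem extSec_smul' {U : Opens X} {a : ∀ x : U, RStalk O x} (ha : (ringSec O).pred a)
    {f : ∀ x : U, ExtStalk F x} (hf : (extSec F).pred f) :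
    (extSec F).pred (fun x => a x • f x) := by
  simp only [Algebra.smul_def]
  exact extSec_mul (extSec_algebraMap ha) hf

theorem extSec_sum {U : Opens X} {κ : Type} (S : Finset κ) {f : κ → ∀ x : U, ExtStalk F x}
    (hf : ∀ k ∈ S, (extSec F).pred (f k)) : (extSec F).pred (fun x => ∑ k ∈ S, f k x) := by
  have := (extSections F U).sum_mem (t := S) (f := f) hf
  rw [Finset.sum_fn] at this
  exact this

/-- To check that every section of `Λ(F)` belongs to a family of subrings that is of local nature,
it suffices to check the sections of `O` and of `F`. -/
theorem extSec_induction {P : ∀ V : Opens X, (∀ x : V, ExtStalk F x) → Prop} {U : Opens X}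
    {f : ∀ x : U, ExtStalk F x} (hf : (extSec F).pred f)
    (locality : (∀ x : U, ∃ (V : Opens X) (_ : x.1 ∈ V) (i : V ⟶ U), P V (fun y => f (i y))) → P U f)
    (ring : ∀ (V : Opens X) (_ : V ⟶ U) (a : (O.obj.obj (op V) : CommRingCat)),
      P V (fun x => algebraMap (RStalk O x) (ExtStalk F x) (rgerm O x a)))
    (mod : ∀ (V : Opens X) (_ : V ⟶ U) (s : F.val.obj (op V)),
      P V (fun x => ExteriorAlgebra.ι (RStalk O x) (germ F x s)))
    (add : ∀ (V : Opens X) (_ : V ⟶ U) f g, P V f → P V g → P V (fun x => f x + g x))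
    (mul : ∀ (V : Opens X) (_ : V ⟶ U) f g, P V f → P V g → P V (fun x => f x * g x)) :
    P U f := by
  refine locality fun x => ?_
  obtain ⟨V, hV, i, h⟩ := hf x
  refine ⟨V, hV, i, ?_⟩
  -- Integers are sections of `O`; the values 0, 1 and -1 supply the zero, unit and negation axioms
  -- of the subring below.
  have hint : ∀ c : ℤ, P V (fun x => algebraMap (RStalk O x) (ExtStalk F x) (c : RStalk O x)) := by
    intro c
    have := ring V i (c : (O.obj.obj (op V) : CommRingCat))
    simpa only [map_intCast] using this
  have hS : polySections F V ≤
      { carrier := {f | P V f}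
        zero_mem' := by
          have := hint 0
          simpa only [Int.cast_zero, map_zero] using! this
        one_mem' := by
          have := hint 1
          simpa only [Int.cast_one, map_one] using! this
        neg_mem' := by
          intro f hf
          have := mul V i _ _ (hint (-1)) hf
          simp only [Int.cast_neg, Int.cast_one, map_neg, map_one, neg_mul, one_mul] at this
          exact this
        add_mem' := fun hf hg => add V i _ _ hf hg
        mul_mem' := fun hf hg => mul V i _ _ hf hg : Subring (∀ x : V, ExtStalk F x) } := by
    refine Subring.closure_le.2 ?_
    rintro _ (⟨g, rfl⟩ | ⟨s, rfl⟩)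
    · exact ring V i g
    · exact mod V i s
  exact hS h

/-- Needed because the parity automorphism appears in the product rule for contractions. -/
theorem extSec_invol {U : Opens X} {f : ∀ x : U, ExtStalk F x} (hf : (extSec F).pred f) :
    (extSec F).pred (fun x => invol (f x)) := by
  refine extSec_induction (P := fun V f => (extSec F).pred (fun x : V => invol (f x))) hf
    (fun h => (extSec F).locality _ h) (fun V _ a => ?_) (fun V _ s => ?_)
    (fun V _ f g hf hg => ?_) (fun V _ f g hf hg => ?_)
  · simp only [AlgHom.commutes]
    exact extSec_algebraMap (ringSec_rgerm a)
  · have h : ∀ x : V, invol (ExteriorAlgebra.ι (RStalk O x) (germ F x s)) =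
        -ExteriorAlgebra.ι (RStalk O x) (germ F x s) := fun x => CliffordAlgebra.involute_ι _
    simp only [h]
    exact (extSections F V).neg_mem (x := fun x => ExteriorAlgebra.ι (RStalk O x.1) (germ F x s))
      (extSec_ι (modSec_germ s))
  · simp only [map_add]
    exact extSec_add F hf hg
  · simp only [map_mul]
    exact extSec_mul hf hg

theorem extSec_contr {U : Opens X} {φ : ∀ x : U, Module.Dual (RStalk O x) (Stalk F x)}
    (hφ : (dual F).sec.pred φ) {f : ∀ x : U, ExtStalk F x} (hf : (extSec F).pred f) :
    (extSec F).pred (fun x => contr (φ x) (f x)) := by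
  -- The family `φ` lives over `U`, so the predicate quantifies over inclusions into `U`. It also
  -- records that `f` itself is a section, since the product rule involves the factors as well as
  -- their contractions.
  refine (extSec_induction (P := fun V f => ∀ i : V ⟶ U, (extSec F).pred f ∧
    (extSec F).pred (fun x : V => contr (φ (i x)) (f x))) hf (fun h i => ?_) (fun V _ a i => ?_)
    (fun V _ s i => ?_) (fun V _ f g hf hg i => ?_) (fun V _ f g hf hg i => ?_) (𝟙 U)).2
  · exact ⟨(extSec F).locality _ fun x => let ⟨V, hV, j, h'⟩ := h x; ⟨V, hV, j, (h' (j ≫ i)).1⟩,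
      (extSec F).locality _ fun x => let ⟨V, hV, j, h'⟩ := h x; ⟨V, hV, j, (h' (j ≫ i)).2⟩⟩
  · refine ⟨extSec_algebraMap (ringSec_rgerm a), ?_⟩
    exact pred_congr (extSec_zero F V) fun x => contr_algebraMap (φ (i x)) _
  · refine ⟨extSec_ι (modSec_germ s), ?_⟩
    exact pred_congr (extSec_algebraMap (hφ V i _ (modSec_germ s))) fun x => contr_ι (φ (i x)) _
  · refine ⟨extSec_add F (hf i).1 (hg i).1, ?_⟩
    simp only [map_add]
    exact extSec_add F (hf i).2 (hg i).2
  · refine ⟨extSec_mul (hf i).1 (hg i).1, ?_⟩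
    simp only [contr_mul]
    exact extSec_add F (extSec_mul (hf i).2 (hg i).1) (extSec_mul (extSec_invol (hf i).1) (hg i).2)

variable {U : Opens X} {m : ℕ}

/-- The basis of the stalk of `F` given by a frame. -/
abbrev stalkBasis (e : (stalkFamily F).Frame U (Fin m)) (x : U) :
    Module.Basis (Fin m) (RStalk O x.1) (Stalk F x.1) := e.basis x

/-- A monomial is an ordered product, over the elements of `I`, of the same frame sections at every
point. -/
theorem extSec_monomial (e : (stalkFamily F).Frame U (Fin m)) (I : Finset (Fin m)) :
    (extSec F).pred (fun x : U => (stalkBasis e x).ExteriorAlgebra I) := by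
  have h : ∀ x : U, (stalkBasis e x).ExteriorAlgebra I = (List.ofFn fun i : Fin I.card =>
      ExteriorAlgebra.ι (RStalk O x.1) (stalkBasis e x (Set.powersetCard.ofFinEmbEquiv.symm
        (⟨I, rfl⟩ : Set.powersetCard (Fin m) I.card) i))).prod := by
    intro x
    rw [ExteriorAlgebra.basis_apply_ofCard _ rfl, ExteriorAlgebra.ιMulti_family,
      ExteriorAlgebra.ιMulti_apply]
    rfl
  simp only [h]
  have h2 := (extSections F U).list_prod_mem (l := List.ofFn fun i : Fin I.card => fun x : U =>
      ExteriorAlgebra.ι (RStalk O x.1) (stalkBasis e x (Set.powersetCard.ofFinEmbEquiv.symm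
        (⟨I, rfl⟩ : Set.powersetCard (Fin m) I.card) i))) (by
    intro f hf
    obtain ⟨i, rfl⟩ := (List.mem_ofFn' _ _).1 hf
    exact extSec_ι (e.sec_basis _))
  convert! h2 using 1
  funext x
  rw [Pi.list_prod_apply, List.map_ofFn]
  rfl

theorem ringSec_repr_ι (e : (stalkFamily F).Frame U (Fin m)) {V : Opens X} (j : V ⟶ U)
    {s : ∀ x : V, Stalk F x} (hs : (modSec F).pred s) (I : Finset (Fin m)) :
    (ringSec O).pred (fun x : V => (stalkBasis e (j x)).ExteriorAlgebra.repr
      (ExteriorAlgebra.ι (RStalk O x.1) (s x)) I) := by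
  have h : ∀ x : V, (stalkBasis e (j x)).ExteriorAlgebra.repr
      (ExteriorAlgebra.ι (RStalk O x.1) (s x)) I =
        ∑ k, (stalkBasis e (j x)).repr (s x) k * (((if ({k} : Finset (Fin m)) = I then 1 else 0 : ℤ)) : RStalk O x.1) := by
    intro x
    conv_lhs => rw [← (stalkBasis e (j x)).sum_repr (s x)]
    simp only [map_sum, map_smul, ← basis_singleton, Module.Basis.repr_self, Finsupp.coe_finsetSum,
      Finset.sum_apply, Finsupp.smul_apply, Finsupp.single_apply, smul_eq_mul]
    refine Finset.sum_congr rfl fun k _ => ?_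
    split_ifs <;> simp
  simp only [h]
  exact ringSec_sum _ fun k _ => ringSec_mul (e.sec_repr j hs k) (ringSec_intCast V _)

/-- The claim is clear for sections of `O` and of `F`. It passes to products because the structure
constants are integers, the same at every point. -/
theorem ringSec_repr (e : (stalkFamily F).Frame U (Fin m)) {V : Opens X} (j : V ⟶ U)
    {f : ∀ x : V, ExtStalk F x} (hf : (extSec F).pred f) (I : Finset (Fin m)) :
    (ringSec O).pred (fun x : V => (stalkBasis e (j x)).ExteriorAlgebra.repr (f x) I) := by
  refine extSec_induction (P := fun W f => ∀ (i : W ⟶ U) I, (ringSec O).pred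
    (fun x : W => (stalkBasis e (i x)).ExteriorAlgebra.repr (f x) I)) hf (fun h i I => ?_)
    (fun W _ a i I => ?_) (fun W _ s i I => ?_) (fun W _ f g hf hg i I => ?_)
    (fun W _ f g hf hg i I => ?_) j I
  · exact (ringSec O).locality _ fun x => let ⟨V, hV, j, h'⟩ := h x; ⟨V, hV, j, h' (j ≫ i) I⟩
  · have h : ∀ x : W, (stalkBasis e (i x)).ExteriorAlgebra.repr
        (algebraMap (RStalk O x) (ExtStalk F x) (rgerm O x a)) I =
          rgerm O x a • (((if (∅ : Finset (Fin m)) = I then 1 else 0 : ℤ)) : RStalk O x.1) := by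
      intro x
      rw [Algebra.algebraMap_eq_smul_one, ← basis_empty (stalkBasis e (i x)), map_smul,
        Module.Basis.repr_self, Finsupp.smul_apply, Finsupp.single_apply]
      split_ifs <;> simp
    simp only [h]
    exact ringSec_smul a (ringSec_intCast W _)
  · exact ringSec_repr_ι e i (modSec_germ s) I
  · simp only [map_add, Finsupp.add_apply]
    exact ringSec_add (hf i I) (hg i I)
  · simp only [mul_repr, zsmul_eq_mul]
    exact ringSec_sum _ fun J _ => ringSec_sum _ fun K _ =>
      ringSec_mul (ringSec_intCast W _) (ringSec_mul (hf i J) (hg i K))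

/-- The frame of `Λ^p(F)` given by a frame of `F`. -/
def extPowerFrame (e : (stalkFamily F).Frame U (Fin m)) (p : ℕ) (q : ℤ) (hq : (p : ℤ) = q) :
    (extPower F p).Frame U (GrIdx m q) where
  basis x := grBasis (stalkBasis e x) p q hq
  sec_basis I := pred_congr (P := (extSec F).toPrelocalPredicate) (extSec_monomial e I.1)
    fun x => grBasis_apply (stalkBasis e x) p q hq I
  sec_repr j f hf I := pred_congr (ringSec_repr e j (f := fun x => Subtype.val
      (p := (· ∈ ⋀[RStalk O x.1]^p (Stalk F x.1))) (f x)) hf I.1)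
    fun x => grBasis_repr (stalkBasis e (j x)) p q hq (f x) I

theorem dual_sec_coord (e : (stalkFamily F).Frame U (Fin m)) (k : Fin m) :
    (dual F).sec.pred (fun x : U => (stalkBasis e x).coord k) :=
  fun _ i _ hs => e.sec_repr i hs k

/-- The frame of `F^*` dual to a frame of `F`. -/
def dualFrame (e : (stalkFamily F).Frame U (Fin m)) : (dual F).Frame U (Fin m) where
  basis x := (stalkBasis e x).dualBasis
  sec_basis k := fun _ i s hs => pred_congr (e.sec_repr i hs k) fun x =>
    DFunLike.congr_fun (congrFun (Module.Basis.coe_dualBasis (stalkBasis e (i x))) k) (s x)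
  sec_repr {V} j φ hφ k := pred_congr
    (hφ V (𝟙 V) _ ((modSec F).res j _ (e.sec_basis k)))
    fun x => Module.Basis.dualBasis_repr (stalkBasis e (j x)) (φ x) k

end ExtSections

/-! ### Frames of the sheaves of derivations -/

section DerFrames

variable {X : TopCat.{0}} {O : TopCat.Sheaf CommRingCat.{0} X} [∀ x, Algebra ℂ (RStalk O x)]
  {F : ModSheaf O} {U : Opens X} {m n : ℕ}

variable (O) in
/-- A frame of the tangent sheaf over `U` that is dual to coordinate functions `z i`. -/
structure CoordFrame (U : Opens X) (n : ℕ) where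
  frame : (tangent O).Frame U (Fin n)
  z : Fin n → (O.obj.obj (op U) : CommRingCat)
  repr_eq : ∀ (x : U) (D : Derivation ℂ (RStalk O x.1) (RStalk O x.1)) (i : Fin n),
    (frame.basis x).repr D i = D (rgerm O x (z i))

/-- Restriction of a coordinate frame. -/
def CoordFrame.restrict (T : CoordFrame O U n) {V : Opens X} (j : V ⟶ U) : CoordFrame O V n where
  frame := T.frame.restrict j
  z i := O.obj.map j.op (T.z i)
  repr_eq x D i := by
    rw [rgerm_res]
    exact T.repr_eq (j x) D i

/-- The basis of the derivations of `O_x` given by a coordinate frame. -/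
abbrev CoordFrame.basis (T : CoordFrame O U n) (x : U) :
    Module.Basis (Fin n) (RStalk O x.1) (Derivation ℂ (RStalk O x.1) (RStalk O x.1)) :=
  T.frame.basis x

theorem carries_contr {W : Opens X} {φ : ∀ x : W, Module.Dual (RStalk O x) (Stalk F x)}
    (hφ : (dual F).sec.pred φ) {p : ℤ} {η : ∀ x : W, gr (RStalk O x.1) (Stalk F x.1) (p + 1)}
    (hη : (extSec F).pred (fun x : W => (η x).1)) :
    (derP F p).sec.pred (fun x : W => vertDer (φ x) (η x)) := by
  intro V i f hf
  exact extSec_mul ((extSec F).res i _ hη) (extSec_contr ((dual F).sec.res i _ hφ) hf)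

/-- Coefficients of a section are sections of `O`, the derivations of the coordinate frame preserve
sections of `O`, and the monomials are sections. -/
theorem carries_horDer (e : (stalkFamily F).Frame U (Fin m)) (T : CoordFrame O U n) {p : ℤ}
    (k : Fin n) (I : GrIdx m p) :
    (derP F p).sec.pred (fun x : U => horDer (stalkBasis e x) (T.basis x k) I) := by
  intro V i f hf
  refine extSec_mul ((extSec F).res i _ (extSec_monomial e I.1)) ?_
  exact pred_congr (extSec_sum Finset.univ fun J _ =>
    extSec_smul' (T.frame.sec_basis k V i _ (ringSec_repr e i hf J))
      ((extSec F).res i _ (extSec_monomial e J)))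
    fun x => nabla_apply (stalkBasis e (i x)) (T.basis (i x) k) (f x)

/-- The frame of `Der_p Λ(F)` given by a frame of `F` and a coordinate frame. -/
def derFrame (e : (stalkFamily F).Frame U (Fin m)) (T : CoordFrame O U n) (p : ℤ) :
    (derP F p).Frame U ((Fin n × GrIdx m p) ⊕ (Fin m × GrIdx m (p + 1))) where
  basis x := derBasis (stalkBasis e x) (T.basis x) (fun i => rgerm O x (T.z i)) (T.repr_eq x) p
  sec_basis k := by
    rcases k with k | k
    · exact pred_congr (P := (derP F p).sec.toPrelocalPredicate) (carries_horDer e T k.1 k.2)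
        fun x => derBasis_inl _ _ _ (T.repr_eq x) p k
    · exact pred_congr (P := (derP F p).sec.toPrelocalPredicate)
        (carries_contr (dual_sec_coord e k.1) (η := fun x => grMono (stalkBasis e x) k.2)
          (extSec_monomial e k.2.1))
        fun x => derBasis_inr _ _ _ (T.repr_eq x) p k
  sec_repr {V} j δ hδ k := by
    rcases k with k | k
    -- The coordinates of `δ` are by construction coefficients of its values at the coordinate
    -- functions and, in the next case, at the frame of `F`. These values are sections.
    · exact ringSec_repr e j (hδ V (𝟙 V) _ (extSec_algebraMap
        ((ringSec O).res j _ (ringSec_rgerm (T.z k.1))))) k.2.1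
    · exact ringSec_repr e j (hδ V (𝟙 V) _ (extSec_ι
        ((modSec F).res j _ (e.sec_basis k.1)))) k.2.1

/-- The sheaf of superderivations of degree `p` of `Λ(F)` that vanish on `O`. -/
def vertP (F : ModSheaf O) (p : ℤ) : GermFamily O where
  fiber x := vertDeg (RStalk O x) (Stalk F x) p
  sec := carries (extSec F) (extSec F) (fun _ δ a => δ.1 a)
  zero_sec _ V _ _ _ := extSec_zero F V
  add_sec hf hg V i s hs := extSec_add F (hf V i s hs) (hg V i s hs)
  smul_sec {_U} a _f hf V i s hs := by
    have h := extSec_smul F (O.obj.map i.op a) (hf V i s hs)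
    simp only [rgerm_res] at h
    exact h

/-- The frame of `vertP F p` given by a frame of `F`. -/
def vertFrame (e : (stalkFamily F).Frame U (Fin m)) (p : ℤ) :
    (vertP F p).Frame U (Fin m × GrIdx m (p + 1)) where
  basis x := vertBasis (stalkBasis e x) p
  sec_basis k := fun V i f hf => pred_congr (P := (extSec F).toPrelocalPredicate)
    (carries_contr (dual_sec_coord e k.1) (η := fun x => grMono (stalkBasis e x) k.2)
          (extSec_monomial e k.2.1) V i f hf)
    fun x => congrArg (fun δ : Module.End ℂ (ExtStalk F x.1) => δ (f x))
      (vertBasis_apply (stalkBasis e (i x)) p k)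
  sec_repr {V} j _ hδ k := ringSec_repr e j (hδ V (𝟙 V) _ (extSec_ι
        ((modSec F).res j _ (e.sec_basis k.1)))) k.2.1

/-- The sheaf of derivations of `O` with values in `Λ^p(F)`. -/
def extDer (F : ModSheaf O) (p : ℕ) : GermFamily O where
  fiber x := Derivation ℂ (RStalk O x) (⋀[RStalk O x]^p (Stalk F x))
  sec := carries (ringSec O) (extPower F p).sec (fun _ D g => D g)
  zero_sec _ V _ _ _ := (extPower F p).zero_sec V
  add_sec hf hg V i s hs := (extPower F p).add_sec (hf V i s hs) (hg V i s hs)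
  smul_sec {_U} a _f hf V i s hs := by
    have h := (extPower F p).smul_sec (O.obj.map i.op a) (hf V i s hs)
    simp only [rgerm_res] at h
    exact h

/-- The frame of `extDer F p` given by a frame of `F` and a coordinate frame. -/
def extDerFrame (e : (stalkFamily F).Frame U (Fin m)) (T : CoordFrame O U n) (p : ℕ) (q : ℤ)
    (hq : (p : ℤ) = q) : (extDer F p).Frame U (Fin n × GrIdx m q) where
  basis x := modDerBasis (grBasis (stalkBasis e x) p q hq) (T.basis x)
    (fun i => rgerm O x (T.z i)) (T.repr_eq x)
  sec_basis k := fun V i f hf => pred_congr (P := (extPower F p).sec.toPrelocalPredicate)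
    ((extPower F p).smul_sec' (T.frame.sec_basis k.1 V i f hf)
      ((extPower F p).sec.res i _ ((extPowerFrame e p q hq).sec_basis k.2)))
    fun x => DFunLike.congr_fun (modDerBasis_apply (grBasis (stalkBasis e (i x)) p q hq)
      (T.basis (i x)) (fun l => rgerm O (i x) (T.z l)) (T.repr_eq (i x)) k) (f x)
  sec_repr {V} j _ hD k := (extPowerFrame e p q hq).sec_repr j (hD V (𝟙 V) _
    ((ringSec O).res j _ (ringSec_rgerm (T.z k.1)))) k.2

end DerFrames

/-! ### Tensor products of sheaves via perfect pairings -/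

section Tensor

variable {X : TopCat.{0}} {O : TopCat.Sheaf CommRingCat.{0} X}

namespace GermFamily

theorem sections_sum (G : GermFamily O) {U : Opens X} {κ : Type} (S : Finset κ)
    (f : κ → G.sections U) (x : U) : (∑ k ∈ S, f k).1 x = ∑ k ∈ S, (f k).1 x := by
  rw [AddSubgroup.val_finsetSum, Finset.sum_apply]

namespace Frame

variable {G : GermFamily O} {U : Opens X} {κ : Type} (e : G.Frame U κ)

/-- The sections forming a frame. -/
def sect (k : κ) : G.sections U := ⟨_, e.sec_basis k⟩

theorem exists_coord [Fintype κ] (s : G.sections U) :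
    ∃ c : κ → (O.obj.obj (op U) : CommRingCat), s = ∑ k, c k • e.sect k := by
  choose c hc using fun k => exists_rgerm (e.sec_repr (𝟙 U) s.2 k)
  refine ⟨c, Subtype.ext (funext fun x => ?_)⟩
  rw [sections_sum]
  refine ((e.basis x).sum_repr (s.1 x)).symm.trans (Finset.sum_congr rfl fun k _ => ?_)
  exact congrArg (· • e.basis x k) (hc k x)

end Frame

end GermFamily

/-- A pairing of families of germs, taking sections to sections. -/
structure Pairing (A B H : GermFamily O) where
  map : ∀ x, A.fiber x →ₗ[RStalk O x] B.fiber x →ₗ[RStalk O x] H.fiber x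
  sec : ∀ {U : Opens X} {f : ∀ x : U, A.fiber x} {g : ∀ x : U, B.fiber x},
    A.sec.pred f → B.sec.pred g → H.sec.pred (fun x => map x (f x) (g x))

namespace Pairing

variable {A B H : GermFamily O} (μ : Pairing A B H)

/-- The pairing on sections. -/
def onSections (U : Opens X) : (A.sections U) →ₗ[(O.obj.obj (op U) : CommRingCat)]
    (B.sections U) →ₗ[(O.obj.obj (op U) : CommRingCat)] (H.sections U) :=
  LinearMap.mk₂ _ (fun s t => ⟨_, μ.sec s.2 t.2⟩)
    (fun s s' t => Subtype.ext <| funext fun x => by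
      change μ.map x (s.1 x + s'.1 x) (t.1 x) = μ.map x (s.1 x) (t.1 x) + μ.map x (s'.1 x) (t.1 x)
      rw [map_add, LinearMap.add_apply])
    (fun a s t => Subtype.ext <| funext fun x => by
      change μ.map x (rgerm O x a • s.1 x) (t.1 x) = rgerm O x a • μ.map x (s.1 x) (t.1 x)
      rw [map_smul, LinearMap.smul_apply])
    (fun s t t' => Subtype.ext <| funext fun x => by
      change μ.map x (s.1 x) (t.1 x + t'.1 x) = μ.map x (s.1 x) (t.1 x) + μ.map x (s.1 x) (t'.1 x)
      rw [map_add])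
    (fun a s t => Subtype.ext <| funext fun x => by
      change μ.map x (s.1 x) (rgerm O x a • t.1 x) = rgerm O x a • μ.map x (s.1 x) (t.1 x)
      rw [map_smul])

/-- The map on the presheaf tensor product. -/
def preMap : preTensor A.toModSheaf B.toModSheaf ⟶
    (SheafOfModules.forget _ ⋙ PresheafOfModules.restrictScalars (𝟙 (ringSheaf O).obj)).obj
      H.toModSheaf where
  app U := ModuleCat.ofHom (X := (preTensor A.toModSheaf B.toModSheaf).obj U)
    (Y := ((SheafOfModules.forget _ ⋙ PresheafOfModules.restrictScalars (𝟙 (ringSheaf O).obj)).obj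
      H.toModSheaf).obj U) (TensorProduct.lift (μ.onSections U.unop))
  naturality {U V} i := by
    refine ModuleCat.hom_ext (LinearMap.ext fun t => ?_)
    induction t using TensorProduct.induction_on with
    | zero => exact (map_zero _).trans (map_zero _).symm
    | tmul s t => rfl
    | add a b ha hb => exact (map_add _ a b).trans ((congrArg₂ (· + ·) ha hb).trans (map_add _ a b).symm)

/-- Every tensor is a combination of products of frame sections (`gen`), and the map sends it to the
section with the same coefficients in the frame `h` (`key`). Injectivity and surjectivity are read
off from these coefficients. -/
theorem lift_bijective {U : Opens X} {κ κ' : Type} [Fintype κ] [Fintype κ'] (a : A.Frame U κ)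
    (b : B.Frame U κ') (h : H.Frame U (κ × κ'))
    (hμ : ∀ x i j, μ.map x.1 (a.basis x i) (b.basis x j) = h.basis x (i, j)) :
    Function.Bijective (TensorProduct.lift (μ.onSections U)) := by
  have key : ∀ (c : κ × κ' → (O.obj.obj (op U) : CommRingCat)) (x : U),
      (TensorProduct.lift (μ.onSections U)
        (∑ k, c k • (a.sect k.1 ⊗ₜ[(O.obj.obj (op U) : CommRingCat)] b.sect k.2))).1 x =
      ∑ k, rgerm O x (c k) • h.basis x k := by
    intro c x
    rw [map_sum, GermFamily.sections_sum]
    refine Finset.sum_congr rfl fun k _ => ?_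
    rw [map_smul, TensorProduct.lift.tmul]
    exact congrArg (rgerm O x (c k) • ·) (hμ x k.1 k.2)
  have gen : ∀ t : (A.sections U) ⊗[(O.obj.obj (op U) : CommRingCat)] (B.sections U),
      ∃ c : κ × κ' → (O.obj.obj (op U) : CommRingCat),
        t = ∑ k, c k • (a.sect k.1 ⊗ₜ[(O.obj.obj (op U) : CommRingCat)] b.sect k.2) := by
    intro t
    induction t using TensorProduct.induction_on with
    | zero => exact ⟨0, by simp⟩
    | tmul s t =>
      obtain ⟨c, rfl⟩ := a.exists_coord s
      obtain ⟨d, rfl⟩ := b.exists_coord t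
      refine ⟨fun k => c k.1 * d k.2, ?_⟩
      rw [TensorProduct.sum_tmul, Fintype.sum_prod_type]
      refine Finset.sum_congr rfl fun i _ => ?_
      rw [TensorProduct.tmul_sum]
      refine Finset.sum_congr rfl fun j _ => ?_
      rw [TensorProduct.smul_tmul_smul]
    | add s t hs ht =>
      obtain ⟨c, rfl⟩ := hs
      obtain ⟨d, rfl⟩ := ht
      exact ⟨c + d, by simp only [Pi.add_apply, add_smul, Finset.sum_add_distrib]⟩
  refine ⟨fun t t' ht => ?_, fun f => ?_⟩
  · obtain ⟨c, rfl⟩ := gen t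
    obtain ⟨d, rfl⟩ := gen t'
    refine Finset.sum_congr rfl fun k _ => congrArg (· • _) (rgerm_injective fun x => ?_)
    have e := (key c x).symm.trans ((congrArg (fun f => f.1 x) ht).trans (key d x))
    have e' := congrArg (fun v => (h.basis x).repr v k) e
    beta_reduce at e'
    rwa [Module.Basis.repr_sum_self, Module.Basis.repr_sum_self] at e'
  · obtain ⟨c, hc⟩ := h.exists_coord f
    refine ⟨_, Subtype.ext (funext fun x => (key c x).trans ?_)⟩
    rw [hc, GermFamily.sections_sum]
    rfl

/-- The induced map on the tensor product of sheaves. -/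
def tensorMap : tensor A.toModSheaf B.toModSheaf ⟶ H.toModSheaf :=
  ((PresheafOfModules.sheafificationAdjunction (𝟙 (ringSheaf O).obj)).homEquiv _ _).symm μ.preMap

/-- The universal property of sheafification, at the level of presheaves of groups, where local
bijectivity is tested. -/
theorem unit_tensorMap :
    CategoryTheory.toSheafify (Opens.grothendieckTopology X)
      (preTensor A.toModSheaf B.toModSheaf).presheaf ≫
        (PresheafOfModules.toPresheaf _).map μ.tensorMap.val =
      (PresheafOfModules.toPresheaf _).map μ.preMap :=
  congrArg (PresheafOfModules.toPresheaf _).map (((PresheafOfModules.sheafificationAdjunction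
    (𝟙 (ringSheaf O).obj)).homEquiv _ _).apply_symm_apply μ.preMap)

theorem value_tensorMap {U : Opens X} (s : A.toModSheaf.val.obj (op U))
    (t : B.toModSheaf.val.obj (op U)) (x : U) :
    H.value (μ.tensorMap.val.app (op U) (tensorSection _ _ U (s ⊗ₜ t))) x =
      μ.map x.1 (A.value s x) (B.value t x) := by
  have h := congrArg (fun f => H.value (f.app (op U) (s ⊗ₜ t)) x) μ.unit_tensorMap
  exact h

/-- The pairing is a local isomorphism: it takes products of frames to frames. -/
def IsPerfect : Prop := ∀ x : X, ∃ (U : Opens X) (_ : x ∈ U) (κ κ' : Type) (_ : Fintype κ)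
  (_ : Fintype κ') (a : A.Frame U κ) (b : B.Frame U κ') (h : H.Frame U (κ × κ')),
  ∀ x i j, μ.map x.1 (a.basis x i) (b.basis x j) = h.basis x (i, j)

variable {μ}

theorem IsPerfect.exists_bijective (hμ : μ.IsPerfect) {U : Opens X} {x : X} (hx : x ∈ U) :
    ∃ (V : Opens X) (_ : x ∈ V) (_ : V ⟶ U),
      Function.Bijective (TensorProduct.lift (μ.onSections V)) := by
  obtain ⟨V, hV, κ, κ', _, _, a, b, h, e⟩ := hμ x
  exact ⟨U ⊓ V, ⟨hx, hV⟩, Opens.infLELeft U V,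
    μ.lift_bijective (a.restrict (Opens.infLERight U V)) (b.restrict (Opens.infLERight U V))
      (h.restrict (Opens.infLERight U V)) fun x i j => e ⟨x.1, x.2.2⟩ i j⟩

theorem IsPerfect.isLocallyInjective (hμ : μ.IsPerfect) :
    Presheaf.IsLocallyInjective (Opens.grothendieckTopology X)
      ((PresheafOfModules.toPresheaf _).map μ.preMap) where
  equalizerSieve_mem {U} s t h := by
    intro x hx
    obtain ⟨V, hV, i, hb⟩ := hμ.exists_bijective hx
    refine ⟨V, i, hb.1 ?_, hV⟩
    have e := NatTrans.naturality_apply ((PresheafOfModules.toPresheaf _).map μ.preMap) i.op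
    exact (e s).trans ((congrArg _ h).trans (e t).symm)

theorem IsPerfect.isLocallySurjective (hμ : μ.IsPerfect) :
    Presheaf.IsLocallySurjective (Opens.grothendieckTopology X)
      ((PresheafOfModules.toPresheaf _).map μ.preMap) where
  imageSieve_mem {U} s := by
    intro x hx
    obtain ⟨V, hV, i, hb⟩ := hμ.exists_bijective hx
    exact ⟨V, i, hb.2 _, hV⟩

/-- The unit of sheafification and its composite `preMap` with `tensorMap` are both locally
bijective, hence so is `tensorMap`. A locally bijective map of sheaves of groups is an isomorphism,
and forgetting the module structure reflects isomorphisms. -/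
theorem IsPerfect.isIso_tensorMap (hμ : μ.IsPerfect) : IsIso μ.tensorMap := by
  have hW := (Opens.grothendieckTopology X).W_toSheafify
    (preTensor A.toModSheaf B.toModSheaf).presheaf
  have h1 : Sheaf.IsLocallyInjective ((SheafOfModules.toSheaf _).map μ.tensorMap) :=
    (@Presheaf.comp_isLocallyInjective_iff _ _ (Opens.grothendieckTopology X) _ _ _ _ _ _ _ _ _ _ _
      hW.isLocallyInjective hW.isLocallySurjective).1 (μ.unit_tensorMap ▸ hμ.isLocallyInjective)
  have h2 : Sheaf.IsLocallySurjective ((SheafOfModules.toSheaf _).map μ.tensorMap) :=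
    (@Presheaf.comp_isLocallySurjective_iff _ _ (Opens.grothendieckTopology X) _ _ _ _ _ _ _ _ _ _ _
      hW.isLocallySurjective).1 (μ.unit_tensorMap ▸ hμ.isLocallySurjective)
  have := (Sheaf.isLocallyBijective_iff_isIso _).1 ⟨h1, h2⟩
  exact isIso_of_reflects_iso _ (SheafOfModules.toSheaf _)

end Pairing

end Tensor

/-! ### Sheaf morphisms given on fibers, and exactness -/

section FiberHom

variable {X : TopCat.{0}} {O : TopCat.Sheaf CommRingCat.{0} X}

namespace GermFamily

theorem sheafHom_ext {G : GermFamily O} {W : ModSheaf O} {f g : W ⟶ G.toModSheaf}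
    (h : ∀ (U : Opens X) (w : W.val.obj (op U)) (x : U),
      G.value (f.val.app (op U) w) x = G.value (g.val.app (op U) w) x) : f = g :=
  SheafOfModules.hom_ext (PresheafOfModules.hom_ext fun U =>
    ModuleCat.hom_ext (LinearMap.ext fun w => G.value_ext fun x => h U.unop w x))

/-- Construct a morphism into the sheaf of sections of `G` from families of values. -/
def sheafHom {G : GermFamily O} {W : ModSheaf O}
    (f : ∀ (U : Opens X) (_ : W.val.obj (op U)) (x : U), G.fiber x)
    (sec : ∀ U w, G.sec.pred (f U w))
    (add : ∀ U v w x, f U (v + w) x = f U v x + f U w x)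
    (smul : ∀ U (a : (O.obj.obj (op U) : CommRingCat)) w x, f U (a • w) x = rgerm O x a • f U w x)
    (res : ∀ {U V : Opens X} (i : V ⟶ U) w x, f V (W.val.map i.op w) x = f U w (i x)) :
    W ⟶ G.toModSheaf where
  val :=
    { app := fun U => ModuleCat.ofHom (Y := G.toModSheaf.val.obj U)
        { toFun := fun w => G.mkSec (f U.unop w) (sec U.unop w)
          map_add' := fun v w => G.value_ext fun x => add U.unop v w x
          map_smul' := fun a w => G.value_ext fun x => smul U.unop a w x }
      naturality := fun i => ModuleCat.hom_ext (LinearMap.ext fun w =>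
        G.value_ext fun x => res i.unop w x) }

end GermFamily

/-- A family of linear maps of fibers, taking sections to sections. -/
structure FiberHom (A B : GermFamily O) where
  map : ∀ x, A.fiber x →ₗ[RStalk O x] B.fiber x
  sec : ∀ {U : Opens X} {f : ∀ x : U, A.fiber x}, A.sec.pred f → B.sec.pred (fun x => map x (f x))

namespace FiberHom

variable {A B C : GermFamily O} (φ : FiberHom A B) (ψ : FiberHom B C)

/-- The morphism of sheaves of modules. -/
def toHom : A.toModSheaf ⟶ B.toModSheaf :=
  GermFamily.sheafHom (fun _ w x => φ.map x (A.value w x)) (fun _ w => φ.sec (A.value_sec w))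
    (fun _ v w x => map_add (φ.map x.1) (A.value v x) (A.value w x))
    (fun _ a w x => map_smul (φ.map x.1) (rgerm O x a) (A.value w x))
    (fun _ _ _ => rfl)

theorem mono_toHom (hφ : ∀ x, Function.Injective (φ.map x)) : Mono φ.toHom where
  right_cancellation f g h := GermFamily.sheafHom_ext fun U w x => hφ x <| by
    have := congrArg (fun k => B.value (k.val.app (op U) w) x) h
    exact this

theorem epi_toHom (hφ : ∀ {U : Opens X} (s : B.toModSheaf.val.obj (op U)) (x : U),
    ∃ (V : Opens X) (_ : x.1 ∈ V) (i : V ⟶ U) (t : A.toModSheaf.val.obj (op V)),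
      ∀ y, φ.map y.1 (A.value t y) = B.value s (i y)) : Epi φ.toHom := by
  have h : Sheaf.IsLocallySurjective ((SheafOfModules.toSheaf _).map φ.toHom) :=
    ⟨fun {U} s x hx => by
      obtain ⟨V, hV, i, t, ht⟩ := hφ s ⟨x, hx⟩
      exact ⟨V, i, ⟨t, B.value_ext ht⟩, hV⟩⟩
  have := (Sheaf.isLocallySurjective_iff_epi' (A := Ab.{0}) _).1 h
  exact (SheafOfModules.toSheaf _).epi_of_epi_map this

theorem toHom_comp_eq_zero (h : ∀ x a, ψ.map x (φ.map x a) = 0) : φ.toHom ≫ ψ.toHom = 0 :=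
  GermFamily.sheafHom_ext fun _ w x => h x (A.value w x)

/-- The preimages in the fibers are unique, so additivity, linearity and compatibility with
restriction can be checked after applying `φ`; `hsec` makes them sections. -/
theorem exists_lift {W : ModSheaf O} (k : W ⟶ B.toModSheaf) (hφ : ∀ x, Function.Injective (φ.map x))
    (hsec : ∀ {U : Opens X} {f : ∀ x : U, A.fiber x}, B.sec.pred (fun x => φ.map x (f x)) →
      A.sec.pred f)
    (hk : ∀ (U : Opens X) (w : W.val.obj (op U)) (x : U),
      ∃ a, φ.map x a = B.value (k.val.app (op U) w) x) : ∃ l, l ≫ φ.toHom = k := by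
  choose f hf using hk
  refine ⟨GermFamily.sheafHom f (fun U w => hsec ?_) (fun U v w x => hφ _ ?_)
    (fun U a w x => hφ _ ?_) (fun {U V} i w x => hφ _ ?_),
    GermFamily.sheafHom_ext fun U w x => hf U w x⟩
  · exact pred_congr (B.value_sec (k.val.app (op U) w)) (hf U w)
  · refine (hf U (v + w) x).trans (Eq.trans ?_ (map_add (φ.map x.1) _ _).symm)
    exact (congrArg (fun s => B.value s x) (map_add (k.val.app (op U)).hom v w)).trans
      (congrArg₂ (· + ·) (hf U v x) (hf U w x)).symm
  · refine (hf U (a • w) x).trans (Eq.trans ?_ (map_smul (φ.map x.1) _ _).symm)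
    exact (congrArg (fun s => B.value s x) (map_smul (k.val.app (op U)).hom a w)).trans
      (congrArg (rgerm O x a • ·) (hf U w x)).symm
  · refine (hf V _ x).trans (Eq.trans ?_ (hf U w (i x)).symm)
    exact congrArg (fun s => B.value s x) (PresheafOfModules.naturality_apply k.val i.op w)

theorem exact_toHom (w : φ.toHom ≫ ψ.toHom = 0) (hφ : ∀ x, Function.Injective (φ.map x))
    (hsec : ∀ {U : Opens X} {f : ∀ x : U, A.fiber x}, B.sec.pred (fun x => φ.map x (f x)) →
      A.sec.pred f)
    (hex : ∀ x b, ψ.map x b = 0 → ∃ a, φ.map x a = b) :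
    (ShortComplex.mk φ.toHom ψ.toHom w).Exact := by
  have := φ.mono_toHom hφ
  -- A morphism killed by `ψ` has its values in the fiberwise kernels, so it lifts through `φ`. This
  -- makes `φ` the kernel of `ψ`.
  refine ShortComplex.exact_of_f_is_kernel _ (Limits.KernelFork.IsLimit.ofι' _ _ fun {W} k hk => ?_)
  have h := φ.exists_lift k hφ hsec fun U w x => hex _ _ <| by
    have := congrArg (fun k : W ⟶ C.toModSheaf => C.value (k.val.app (op U) w) x) hk
    exact this
  exact ⟨h.choose, h.choose_spec⟩

theorem shortExact_toHom (w : φ.toHom ≫ ψ.toHom = 0) (hφ : ∀ x, Function.Injective (φ.map x))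
    (hsec : ∀ {U : Opens X} {f : ∀ x : U, A.fiber x}, B.sec.pred (fun x => φ.map x (f x)) →
      A.sec.pred f)
    (hex : ∀ x b, ψ.map x b = 0 → ∃ a, φ.map x a = b)
    (hψ : ∀ {U : Opens X} (s : C.toModSheaf.val.obj (op U)) (x : U),
    ∃ (V : Opens X) (_ : x.1 ∈ V) (i : V ⟶ U) (t : B.toModSheaf.val.obj (op V)),
      ∀ y, ψ.map y.1 (B.value t y) = C.value s (i y)) :
    (ShortComplex.mk φ.toHom ψ.toHom w).ShortExact where
  exact := exact_toHom φ ψ w hφ hsec hex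
  mono_f := φ.mono_toHom hφ
  epi_g := ψ.epi_toHom hψ

/-- The isomorphism given by mutually inverse families. -/
def toIso (φ : FiberHom A B) (χ : FiberHom B A) (h : ∀ x a, χ.map x (φ.map x a) = a)
    (h' : ∀ x b, φ.map x (χ.map x b) = b) : A.toModSheaf ≅ B.toModSheaf where
  hom := φ.toHom
  inv := χ.toHom
  hom_inv_id := GermFamily.sheafHom_ext fun _ w x => h x (A.value w x)
  inv_hom_id := GermFamily.sheafHom_ext fun _ w x => h' x (B.value w x)

end FiberHom

end FiberHom

/-! ### The exact sequence in a stalk -/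

section Algebra

theorem mem_gr_natCast {R N : Type} [CommRing R] [AddCommGroup N] [Module R N] {p : ℕ}
    {a : ExteriorAlgebra R N} : a ∈ gr R N p ↔ a ∈ ⋀[R]^p N := by
  rw [gr_natCast]

variable {R N : Type} [CommRing R] [Algebra ℂ R] [AddCommGroup N] [Module R N] [Module ℂ N]
  [IsScalarTower ℂ R N]

/-- An element of `⋀^(p+1)` as an element of the component of degree `p + 1`. -/
def toGrSucc {p : ℕ} (η : ⋀[R]^(p + 1) N) : gr R N (p + 1 : ℤ) :=
  ⟨η.1, (mem_gr_natCast (p := p + 1)).2 η.2⟩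

variable (R N) in
/-- The bilinear map taking `φ` and `η` to the product of `η` and the contraction with `φ`. -/
def vertPair (p : ℕ) : Module.Dual R N →ₗ[R] ⋀[R]^(p + 1) N →ₗ[R] vertDeg R N (p : ℤ) :=
  LinearMap.mk₂ R (fun φ η => ⟨_, vertDer_mem_vertDeg φ (toGrSucc η)⟩)
    (fun φ φ' η => Subtype.ext (LinearMap.ext fun a => by
      change η.1 * contr (φ + φ') a = η.1 * contr φ a + η.1 * contr φ' a
      rw [show contr (φ + φ') = contr φ + contr φ' from map_add _ φ φ', LinearMap.add_apply,
        mul_add]))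
    (fun r φ η => Subtype.ext (LinearMap.ext fun a => by
      change η.1 * contr (r • φ) a = r • (η.1 * contr φ a)
      rw [show contr (r • φ) = r • contr φ from map_smul _ r φ, LinearMap.smul_apply,
        mul_smul_comm]))
    (fun φ η η' => Subtype.ext (LinearMap.ext fun a => by
      change (η.1 + η'.1) * contr φ a = η.1 * contr φ a + η'.1 * contr φ a
      rw [add_mul]))
    (fun r φ η => Subtype.ext (LinearMap.ext fun a => by
      change (r • η.1) * contr φ a = r • (η.1 * contr φ a)
      rw [smul_mul_assoc]))

variable (R N) in
/-- The bilinear map taking `D` and `η` to the derivation `r ↦ D r • η`. -/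
def horPair (p : ℕ) : Derivation ℂ R R →ₗ[R] ⋀[R]^p N →ₗ[R] Derivation ℂ R (⋀[R]^p N) :=
  LinearMap.mk₂ R smulDer
    (fun D D' η => Derivation.ext fun r => add_smul (D r) (D' r) η)
    (fun s D η => Derivation.ext fun r => mul_smul s (D r) η)
    (fun D η η' => Derivation.ext fun r => smul_add (D r) η η')
    (fun s D η => Derivation.ext fun r => smul_comm (D r) s η)

variable (R N) in
/-- Restriction of superderivations of degree `p` to `R`. -/
def resMap (p : ℕ) : derDeg R N (p : ℤ) →ₗ[R] Derivation ℂ R (⋀[R]^p N) where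
  toFun δ := Derivation.mk'
    { toFun := fun r => ⟨δ.1 (algebraMap R _ r), mem_gr_natCast.1 (map_algebraMap_mem_gr δ.2 r)⟩
      map_add' := fun r s => Subtype.ext ((resDer δ).map_add r s)
      map_smul' := fun c r => Subtype.ext ((resDer δ).map_smul c r) }
    (fun r s => Subtype.ext ((resDer δ).leibniz r s))
  map_add' _ _ := rfl
  map_smul' _ _ := rfl

theorem resMap_apply {p : ℕ} (δ : derDeg R N (p : ℤ)) (r : R) :
    (resMap R N p δ r : ExteriorAlgebra R N) = δ.1 (algebraMap R _ r) := rfl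

variable (R N) in
theorem vertDeg_le (p : ℤ) : vertDeg R N p ≤ derDeg R N p := fun _ h => h.1

theorem mem_vertDeg_of_resMap {p : ℕ} {δ : derDeg R N (p : ℤ)} (h : resMap R N p δ = 0) :
    δ.1 ∈ vertDeg R N (p : ℤ) :=
  ⟨δ.2, fun r => (resMap_apply δ r).symm.trans (congrArg Subtype.val (DFunLike.congr_fun h r))⟩

/-- A superderivation with given restriction to `R`. -/
def horLift {m n : ℕ} (b : Module.Basis (Fin m) R N)
    (B : Module.Basis (Fin n) R (Derivation ℂ R R)) (z : Fin n → R)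
    (hz : ∀ D i, B.repr D i = D (z i)) {p : ℕ} (D : Derivation ℂ R (⋀[R]^p N)) :
    derDeg R N (p : ℤ) :=
  ∑ k, (modDerBasis (grBasis b p p rfl) B z hz).repr D k • horDer b (B k.1) k.2

theorem resMap_horLift {m n : ℕ} (b : Module.Basis (Fin m) R N)
    (B : Module.Basis (Fin n) R (Derivation ℂ R R)) (z : Fin n → R)
    (hz : ∀ D i, B.repr D i = D (z i)) {p : ℕ} (D : Derivation ℂ R (⋀[R]^p N)) :
    resMap R N p (horLift b B z hz D) = D := by
  rw [horLift, map_sum]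
  conv_rhs => rw [← (modDerBasis (grBasis b p p rfl) B z hz).sum_repr D]
  refine Finset.sum_congr rfl fun k _ => ?_
  rw [map_smul, modDerBasis_apply]
  refine congrArg (_ • ·) (Derivation.ext fun r => Subtype.ext ?_)
  rw [resMap_apply, horDer_algebraMap, smulDer_apply, Submodule.coe_smul, grBasis_apply]

end Algebra

/-! ### Vertical derivations, restriction and local lifting -/

section Sheaves

variable {X : TopCat.{0}} {O : TopCat.Sheaf CommRingCat.{0} X} [∀ x, Algebra ℂ (RStalk O x)]
  {F : ModSheaf O} {m n : ℕ}

variable (F) in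
/-- The pairing of `F^*` and `Λ^{p+1}(F)`. -/
def vertPairing (p : ℕ) : Pairing (dual F) (extPower F (p + 1)) (vertP F p) where
  map x := vertPair (RStalk O x) (Stalk F x) p
  sec {_ _ g} hf hg := carries_contr hf (η := fun x => toGrSucc (g x)) hg

variable (F) in
/-- The pairing of `T` and `Λ^p(F)`. -/
def horPairing (p : ℕ) : Pairing (tangent O) (extPower F p) (extDer F p) where
  map x := horPair (RStalk O x) (Stalk F x) p
  sec hf hg V i _ hs := (extPower F p).smul_sec' (hf V i _ hs) ((extPower F p).sec.res i _ hg)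

variable (F) in
/-- The inclusion of the derivations that vanish on `O`. -/
def vertIncl (p : ℕ) : FiberHom (vertP F p) (derP F p) where
  map x := Submodule.inclusion (vertDeg_le (RStalk O x) (Stalk F x) p)
  sec h := h

variable (F) in
/-- The restriction of derivations to `O`. -/
def resHom (p : ℕ) : FiberHom (derP F p) (extDer F p) where
  map x := resMap (RStalk O x) (Stalk F x) p
  sec h V i _ hs := h V i _ (extSec_algebraMap hs)

variable (hF : IsLocallyFreeOfRank F m)
  (hT : ∀ x, ∃ U : Opens X, x ∈ U ∧ Nonempty (CoordFrame O U n))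

theorem exists_frames (hF : IsLocallyFreeOfRank F m)
    (hT : ∀ x, ∃ U : Opens X, x ∈ U ∧ Nonempty (CoordFrame O U n)) (x : X) :
    ∃ U : Opens X, x ∈ U ∧ Nonempty ((stalkFamily F).Frame U (Fin m)) ∧
      Nonempty (CoordFrame O U n) := by
  obtain ⟨U, hU, ⟨e⟩⟩ := exists_frame hF x
  obtain ⟨V, hV, ⟨T⟩⟩ := hT x
  exact ⟨U ⊓ V, ⟨hU, hV⟩, ⟨e.restrict (Opens.infLELeft U V)⟩, ⟨T.restrict (Opens.infLERight U V)⟩⟩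

theorem vertPairing_isPerfect (hF : IsLocallyFreeOfRank F m) (p : ℕ) :
    (vertPairing F p).IsPerfect := by
  intro x
  obtain ⟨U, hU, ⟨e⟩⟩ := exists_frame hF x
  -- `Nat.cast_succ p` matches the natural exponent `p + 1` of the exterior power with the integer
  -- degree `p + 1` that indexes the monomials of vertical derivations.
  refine ⟨U, hU, _, _, inferInstance, inferInstance, dualFrame e,
    extPowerFrame e (p + 1) (p + 1 : ℤ) (Nat.cast_succ p), vertFrame e p, fun y i J => ?_⟩
  refine Subtype.ext ?_
  refine Eq.trans ?_ (vertBasis_apply (stalkBasis e y) p (i, J)).symm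
  refine LinearMap.ext fun a => ?_
  change (grBasis (stalkBasis e y) (p + 1) _ (Nat.cast_succ p) J).1 * contr ((stalkBasis e y).dualBasis i) a =
    (stalkBasis e y).ExteriorAlgebra J.1 * contr ((stalkBasis e y).coord i) a
  rw [grBasis_apply, Module.Basis.coe_dualBasis]

theorem horPairing_isPerfect (hF : IsLocallyFreeOfRank F m)
    (hT : ∀ x, ∃ U : Opens X, x ∈ U ∧ Nonempty (CoordFrame O U n)) (p : ℕ) :
    (horPairing F p).IsPerfect := by
  intro x
  obtain ⟨U, hU, ⟨e⟩, ⟨T⟩⟩ := exists_frames hF hT x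
  exact ⟨U, hU, _, _, inferInstance, inferInstance, T.frame,
    extPowerFrame e p p rfl, extDerFrame e T p p rfl, fun y i J =>
      (modDerBasis_apply (grBasis (stalkBasis e y) p p rfl) (T.basis y)
        (fun i => rgerm O y (T.z i)) (T.repr_eq y) (i, J)).symm⟩

/-- Where frames exist, a derivation of `O` with values in `Λ^p(F)` is a combination of the `∂_i`
times monomials. The same combination of the superderivations `horDer` restricts to it, and its
coefficients are sections. The lift depends on the frames, so it is only local. -/
theorem exists_local_lift (hF : IsLocallyFreeOfRank F m)
    (hT : ∀ x, ∃ U : Opens X, x ∈ U ∧ Nonempty (CoordFrame O U n)) (p : ℕ) {U : Opens X}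
    (s : (extDer F p).toModSheaf.val.obj (op U)) (x : U) :
    ∃ (V : Opens X) (_ : x.1 ∈ V) (i : V ⟶ U) (t : (derSheaf F p).val.obj (op V)),
      ∀ y : V, (resHom F p).map y.1 ((derP F p).value t y) = (extDer F p).value s (i y) := by
  obtain ⟨W, hW, ⟨e⟩, ⟨T⟩⟩ := exists_frames hF hT x.1
  have hs := (extDer F p).sec.res (Opens.infLELeft U W) _ ((extDer F p).value_sec s)
  have hf : (derP F p).sec.pred fun y : (U ⊓ W : Opens X) =>
      horLift (stalkBasis e (Opens.infLERight U W y)) (T.basis (Opens.infLERight U W y))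
        (fun i => rgerm O _ (T.z i)) (T.repr_eq _) ((extDer F p).value s (Opens.infLELeft U W y)) :=
    (derP F p).sum_sec Finset.univ fun k _ =>
      (derP F p).smul_sec' ((extDerFrame e T p p rfl).sec_repr (Opens.infLERight U W) hs k)
        ((derP F p).sec.res (Opens.infLERight U W) _ (carries_horDer e T k.1 k.2))
  exact ⟨U ⊓ W, ⟨x.2, hW⟩, Opens.infLELeft U W, (derP F p).mkSec _ hf, fun y =>
    resMap_horLift _ _ _ _ _⟩

theorem shortExact_res (hF : IsLocallyFreeOfRank F m)
    (hT : ∀ x, ∃ U : Opens X, x ∈ U ∧ Nonempty (CoordFrame O U n)) (p : ℕ)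
    (w : (vertIncl F p).toHom ≫ (resHom F p).toHom = 0) :
    (ShortComplex.mk (vertIncl F p).toHom (resHom F p).toHom w).ShortExact :=
  FiberHom.shortExact_toHom _ _ w
    (fun x => Submodule.inclusion_injective (vertDeg_le (RStalk O x) (Stalk F x) p)) (fun h => h)
    (fun _ b h => ⟨⟨b.1, mem_vertDeg_of_resMap h⟩, rfl⟩)
    (exists_local_lift hF hT p)

end Sheaves

/-! ### Degree `-1`: superderivations and linear forms -/

section Algebra

theorem algebraMap_algebraMapInv {R N : Type} [CommRing R] [AddCommGroup N] [Module R N] {q : ℤ} (hq : q = 0) {a : ExteriorAlgebra R N}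
    (ha : a ∈ gr R N q) : algebraMap R _ (ExteriorAlgebra.algebraMapInv a) = a := by
  rw [hq, ← Nat.cast_zero, mem_gr_natCast, ExteriorAlgebra.exteriorPower, pow_zero,
    Submodule.mem_one] at ha
  obtain ⟨r, rfl⟩ := ha
  rw [ExteriorAlgebra.algebraMap_leftInverse N r]

variable {R N : Type} [CommRing R] [Algebra ℂ R] [AddCommGroup N] [Module R N] [Module ℂ N]
  [IsScalarTower ℂ R N]

theorem map_algebraMap_eq_zero {p : ℤ} (hp : p < 0) {δ : Module.End ℂ (ExteriorAlgebra R N)}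
    (h : δ ∈ derDeg R N p) (r : R) : δ (algebraMap R _ r) = 0 := by
  have := map_algebraMap_mem_gr h r
  rwa [gr_of_neg hp, Submodule.mem_bot] at this

variable (R N) in
/-- The linear form given by the restriction of a superderivation of degree `-1` to `N`. -/
def formOfDer : derDeg R N (-1) →ₗ[R] Module.Dual R N where
  toFun δ :=
    { toFun := fun s => ExteriorAlgebra.algebraMapInv (δ.1 (ExteriorAlgebra.ι R s))
      map_add' := fun s t => by rw [map_add, map_add, map_add]
      map_smul' := fun r s => by
        rw [map_smul, derDeg_leibniz_algebraMap δ.2, map_algebraMap_eq_zero (by decide) δ.2,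
          zero_mul, zero_add, map_smul, RingHom.id_apply] }
  map_add' δ δ' := LinearMap.ext fun s => map_add ExteriorAlgebra.algebraMapInv
    (δ.1 (ExteriorAlgebra.ι R s)) (δ'.1 (ExteriorAlgebra.ι R s))
  map_smul' r δ := LinearMap.ext fun s => map_smul ExteriorAlgebra.algebraMapInv r
    (δ.1 (ExteriorAlgebra.ι R s))

theorem algebraMap_formOfDer (δ : derDeg R N (-1)) (s : N) :
    algebraMap R _ (formOfDer R N δ s) = δ.1 (ExteriorAlgebra.ι R s) :=
  algebraMap_algebraMapInv (neg_add_cancel 1) (map_ι_mem_gr δ.2 s)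

variable (R N) in
/-- The contractions as superderivations of degree `-1`. -/
def derOfForm : Module.Dual R N →ₗ[R] derDeg R N (-1) where
  toFun φ := ⟨_, contr_mem_derDeg φ⟩
  map_add' φ φ' := Subtype.ext (LinearMap.ext fun a =>
    DFunLike.congr_fun (show contr (φ + φ') = contr φ + contr φ' from map_add _ φ φ') a)
  map_smul' r φ := Subtype.ext (LinearMap.ext fun a =>
    DFunLike.congr_fun (show contr (r • φ) = r • contr φ from map_smul _ r φ) a)

/-- Both sides vanish on `R`, as there is nothing in degree `-1`, and they agree on `N`, whose
images lie in degree 0, that is, in `R`. -/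
theorem derOfForm_formOfDer (δ : derDeg R N (-1)) : derOfForm R N (formOfDer R N δ) = δ :=
  Subtype.ext (derDeg_ext (derOfForm R N (formOfDer R N δ)).2 δ.2
    (fun r => (contr_algebraMap _ r).trans (map_algebraMap_eq_zero (by decide) δ.2 r).symm)
    (fun s => (contr_ι _ s).trans (algebraMap_formOfDer δ s)))

theorem formOfDer_derOfForm (φ : Module.Dual R N) : formOfDer R N (derOfForm R N φ) = φ :=
  LinearMap.ext fun s => (congrArg ExteriorAlgebra.algebraMapInv (contr_ι φ s)).trans
    (ExteriorAlgebra.algebraMap_leftInverse N (φ s))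

end Algebra

section Category

/-- Used to replace the outer terms, vertical derivations and derivations into `Λ^p(F)`, by the
tensor products isomorphic to them. -/
theorem shortExact_conj {C : Type*} [Category C] [Limits.HasZeroMorphisms C] {A A' B D D' : C}
    (a : A' ⟶ A) [IsIso a] (f : A ⟶ B) (g : B ⟶ D) (d : D' ⟶ D) [IsIso d] (w : f ≫ g = 0)
    (w' : (a ≫ f) ≫ g ≫ inv d = 0) (h : (ShortComplex.mk f g w).ShortExact) :
    (ShortComplex.mk (a ≫ f) (g ≫ inv d) w').ShortExact :=
  ShortComplex.shortExact_of_iso (ShortComplex.isoMk (S₁ := .mk (a ≫ f) (g ≫ inv d) w')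
    (S₂ := .mk f g w) (asIso a) (Iso.refl _) (asIso d) (by simp) (by simp)).symm h

end Category

/-! ### The isomorphism in degree `-1` and the exact sequence of sheaves -/

section Sheaves

variable {X : TopCat.{0}} {O : TopCat.Sheaf CommRingCat.{0} X}
  {F : ModSheaf O} {m n : ℕ}

theorem ringSec_algebraMapInv {U : Opens X} {f : ∀ x : U, ExtStalk F x}
    (hf : (extSec F).pred f) :
    (ringSec O).pred (fun x => ExteriorAlgebra.algebraMapInv (f x)) := by
  refine extSec_induction (P := fun V f => (ringSec O).pred
    (fun x : V => ExteriorAlgebra.algebraMapInv (f x))) hf (fun h => ?_) (fun V _ a => ?_)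
    (fun V _ s => ?_) (fun V _ f g hf hg => ?_) (fun V _ f g hf hg => ?_)
  · exact (ringSec O).locality _ h
  · exact pred_congr (ringSec_rgerm a) fun x => ExteriorAlgebra.algebraMap_leftInverse _ _
  · refine pred_congr (ringSec_zero O V) fun x => ?_
    simp [ExteriorAlgebra.algebraMapInv]
  · simp only [map_add]
    exact ringSec_add hf hg
  · simp only [map_mul]
    exact ringSec_mul hf hg

variable [∀ x, Algebra ℂ (RStalk O x)]

variable (F) in
/-- The isomorphism between `Der_{-1} Λ(F)` and `F^*`. -/
def derNegOneIso : derSheaf F (-1) ≅ dualSheaf F :=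
  FiberHom.toIso (A := derP F (-1)) (B := dual F)
    { map := fun x => formOfDer (RStalk O x) (Stalk F x)
      sec := fun h V i _ hs => ringSec_algebraMapInv (h V i _ (extSec_ι hs)) }
    { map := fun x => derOfForm (RStalk O x) (Stalk F x)
      sec := fun h _ i _ hs => extSec_contr ((dual F).sec.res i _ h) hs }
    (fun _ => derOfForm_formOfDer) (fun _ => formOfDer_derOfForm)

theorem derNegOneIso_spec {U : Opens X} (δ : (derSheaf F (-1)).val.obj (op U)) (x : U)
    (s : Stalk F x.1) : derAt δ x (ExteriorAlgebra.ι _ s) =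
      algebraMap _ (ExtStalk F x.1) (dualAt ((derNegOneIso F).hom.val.app (op U) δ) x s) :=
  (algebraMap_formOfDer ((derP F (-1)).value δ x) s).symm

theorem derSheaf_isLocallyFree (hF : IsLocallyFreeOfRank F m)
    (hT : ∀ x, ∃ U : Opens X, x ∈ U ∧ Nonempty (CoordFrame O U n)) (p : ℤ) :
    ∃ r : ℕ, IsLocallyFreeOfRank (derSheaf F p) r := by
  refine ⟨_, (derP F p).isLocallyFree_of_frame
    (κ := (Fin n × GrIdx m p) ⊕ (Fin m × GrIdx m (p + 1))) fun x => ?_⟩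
  obtain ⟨U, hU, ⟨e⟩, ⟨T⟩⟩ := exists_frames hF hT x
  exact ⟨U, hU, ⟨derFrame e T p⟩⟩

/-- The derivation of `O_x` given by a section of `extDer F p`. -/
def extDerAt {p : ℕ} {U : Opens X} (D : (extDer F p).toModSheaf.val.obj (op U)) (x : U) :
    Derivation ℂ (RStalk O x.1) (⋀[RStalk O x.1]^p (Stalk F x.1)) :=
  (extDer F p).value D x

theorem extDerAt_sum {p : ℕ} {U : Opens X} {N : ℕ} (ξ : Fin N → (tangentSheaf O).val.obj (op U))
    (η : Fin N → (extPowerSheaf F p).val.obj (op U)) (x : U) (g : RStalk O x.1) :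
    (extDerAt ((horPairing F p).tensorMap.val.app (op U)
      (∑ k, tensorSection _ _ U (ξ k ⊗ₜ η k))) x g : ExtStalk F x.1) =
      ∑ k, tangentAt (ξ k) x g • extAt (η k) x := by
  have h : extDerAt ((horPairing F p).tensorMap.val.app (op U)
      (∑ k, tensorSection _ _ U (ξ k ⊗ₜ η k))) x =
      ∑ k, horPair (RStalk O x.1) (Stalk F x.1) p (tangentAt (ξ k) x)
        ((extPower F p).value (η k) x) :=
    (congrArg (fun s => (extDer F p).value s x) (map_sum
      ((horPairing F p).tensorMap.val.app (op U)).hom _ _)).trans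
      (((extDer F p).value_sum _ _ x).trans (Finset.sum_congr rfl fun k _ =>
        (horPairing F p).value_tensorMap (ξ k) (η k) x))
  rw [h, ← Derivation.coeFnAddMonoidHom_apply, map_sum, Finset.sum_apply,
    AddSubmonoidClass.coe_finsetSum]
  rfl

/-- The comparison takes place among derivations into `Λ^p(F)`, where equality is tested on values.
Elements of the sheafified tensor product have no such description. -/
theorem resHom_eq_sum_iff {p : ℕ} {U : Opens X} (δ : (derSheaf F p).val.obj (op U)) {N : ℕ}
    (ξ : Fin N → (tangentSheaf O).val.obj (op U)) (η : Fin N → (extPowerSheaf F p).val.obj (op U)) :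
    (resHom F p).toHom.val.app (op U) δ =
        (horPairing F p).tensorMap.val.app (op U) (∑ k, tensorSection _ _ U (ξ k ⊗ₜ η k)) ↔
      ∀ (x : U) (g : RStalk O x.1),
        derAt δ x (algebraMap _ _ g) = ∑ k, tangentAt (ξ k) x g • extAt (η k) x := by
  constructor
  · intro e x g
    refine Eq.trans ?_ (extDerAt_sum ξ η x g)
    exact congrArg (fun s => (extDerAt s x g : ExtStalk F x.1)) e
  · intro e
    exact (extDer F p).value_ext fun x => Derivation.ext fun g =>
      Subtype.ext ((e x g).trans (extDerAt_sum ξ η x g).symm)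

/-- Characterizes a map defined through an inverse isomorphism without computing the inverse. -/
theorem comp_inv_apply_eq_iff {X : TopCat.{0}} {O : TopCat.Sheaf CommRingCat.{0} X}
    {A D D' : ModSheaf O} (f : A ⟶ D) (τ : D' ⟶ D) [IsIso τ] {U : Opens X}
    (a : A.val.obj (op U)) (t : D'.val.obj (op U)) :
    (f ≫ inv τ).val.app (op U) a = t ↔ f.val.app (op U) a = τ.val.app (op U) t := by
  have e₁ : τ.val.app (op U) ((inv τ).val.app (op U) (f.val.app (op U) a)) = f.val.app (op U) a :=
    congrArg (fun k => k.val.app (op U) (f.val.app (op U) a)) (IsIso.inv_hom_id τ)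
  have e₂ : (inv τ).val.app (op U) (τ.val.app (op U) t) = t :=
    congrArg (fun k => k.val.app (op U) t) (IsIso.hom_inv_id τ)
  constructor
  · rintro rfl
    exact e₁.symm
  · intro h
    exact (congrArg ((inv τ).val.app (op U)) h).trans e₂

theorem exists_shortExact (hF : IsLocallyFreeOfRank F m)
    (hT : ∀ x, ∃ U : Opens X, x ∈ U ∧ Nonempty (CoordFrame O U n)) (p : ℕ) :
    ∃ (β : tensor (dualSheaf F) (extPowerSheaf F (p + 1)) ⟶ derSheaf F p)
      (α : derSheaf F p ⟶ tensor (tangentSheaf O) (extPowerSheaf F p)) (w : β ≫ α = 0),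
      (ShortComplex.mk β α w).ShortExact ∧
      (∀ (U : Opens X) (φ : (dualSheaf F).val.obj (op U))
        (η : (extPowerSheaf F (p + 1)).val.obj (op U)) (x : U),
        (∀ g : RStalk O x.1,
          derAt (β.val.app (op U) (tensorSection _ _ U (φ ⊗ₜ η))) x (algebraMap _ _ g) = 0) ∧
        (∀ s : Stalk F x.1,
          derAt (β.val.app (op U) (tensorSection _ _ U (φ ⊗ₜ η))) x (ExteriorAlgebra.ι _ s) =
            dualAt φ x s • extAt η x)) ∧
      (∀ (U : Opens X) (δ : (derSheaf F p).val.obj (op U)) (N : ℕ)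
        (ξ : Fin N → (tangentSheaf O).val.obj (op U))
        (η : Fin N → (extPowerSheaf F p).val.obj (op U)),
        α.val.app (op U) δ = ∑ k, tensorSection _ _ U (ξ k ⊗ₜ η k) ↔
          ∀ (x : U) (g : RStalk O x.1),
            derAt δ x (algebraMap _ _ g) = ∑ k, tangentAt (ξ k) x g • extAt (η k) x) := by
  have h₁ := (vertPairing_isPerfect hF p).isIso_tensorMap
  have h₂ := (horPairing_isPerfect hF hT p).isIso_tensorMap
  have w₀ : (vertIncl F p).toHom ≫ (resHom F p).toHom = 0 :=
    FiberHom.toHom_comp_eq_zero _ _ fun x a => Derivation.ext fun r => Subtype.ext (a.2.2 r)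
  have w : ((vertPairing F p).tensorMap ≫ (vertIncl F p).toHom) ≫
      ((resHom F p).toHom ≫ inv (horPairing F p).tensorMap) = 0 := by
    rw [Category.assoc, reassoc_of% w₀, Limits.zero_comp, Limits.comp_zero]
  refine ⟨(vertPairing F p).tensorMap ≫ (vertIncl F p).toHom,
    (resHom F p).toHom ≫ inv (horPairing F p).tensorMap, w, ?_, ?_, ?_⟩
  · exact shortExact_conj _ _ _ _ w₀ w (shortExact_res hF hT p w₀)
  · intro U φ η x
    have hv := (vertPairing F p).value_tensorMap φ η x
    have h (a : ExtStalk F x.1) : derAt (((vertPairing F p).tensorMap ≫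
        (vertIncl F p).toHom).val.app (op U) (tensorSection _ _ U (φ ⊗ₜ η))) x a =
        (vertDer (dualAt φ x) (toGrSucc ((extPower F (p + 1)).value η x))).1 a :=
      congrArg (fun δ : vertDeg (RStalk O x.1) (Stalk F x.1) p => δ.1 a) hv
    exact ⟨fun g => (h _).trans (vertDer_algebraMap _ _ g), fun s => (h _).trans (vertDer_ι _ _ s)⟩
  · intro U δ N ξ η
    refine Iff.trans ?_ (resHom_eq_sum_iff δ ξ η)
    exact comp_inv_apply_eq_iff (resHom F p).toHom (horPairing F p).tensorMap δ _

end Sheaves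

/-! ### Hadamard's lemma and flat holomorphic functions -/

section Hadamard

open MeasureTheory Topology Metric

variable {E F : Type} [NormedAddCommGroup E] [NormedSpace ℂ E] [NormedAddCommGroup F]
  [NormedSpace ℂ F]

/-- The weighted mean of `f` along the segment from `e` to `w`. -/
def rayInt (e : E) (j : ℕ) (f : E → F) (w : E) : F :=
  ∫ t in (0 : ℝ)..1, (t : ℂ) ^ j • f (e + (t : ℂ) • (w - e))

theorem ray_mem_ball {e w : E} {r t : ℝ} (hw : w ∈ ball e r) (ht : t ∈ Set.Icc (0 : ℝ) 1) :
    e + (t : ℂ) • (w - e) ∈ ball e r := by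
  rw [mem_ball, dist_eq_norm] at hw ⊢
  rw [add_sub_cancel_left, norm_smul, Complex.norm_real, Real.norm_of_nonneg ht.1]
  exact (mul_le_of_le_one_left (norm_nonneg _) ht.2).trans_lt hw

theorem continuousOn_ray {e : E} {ρ : ℝ} {f : E → F} (hf : ContinuousOn f (ball e ρ)) (j : ℕ)
    {w : E} (hw : w ∈ ball e ρ) :
    ContinuousOn (fun t : ℝ => (t : ℂ) ^ j • f (e + (t : ℂ) • (w - e))) (Set.uIcc 0 1) := by
  rw [Set.uIcc_of_le zero_le_one]
  refine ContinuousOn.smul (by fun_prop) (hf.comp (by fun_prop) fun t ht => ray_mem_ball hw ht)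

/-- Differentiation under the integral sign. The chain rule produces a factor `t`, which raises the
weight from `j` to `j + 1`; this is why the means carry a weight. -/
theorem hasFDerivAt_rayInt [FiniteDimensional ℂ E] {e : E} {ρ : ℝ} {f : E → F}
    (hf : ContDiffOn ℂ 1 f (ball e ρ)) (j : ℕ) {w : E} (hw : w ∈ ball e ρ) :
    HasFDerivAt (rayInt e j f) (rayInt e (j + 1) (fderiv ℂ f) w) w := by
  have : ProperSpace E := FiniteDimensional.proper ℂ E
  -- The closed ball of an intermediate radius is compact and contains all segments from `e` to
  -- points near `w`. It supplies the uniform bound on the derivative.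
  obtain ⟨r, hwr, hr⟩ := exists_between (mem_ball.1 hw)
  have hsub : closedBall e r ⊆ ball e ρ := closedBall_subset_ball hr
  have hf' : ContinuousOn (fderiv ℂ f) (ball e ρ) := hf.continuousOn_fderiv_of_isOpen isOpen_ball le_rfl
  obtain ⟨C, hC⟩ := (isCompact_closedBall e r).exists_bound_of_continuousOn (hf'.mono hsub)
  have hint : ∀ {G : Type} [NormedAddCommGroup G] [NormedSpace ℂ G] {g : E → G}
      (_ : ContinuousOn g (ball e ρ)) (i : ℕ) {x : E} (_ : x ∈ ball e r),
      IntervalIntegrable (fun t : ℝ => (t : ℂ) ^ i • g (e + (t : ℂ) • (x - e))) volume 0 1 :=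
    fun hg i x hx => (continuousOn_ray hg i (hsub (ball_subset_closedBall hx))).intervalIntegrable
  refine intervalIntegral.hasFDerivAt_integral_of_dominated_of_fderiv_le
    (F := fun x t => (t : ℂ) ^ j • f (e + (t : ℂ) • (x - e)))
    (F' := fun x t => (t : ℂ) ^ (j + 1) • fderiv ℂ f (e + (t : ℂ) • (x - e)))
    (bound := fun _ => C) (isOpen_ball.mem_nhds (mem_ball.2 hwr)) ?_
    (hint hf.continuousOn j (mem_ball.2 hwr)) ?_ ?_ intervalIntegrable_const ?_
  · filter_upwards [isOpen_ball.mem_nhds (mem_ball.2 hwr)] with x hx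
    exact (hint hf.continuousOn j hx).aestronglyMeasurable_restrict_uIoc
  · exact (hint hf' (j + 1) (mem_ball.2 hwr)).aestronglyMeasurable_restrict_uIoc
  · refine Filter.Eventually.of_forall fun t ht x hx => ?_
    rw [Set.uIoc_of_le zero_le_one] at ht
    have ht' : t ∈ Set.Icc (0 : ℝ) 1 := ⟨ht.1.le, ht.2⟩
    rw [norm_smul, norm_pow, Complex.norm_real, Real.norm_of_nonneg ht'.1]
    refine (mul_le_of_le_one_left (norm_nonneg _) (pow_le_one₀ ht'.1 ht'.2)).trans ?_
    exact hC _ (ball_subset_closedBall (ray_mem_ball hx ht'))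
  · refine Filter.Eventually.of_forall fun t ht x hx => ?_
    rw [Set.uIoc_of_le zero_le_one] at ht
    have ht' : t ∈ Set.Icc (0 : ℝ) 1 := ⟨ht.1.le, ht.2⟩
    have hm := hsub (ball_subset_closedBall (ray_mem_ball hx ht'))
    have h1 : HasFDerivAt f (fderiv ℂ f (e + (t : ℂ) • (x - e))) (e + (t : ℂ) • (x - e)) :=
      ((hf.differentiableOn one_ne_zero).differentiableAt (isOpen_ball.mem_nhds hm)).hasFDerivAt
    have h2 : HasFDerivAt (fun x : E => e + (t : ℂ) • (x - e))
        ((t : ℂ) • ContinuousLinearMap.id ℂ E) x :=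
      (((hasFDerivAt_id x).sub_const e).const_smul (t : ℂ)).const_add e
    have h3 := (h1.comp x h2).const_smul ((t : ℂ) ^ j)
    refine h3.congr_fderiv ?_
    ext v
    simp [pow_succ, mul_smul]

/-- The derivative of a weighted mean is a weighted mean of the derivative, so the induction on `k`
runs over all weights and all target spaces at once. -/
theorem contDiffOn_rayInt [FiniteDimensional ℂ E] {e : E} {ρ : ℝ} (k : ℕ) :
    ∀ {F : Type} [NormedAddCommGroup F] [NormedSpace ℂ F] {f : E → F} (j : ℕ),
      ContDiffOn ℂ ∞ f (ball e ρ) → ContDiffOn ℂ k (rayInt e j f) (ball e ρ) := by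
  induction k with
  | zero =>
    intro F _ _ f j hf
    rw [Nat.cast_zero, contDiffOn_zero]
    exact fun w hw => (hasFDerivAt_rayInt (hf.of_le (by simp)) j
      hw).continuousAt.continuousWithinAt
  | succ k ih =>
    intro F _ _ f j hf
    have h := fun {w} (hw : w ∈ ball e ρ) =>
      hasFDerivAt_rayInt (hf.of_le (by simp)) j hw
    rw [Nat.cast_add, Nat.cast_one, contDiffOn_succ_iff_fderiv_of_isOpen isOpen_ball]
    refine ⟨fun w hw => (h hw).differentiableAt.differentiableWithinAt, by simp, ?_⟩
    exact (ih (j + 1) (hf.fderiv_of_isOpen isOpen_ball (by simp))).congr fun w hw => (h hw).fderiv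

/-- Hadamard's lemma. -/
theorem hadamard [FiniteDimensional ℂ E] {e : E} {G : E → ℂ}
    (hG : ∀ᶠ w in 𝓝 e, ContDiffAt ℂ ∞ G w) :
    ∃ g : E → E →L[ℂ] ℂ, (∀ᶠ w in 𝓝 e, ContDiffAt ℂ ∞ g w) ∧
      ∀ᶠ w in 𝓝 e, G w = G e + g w (w - e) := by
  obtain ⟨ρ, hρ, h⟩ := Metric.eventually_nhds_iff_ball.1 hG
  have hG' : ContDiffOn ℂ ∞ G (ball e ρ) := fun w hw => (h w hw).contDiffWithinAt
  have hG₁ : ContDiffOn ℂ ∞ (fderiv ℂ G) (ball e ρ) := hG'.fderiv_of_isOpen isOpen_ball (by simp)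
  -- The mean of the derivative along the segment: applied to `w - e`, it integrates the derivative
  -- of `t ↦ G (e + t (w - e))` from 0 to 1.
  refine ⟨rayInt e 0 (fderiv ℂ G), ?_, ?_⟩
  · filter_upwards [isOpen_ball.mem_nhds (mem_ball_self hρ)] with w hw
    exact (contDiffOn_infty.2 fun k => contDiffOn_rayInt k 0 hG₁).contDiffAt
      (isOpen_ball.mem_nhds hw)
  · filter_upwards [isOpen_ball.mem_nhds (mem_ball_self hρ)] with w hw
    have hint := (continuousOn_ray hG₁.continuousOn 0 hw).intervalIntegrable (μ := volume)
    have h1 : rayInt e 0 (fderiv ℂ G) w (w - e) =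
        ∫ t in (0 : ℝ)..1, fderiv ℂ G (e + (t : ℂ) • (w - e)) (w - e) := by
      rw [rayInt, ContinuousLinearMap.intervalIntegral_apply hint]
      simp
    have h2 : ∀ t ∈ Set.uIcc (0 : ℝ) 1, HasDerivAt (fun t : ℝ => G (e + (t : ℂ) • (w - e)))
        (fderiv ℂ G (e + (t : ℂ) • (w - e)) (w - e)) t := by
      intro t ht
      rw [Set.uIcc_of_le zero_le_one] at ht
      have hm := ray_mem_ball hw ht
      have h3 : HasFDerivAt G (fderiv ℂ G (e + (t : ℂ) • (w - e))) (e + (t : ℂ) • (w - e)) :=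
        ((h _ hm).differentiableAt (by simp)).hasFDerivAt
      have h4 : HasDerivAt (fun t : ℂ => e + t • (w - e)) (w - e) t := by
        simpa using ((hasDerivAt_id (t : ℂ)).smul_const (w - e)).const_add e
      exact (h3.comp_hasDerivAt (t : ℂ) h4).comp_ofReal
    have h5 : ContinuousOn (fun t : ℝ => fderiv ℂ G (e + (t : ℂ) • (w - e)) (w - e))
        (Set.uIcc 0 1) := by
      have := (continuousOn_ray hG₁.continuousOn 0 hw).clm_apply
        (continuousOn_const (c := w - e))
      simpa using this
    rw [h1, intervalIntegral.integral_eq_sub_of_hasDerivAt h2 h5.intervalIntegrable]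
    simp

/-- Otherwise `f = t ^ k g` near 0 with `g 0 ≠ 0`, and the bound of order `k + 1` forces `g 0 = 0`.
-/
theorem eventually_eq_zero_of_isBigO_pow {f : ℂ → ℂ} (hf : AnalyticAt ℂ f 0)
    (h : ∀ k : ℕ, f =O[𝓝 0] fun t => t ^ k) : ∀ᶠ t in 𝓝 0, f t = 0 := by
  by_contra hne
  obtain ⟨k, g, hg, hg0, hfg⟩ := hf.exists_eventuallyEq_pow_smul_nonzero_iff.2 hne
  obtain ⟨C, hC⟩ := (h (k + 1)).bound
  have hle : ∀ᶠ t in 𝓝[≠] (0 : ℂ), ‖g t‖ ≤ C * ‖t‖ := by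
    filter_upwards [hfg.filter_mono nhdsWithin_le_nhds, hC.filter_mono nhdsWithin_le_nhds,
      self_mem_nhdsWithin] with t h1 h2 h3
    have hpos : 0 < ‖t‖ ^ k := pow_pos (norm_pos_iff.2 h3) k
    rw [h1, sub_zero, norm_smul, norm_pow, norm_pow, pow_succ] at h2
    refine le_of_mul_le_mul_left (h2.trans_eq ?_) hpos
    ring
  have h1 : Filter.Tendsto (fun t => ‖g t‖) (𝓝[≠] 0) (𝓝 ‖g 0‖) :=
    (hg.continuousAt.tendsto.mono_left nhdsWithin_le_nhds).norm
  have h2 : Filter.Tendsto (fun t : ℂ => C * ‖t‖) (𝓝[≠] 0) (𝓝 0) := by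
    have : Filter.Tendsto (fun t : ℂ => C * ‖t‖) (𝓝 0) (𝓝 (C * ‖(0 : ℂ)‖)) :=
      (continuous_const.mul continuous_norm).tendsto 0
    rw [norm_zero, mul_zero] at this
    exact this.mono_left nhdsWithin_le_nhds
  exact hg0 (norm_le_zero_iff.1 (le_of_tendsto_of_tendsto h1 h2 hle))

/-- A holomorphic function vanishing to infinite order at a point vanishes near that point. -/
theorem eventually_eq_zero_of_isBigO {e : E} {G : E → ℂ}
    (hG : ∀ᶠ w in 𝓝 e, DifferentiableAt ℂ G w)
    (h : ∀ k : ℕ, G =O[𝓝 e] fun w => ‖w - e‖ ^ k) : ∀ᶠ w in 𝓝 e, G w = 0 := by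
  obtain ⟨ρ, hρ, hd⟩ := Metric.eventually_nhds_iff_ball.1 hG
  filter_upwards [isOpen_ball.mem_nhds (mem_ball_self hρ)] with w hw
  obtain rfl | hne := eq_or_ne w e
  · exact (h 1).eq_zero_of_norm_pow one_ne_zero
  have hpos : 0 < ‖w - e‖ := norm_pos_iff.2 (sub_ne_zero.2 hne)
  -- The complex line through `e` and `w`. On a disk around 0 that contains 1, `G ∘ L` is analytic
  -- and flat at 0, so the identity theorem gives `G w = 0`.
  set L : ℂ → E := fun t => e + t • (w - e) with hL
  have hLm : ∀ t ∈ ball (0 : ℂ) (ρ / ‖w - e‖), L t ∈ ball e ρ := by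
    intro t ht
    rw [mem_ball_zero_iff, lt_div_iff₀ hpos] at ht
    simpa [hL, dist_eq_norm, norm_smul] using ht
  have hLd : Differentiable ℂ L := by fun_prop
  have hdiff : DifferentiableOn ℂ (G ∘ L) (ball 0 (ρ / ‖w - e‖)) := fun t ht =>
    ((hd _ (hLm t ht)).comp t (hLd t)).differentiableWithinAt
  have han := hdiff.analyticOnNhd isOpen_ball
  have h0 : (0 : ℂ) ∈ ball (0 : ℂ) (ρ / ‖w - e‖) := mem_ball_self (div_pos hρ hpos)
  have hev : (G ∘ L) =ᶠ[𝓝 0] 0 := by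
    refine eventually_eq_zero_of_isBigO_pow (han 0 h0) fun k => ?_
    have hL0 : Filter.Tendsto L (𝓝 0) (𝓝 e) := by
      have := hLd.continuous.tendsto 0
      rwa [show L 0 = e by simp [hL]] at this
    refine ((h k).comp_tendsto hL0).trans
      (Asymptotics.IsBigO.of_bound (‖w - e‖ ^ k) (Filter.Eventually.of_forall fun t => ?_))
    simp [hL, norm_smul, mul_pow, mul_comm]
  have h1 : (1 : ℂ) ∈ ball (0 : ℂ) (ρ / ‖w - e‖) := by
    rw [mem_ball_zero_iff, norm_one, one_lt_div hpos]
    exact mem_ball_iff_norm.1 hw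
  have := han.eqOn_zero_of_preconnected_of_eventuallyEq_zero
    (convex_ball (0 : ℂ) _).isPreconnected h0 hev h1
  simpa [hL] using this

end Hadamard

/-! ### An algebraic criterion for the vanishing of a derivation -/

section DerivationVanishing

variable {A : Type} [CommRing A] [Algebra ℂ A] {κ : Type} [Fintype κ]

/-- A derivation killing elements `u i` vanishes if every element is the sum of a constant and a
combination of the `u i` and the ring is separated in the topology defined by the `u i`. -/
theorem derivation_eq_zero_of_expansion (u : κ → A)
    (hu : ∀ r, ∃ (c : ℂ) (s : κ → A), r = algebraMap ℂ A c + ∑ i, u i * s i)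
    (hsep : ∀ r, (∀ k : ℕ, r ∈ Ideal.span (Set.range u) ^ k) → r = 0)
    (D : Derivation ℂ A A) (hD : ∀ i, D (u i) = 0) : D = 0 := by
  -- Expanding `r` leaves `D r = ∑ u i * D (s i)`, so a bound on all values of `D` improves by one
  -- power at each step.
  have key : ∀ (k : ℕ) (r : A), D r ∈ Ideal.span (Set.range u) ^ k := by
    intro k
    induction k with
    | zero => intro r; simp
    | succ k ih =>
      intro r
      obtain ⟨c, s, rfl⟩ := hu r
      rw [map_add, Derivation.map_algebraMap, zero_add, map_sum]
      refine Ideal.sum_mem _ fun i _ => ?_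
      rw [Derivation.leibniz, hD, smul_zero, add_zero, smul_eq_mul, pow_succ']
      exact Ideal.mul_mem_mul (Ideal.subset_span ⟨i, rfl⟩) (ih _)
  exact Derivation.ext fun r => hsep _ fun k => key k r

end DerivationVanishing

/-! ### Holomorphic sections in a chart -/

section Charts

open Topology

variable {n : ℕ} {M : Type} [TopologicalSpace M] [ChartedSpace (EuclideanSpace ℂ (Fin n)) M]

/-- The function given by a section of the sheaf of holomorphic functions. -/
def holFun {V : Opens (TopCat.of M)} (g : ((holSheaf n M).obj.obj (op V) : CommRingCat)) :
    V → ℂ :=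
  (show C^∞⟮𝓘(ℂ, EuclideanSpace ℂ (Fin n)), (V : Opens M); 𝓘(ℂ), ℂ⟯ from g)

theorem contMDiff_holFun {V : Opens (TopCat.of M)}
    (g : ((holSheaf n M).obj.obj (op V) : CommRingCat)) :
    ContMDiff 𝓘(ℂ, EuclideanSpace ℂ (Fin n)) 𝓘(ℂ) ∞ (M := (V : Opens M)) (holFun g) :=
  (show C^∞⟮𝓘(ℂ, EuclideanSpace ℂ (Fin n)), (V : Opens M); 𝓘(ℂ), ℂ⟯ from g).contMDiff

/-- The section given by a function. -/
def holMk {V : Opens (TopCat.of M)} (f : V → ℂ)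
    (hf : ContMDiff 𝓘(ℂ, EuclideanSpace ℂ (Fin n)) 𝓘(ℂ) ∞ (M := (V : Opens M)) f) :
    ((holSheaf n M).obj.obj (op V) : CommRingCat) :=
  (⟨f, hf⟩ : C^∞⟮𝓘(ℂ, EuclideanSpace ℂ (Fin n)), (V : Opens M); 𝓘(ℂ), ℂ⟯)

theorem holFun_injective {V : Opens (TopCat.of M)}
    {g h : ((holSheaf n M).obj.obj (op V) : CommRingCat)} (e : ∀ z, holFun g z = holFun h z) :
    g = h :=
  ContMDiffMap.ext (I := 𝓘(ℂ, EuclideanSpace ℂ (Fin n))) (M := (V : Opens M)) (I' := 𝓘(ℂ)) e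

theorem holFun_add {V : Opens (TopCat.of M)}
    (g h : ((holSheaf n M).obj.obj (op V) : CommRingCat)) (z : V) :
    holFun (g + h) z = holFun g z + holFun h z := rfl

theorem holFun_mul {V : Opens (TopCat.of M)}
    (g h : ((holSheaf n M).obj.obj (op V) : CommRingCat)) (z : V) :
    holFun (g * h) z = holFun g z * holFun h z := rfl

theorem holFun_holConst (c : ℂ) (z : (⊤ : Opens (TopCat.of M))) :
    holFun (holConst n M c) z = c := rfl

variable (n) (x₀ : M)

/-- The domain of the chart at `x₀`. -/
def chartDom : Opens (TopCat.of M) :=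
  ⟨(chartAt (EuclideanSpace ℂ (Fin n)) x₀).source, (chartAt _ x₀).open_source⟩

/-- The chart at `x₀`. -/
abbrev chart : OpenPartialHomeomorph M (EuclideanSpace ℂ (Fin n)) := chartAt _ x₀

variable {n}

open Classical in
/-- A section of the sheaf of holomorphic functions in the chart at `x₀`, extended by zero. -/
def chartFun {V : Opens (TopCat.of M)} (g : ((holSheaf n M).obj.obj (op V) : CommRingCat))
    (w : EuclideanSpace ℂ (Fin n)) : ℂ :=
  if h : (chart n x₀).symm w ∈ V then holFun g ⟨_, h⟩ else 0

theorem chartFun_of_mem {V : Opens (TopCat.of M)}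
    (g : ((holSheaf n M).obj.obj (op V) : CommRingCat)) {w : EuclideanSpace ℂ (Fin n)}
    (h : (chart n x₀).symm w ∈ V) : chartFun x₀ g w = holFun g ⟨_, h⟩ := dif_pos h

theorem chartFun_chart {V : Opens (TopCat.of M)}
    (g : ((holSheaf n M).obj.obj (op V) : CommRingCat)) {y : M} (hV : y ∈ V)
    (hy : y ∈ chartDom n x₀) : chartFun x₀ g (chart n x₀ y) = holFun g ⟨y, hV⟩ := by
  have e : (chart n x₀).symm (chart n x₀ y) = y := (chart n x₀).left_inv hy
  rw [chartFun_of_mem x₀ g (e.symm ▸ hV)]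
  exact congrArg (holFun g) (Subtype.ext e)

variable {x₀}

theorem eventually_symm_mem {V : Opens (TopCat.of M)} {y : M} (hV : y ∈ V)
    (hy : y ∈ chartDom n x₀) : ∀ᶠ w in 𝓝 (chart n x₀ y),
      w ∈ (chart n x₀).target ∧ (chart n x₀).symm w ∈ V := by
  refine ((chart n x₀).open_target.eventually_mem ((chart n x₀).map_source hy)).and ?_
  refine ((chart n x₀).tendsto_symm hy).eventually_mem ?_
  exact V.isOpen.mem_nhds hV

theorem contDiffAt_chartFun [IsManifold 𝓘(ℂ, EuclideanSpace ℂ (Fin n)) ω M]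
    {V : Opens (TopCat.of M)} (g : ((holSheaf n M).obj.obj (op V) : CommRingCat)) {y : M}
    (hV : y ∈ V) (hy : y ∈ chartDom n x₀) : ContDiffAt ℂ ∞ (chartFun x₀ g) (chart n x₀ y) := by
  classical
  let G : M → ℂ := fun z => if h : z ∈ V then holFun g ⟨z, h⟩ else 0
  have hG : ContMDiffAt 𝓘(ℂ, EuclideanSpace ℂ (Fin n)) 𝓘(ℂ) ∞ G y := by
    refine (contMDiffAt_subtype_iff (U := (V : Opens M)) (x := ⟨y, hV⟩)).1 ?_
    have e : (fun z : (V : Opens M) => G z) = holFun g := funext fun z => dif_pos z.2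
    rw [e]
    exact contMDiff_holFun g _
  have hs : ContMDiffAt 𝓘(ℂ, EuclideanSpace ℂ (Fin n)) 𝓘(ℂ, EuclideanSpace ℂ (Fin n)) ∞
      (chart n x₀).symm (chart n x₀ y) :=
    (contMDiffOn_chart_symm (n := ∞)).contMDiffAt
      ((chart n x₀).open_target.mem_nhds ((chart n x₀).map_source hy))
  have e : (chart n x₀).symm (chart n x₀ y) = y := (chart n x₀).left_inv hy
  rw [← contMDiffAt_iff_contDiffAt]
  exact ContMDiffAt.comp _ (e.symm ▸ hG) hs

theorem eventually_contDiffAt_chartFun [IsManifold 𝓘(ℂ, EuclideanSpace ℂ (Fin n)) ω M]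
    {V : Opens (TopCat.of M)} (g : ((holSheaf n M).obj.obj (op V) : CommRingCat)) {y : M}
    (hV : y ∈ V) (hy : y ∈ chartDom n x₀) :
    ∀ᶠ w in 𝓝 (chart n x₀ y), ContDiffAt ℂ ∞ (chartFun x₀ g) w := by
  filter_upwards [eventually_symm_mem hV hy] with w hw
  have := contDiffAt_chartFun g hw.2 ((chart n x₀).map_target hw.1)
  rwa [(chart n x₀).right_inv hw.1] at this

theorem rgerm_eq_of_chartFun {V W : Opens (TopCat.of M)}
    {g : ((holSheaf n M).obj.obj (op V) : CommRingCat)}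
    {h : ((holSheaf n M).obj.obj (op W) : CommRingCat)} {y : M} (hV : y ∈ V) (hW : y ∈ W)
    (hy : y ∈ chartDom n x₀) (e : chartFun x₀ g =ᶠ[𝓝 (chart n x₀ y)] chartFun x₀ h) :
    rgerm (holSheaf n M) ⟨y, hV⟩ g = rgerm (holSheaf n M) ⟨y, hW⟩ h := by
  have ev : ∀ᶠ z in 𝓝 y, chartFun x₀ g (chart n x₀ z) = chartFun x₀ h (chart n x₀ z) ∧
      z ∈ V ∧ z ∈ W ∧ z ∈ chartDom n x₀ :=
    (((chart n x₀).continuousAt hy).eventually e).and ((V.isOpen.eventually_mem hV).and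
      ((W.isOpen.eventually_mem hW).and ((chartDom n x₀).isOpen.eventually_mem hy)))
  obtain ⟨S, hS, hSo, hyS⟩ := mem_nhds_iff.1 ev
  let S' : Opens (TopCat.of M) := ⟨S, hSo⟩
  let i : S' ⟶ V := homOfLE fun z hz => (hS hz).2.1
  let j : S' ⟶ W := homOfLE fun z hz => (hS hz).2.2.1
  have key : (holSheaf n M).obj.map i.op g = (holSheaf n M).obj.map j.op h :=
    holFun_injective fun z => by
      obtain ⟨h1, h2, h3, h4⟩ := hS z.2
      rw [chartFun_chart x₀ g h2 h4, chartFun_chart x₀ h h3 h4] at h1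
      exact h1
  exact (rgerm_res i (⟨y, hyS⟩ : S') g).symm.trans
    ((congrArg (rgerm (holSheaf n M) (⟨y, hyS⟩ : S')) key).trans
      (rgerm_res j (⟨y, hyS⟩ : S') h))

theorem chartFun_eventuallyEq_of_rgerm {V W : Opens (TopCat.of M)}
    {g : ((holSheaf n M).obj.obj (op V) : CommRingCat)}
    {h : ((holSheaf n M).obj.obj (op W) : CommRingCat)} {y : M} (hV : y ∈ V) (hW : y ∈ W)
    (hy : y ∈ chartDom n x₀)
    (e : rgerm (holSheaf n M) ⟨y, hV⟩ g = rgerm (holSheaf n M) ⟨y, hW⟩ h) :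
    chartFun x₀ g =ᶠ[𝓝 (chart n x₀ y)] chartFun x₀ h := by
  obtain ⟨S, hS, i, j, e'⟩ := TopCat.Presheaf.germ_eq (holSheaf n M).obj y hV hW g h e
  filter_upwards [eventually_symm_mem (V := S) hS hy] with w hw
  rw [chartFun_of_mem x₀ g (i.le hw.2), chartFun_of_mem x₀ h (j.le hw.2)]
  exact congrArg (fun f => holFun f ⟨_, hw.2⟩) e'

variable (x₀) in
/-- The section given by a function of the coordinates. -/
def chartSec [IsManifold 𝓘(ℂ, EuclideanSpace ℂ (Fin n)) ω M] {V : Opens (TopCat.of M)}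
    (H : EuclideanSpace ℂ (Fin n) → ℂ)
    (hH : ∀ z ∈ V, z ∈ chartDom n x₀ ∧ ContDiffAt ℂ ∞ H (chart n x₀ z)) :
    ((holSheaf n M).obj.obj (op V) : CommRingCat) :=
  holMk (fun z : V => H (chart n x₀ z)) fun z =>
    (contMDiffAt_subtype_iff (U := (V : Opens M)) (x := z)
      (f := fun z => H (chart n x₀ z))).2
      (ContMDiffAt.comp _ (contMDiffAt_iff_contDiffAt.2 (hH z.1 z.2).2)
        ((contMDiffOn_chart (n := ∞)).contMDiffAt
          ((chartDom n x₀).isOpen.mem_nhds (hH z.1 z.2).1)))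

theorem chartFun_chartSec [IsManifold 𝓘(ℂ, EuclideanSpace ℂ (Fin n)) ω M]
    {V : Opens (TopCat.of M)} (H : EuclideanSpace ℂ (Fin n) → ℂ)
    (hH : ∀ z ∈ V, z ∈ chartDom n x₀ ∧ ContDiffAt ℂ ∞ H (chart n x₀ z)) {y : M} (hV : y ∈ V) :
    chartFun x₀ (chartSec x₀ H hH) =ᶠ[𝓝 (chart n x₀ y)] H := by
  filter_upwards [eventually_symm_mem hV (hH y hV).1] with w hw
  rw [chartFun_of_mem x₀ _ hw.2]
  exact congrArg H ((chart n x₀).right_inv hw.1)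

end Charts

/-! ### Stalks of holomorphic functions and their derivations -/

section ChartStalk

open Topology

variable {n : ℕ} {M : Type} [TopologicalSpace M] [ChartedSpace (EuclideanSpace ℂ (Fin n)) M]
  {x₀ : M}

/-- A function of the coordinates representing a germ. -/
def rep (y : chartDom n x₀) (r : RStalk (holSheaf n M) y.1) : EuclideanSpace ℂ (Fin n) → ℂ :=
  chartFun x₀ (rgerm_surjective y.2 r).choose_spec.choose_spec.choose_spec.choose

theorem rep_rgerm (y : chartDom n x₀) {V : Opens (TopCat.of M)} (hV : y.1 ∈ V)
    (g : ((holSheaf n M).obj.obj (op V) : CommRingCat)) :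
    rep y (rgerm (holSheaf n M) ⟨y.1, hV⟩ g) =ᶠ[𝓝 (chart n x₀ y.1)] chartFun x₀ g :=
  chartFun_eventuallyEq_of_rgerm _ hV y.2 (rgerm_surjective y.2
    (rgerm (holSheaf n M) ⟨y.1, hV⟩ g)).choose_spec.choose_spec.choose_spec.choose_spec

theorem exists_rgerm_eq (y : chartDom n x₀) (r : RStalk (holSheaf n M) y.1) :
    ∃ (V : Opens (TopCat.of M)) (hV : y.1 ∈ V) (_ : V ⟶ chartDom n x₀)
      (g : ((holSheaf n M).obj.obj (op V) : CommRingCat)), rgerm (holSheaf n M) ⟨y.1, hV⟩ g = r :=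
  rgerm_surjective y.2 r

/-- This turns identities between germs into identities of functions near a point of `ℂ^n`, where
calculus applies. -/
theorem rep_injective (y : chartDom n x₀) {r s : RStalk (holSheaf n M) y.1}
    (h : rep y r =ᶠ[𝓝 (chart n x₀ y.1)] rep y s) : r = s := by
  obtain ⟨V, hV, -, g, rfl⟩ := exists_rgerm_eq y r
  obtain ⟨W, hW, -, g', rfl⟩ := exists_rgerm_eq y s
  exact rgerm_eq_of_chartFun hV hW y.2
    ((rep_rgerm y hV g).symm.trans (h.trans (rep_rgerm y hW g')))

theorem exists_rgerm_eq₂ (y : chartDom n x₀) (r s : RStalk (holSheaf n M) y.1) :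
    ∃ (V : Opens (TopCat.of M)) (hV : y.1 ∈ V)
      (g h : ((holSheaf n M).obj.obj (op V) : CommRingCat)),
      rgerm (holSheaf n M) ⟨y.1, hV⟩ g = r ∧ rgerm (holSheaf n M) ⟨y.1, hV⟩ h = s := by
  obtain ⟨V, hV, -, g, hg⟩ := exists_rgerm_family y.2 ![r, s]
  exact ⟨V, hV, g 0, g 1, hg 0, hg 1⟩

theorem rep_add (y : chartDom n x₀) (r s : RStalk (holSheaf n M) y.1) :
    rep y (r + s) =ᶠ[𝓝 (chart n x₀ y.1)] rep y r + rep y s := by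
  obtain ⟨V, hV, g, h, rfl, rfl⟩ := exists_rgerm_eq₂ y r s
  rw [← map_add]
  refine (rep_rgerm y hV (g + h)).trans
    (Filter.EventuallyEq.trans ?_ ((rep_rgerm y hV g).add (rep_rgerm y hV h)).symm)
  filter_upwards [eventually_symm_mem hV y.2] with w hw
  rw [Pi.add_apply, chartFun_of_mem x₀ _ hw.2, chartFun_of_mem x₀ g hw.2,
    chartFun_of_mem x₀ h hw.2, holFun_add]

theorem rep_mul (y : chartDom n x₀) (r s : RStalk (holSheaf n M) y.1) :
    rep y (r * s) =ᶠ[𝓝 (chart n x₀ y.1)] rep y r * rep y s := by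
  obtain ⟨V, hV, g, h, rfl, rfl⟩ := exists_rgerm_eq₂ y r s
  rw [← map_mul]
  refine (rep_rgerm y hV (g * h)).trans
    (Filter.EventuallyEq.trans ?_ ((rep_rgerm y hV g).mul (rep_rgerm y hV h)).symm)
  filter_upwards [eventually_symm_mem hV y.2] with w hw
  rw [Pi.mul_apply, chartFun_of_mem x₀ _ hw.2, chartFun_of_mem x₀ g hw.2,
    chartFun_of_mem x₀ h hw.2, holFun_mul]

theorem rep_algebraMap (y : chartDom n x₀) (c : ℂ) :
    rep y (algebraMap ℂ (RStalk (holSheaf n M) y.1) c) =ᶠ[𝓝 (chart n x₀ y.1)] fun _ => c := by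
  refine (rep_rgerm y (V := ⊤) trivial (holConst n M c)).trans (Filter.Eventually.of_forall
    fun w => ?_)
  exact (chartFun_of_mem x₀ (V := ⊤) (holConst n M c) (w := w) trivial).trans (holFun_holConst c _)

theorem rep_sum (y : chartDom n x₀) {κ : Type} (S : Finset κ)
    (r : κ → RStalk (holSheaf n M) y.1) :
    rep y (∑ k ∈ S, r k) =ᶠ[𝓝 (chart n x₀ y.1)] ∑ k ∈ S, rep y (r k) := by
  classical
  induction S using Finset.induction_on with
  | empty => simpa using! rep_algebraMap y 0
  | insert k S hk ih =>
    rw [Finset.sum_insert hk, Finset.sum_insert hk]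
    exact (rep_add y _ _).trans ((Filter.EventuallyEq.refl _ _).add ih)

variable [IsManifold 𝓘(ℂ, EuclideanSpace ℂ (Fin n)) ω M]

theorem eventually_contDiffAt_rep (y : chartDom n x₀) (r : RStalk (holSheaf n M) y.1) :
    ∀ᶠ w in 𝓝 (chart n x₀ y.1), ContDiffAt ℂ ∞ (rep y r) w := by
  obtain ⟨V, hV, -, g, rfl⟩ := exists_rgerm_eq y r
  filter_upwards [eventually_contDiffAt_chartFun g hV y.2, (rep_rgerm y hV g).eventually_nhds]
    with w h h'
  exact h.congr_of_eventuallyEq h'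

theorem exists_rep (y : chartDom n x₀) {H : EuclideanSpace ℂ (Fin n) → ℂ}
    (hH : ∀ᶠ w in 𝓝 (chart n x₀ y.1), ContDiffAt ℂ ∞ H w) :
    ∃ r : RStalk (holSheaf n M) y.1, rep y r =ᶠ[𝓝 (chart n x₀ y.1)] H := by
  have ev : ∀ᶠ z in 𝓝 y.1, z ∈ chartDom n x₀ ∧ ContDiffAt ℂ ∞ H (chart n x₀ z) :=
    ((chartDom n x₀).isOpen.eventually_mem y.2).and (((chart n x₀).continuousAt y.2).eventually hH)
  obtain ⟨S, hS, hSo, hyS⟩ := mem_nhds_iff.1 ev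
  let S' : Opens (TopCat.of M) := ⟨S, hSo⟩
  exact ⟨rgerm (holSheaf n M) (⟨y.1, hyS⟩ : S') (chartSec x₀ H hS),
    (rep_rgerm y (V := S') hyS _).trans (chartFun_chartSec H hS (V := S') hyS)⟩

/-- The germ represented by a function of the coordinates. -/
def ofRep (y : chartDom n x₀) {H : EuclideanSpace ℂ (Fin n) → ℂ}
    (hH : ∀ᶠ w in 𝓝 (chart n x₀ y.1), ContDiffAt ℂ ∞ H w) : RStalk (holSheaf n M) y.1 :=
  (exists_rep y hH).choose

theorem rep_ofRep (y : chartDom n x₀) {H : EuclideanSpace ℂ (Fin n) → ℂ}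
    (hH : ∀ᶠ w in 𝓝 (chart n x₀ y.1), ContDiffAt ℂ ∞ H w) :
    rep y (ofRep y hH) =ᶠ[𝓝 (chart n x₀ y.1)] H := (exists_rep y hH).choose_spec

/-- The partial derivative of a function of the coordinates. -/
def pd (i : Fin n) (H : EuclideanSpace ℂ (Fin n) → ℂ) (w : EuclideanSpace ℂ (Fin n)) : ℂ :=
  fderiv ℂ H w (EuclideanSpace.single i 1)

theorem contDiffAt_pd (i : Fin n) {H : EuclideanSpace ℂ (Fin n) → ℂ}
    {w : EuclideanSpace ℂ (Fin n)} (h : ContDiffAt ℂ ∞ H w) : ContDiffAt ℂ ∞ (pd i H) w :=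
  (h.fderiv_right (by simp)).clm_apply contDiffAt_const

theorem pd_congr (i : Fin n) {H H' : EuclideanSpace ℂ (Fin n) → ℂ}
    {w : EuclideanSpace ℂ (Fin n)} (h : H =ᶠ[𝓝 w] H') : pd i H =ᶠ[𝓝 w] pd i H' := by
  filter_upwards [h.fderiv (𝕜 := ℂ)] with v hv
  rw [pd, pd, hv]

theorem eventually_contDiffAt_pd (i : Fin n) (y : chartDom n x₀)
    (r : RStalk (holSheaf n M) y.1) :
    ∀ᶠ w in 𝓝 (chart n x₀ y.1), ContDiffAt ℂ ∞ (pd i (rep y r)) w :=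
  (eventually_contDiffAt_rep y r).mono fun _ h => contDiffAt_pd i h

/-- The partial derivative of a germ. -/
def dpartFun (i : Fin n) (y : chartDom n x₀) (r : RStalk (holSheaf n M) y.1) :
    RStalk (holSheaf n M) y.1 := ofRep y (eventually_contDiffAt_pd i y r)

theorem rep_dpartFun (i : Fin n) (y : chartDom n x₀) (r : RStalk (holSheaf n M) y.1) :
    rep y (dpartFun i y r) =ᶠ[𝓝 (chart n x₀ y.1)] pd i (rep y r) := rep_ofRep y _

theorem dpartFun_add (i : Fin n) (y : chartDom n x₀) (r s : RStalk (holSheaf n M) y.1) :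
    dpartFun i y (r + s) = dpartFun i y r + dpartFun i y s := by
  refine rep_injective y ((rep_dpartFun i y _).trans ((pd_congr i (rep_add y r s)).trans
    (Filter.EventuallyEq.trans ?_ ((rep_add y _ _).trans
      ((rep_dpartFun i y r).add (rep_dpartFun i y s))).symm)))
  filter_upwards [eventually_contDiffAt_rep y r, eventually_contDiffAt_rep y s] with w h h'
  rw [Pi.add_apply, pd, fderiv_add (h.differentiableAt (by simp)) (h'.differentiableAt (by simp))]
  rfl

theorem dpartFun_mul (i : Fin n) (y : chartDom n x₀) (r s : RStalk (holSheaf n M) y.1) :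
    dpartFun i y (r * s) = r * dpartFun i y s + s * dpartFun i y r := by
  refine rep_injective y ((rep_dpartFun i y _).trans ((pd_congr i (rep_mul y r s)).trans
    (Filter.EventuallyEq.trans ?_ ((rep_add y _ _).trans
      (((rep_mul y _ _).trans ((Filter.EventuallyEq.refl _ _).mul (rep_dpartFun i y s))).add
        ((rep_mul y _ _).trans ((Filter.EventuallyEq.refl _ _).mul (rep_dpartFun i y r))))).symm)))
  filter_upwards [eventually_contDiffAt_rep y r, eventually_contDiffAt_rep y s] with w h h'
  rw [pd, fderiv_mul (h.differentiableAt (by simp)) (h'.differentiableAt (by simp))]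
  rfl

theorem dpartFun_algebraMap (i : Fin n) (y : chartDom n x₀) (c : ℂ) :
    dpartFun i y (algebraMap ℂ (RStalk (holSheaf n M) y.1) c) = 0 := by
  refine rep_injective y ((rep_dpartFun i y _).trans ((pd_congr i (rep_algebraMap y c)).trans
    (Filter.EventuallyEq.trans ?_ (map_zero (algebraMap ℂ (RStalk (holSheaf n M) y.1)) ▸
      rep_algebraMap y 0).symm)))
  refine Filter.Eventually.of_forall fun w => ?_
  rw [pd, fderiv_fun_const]
  rfl

/-- The partial derivative as a derivation of the stalk. -/
def dpart (i : Fin n) (y : chartDom n x₀) :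
    Derivation ℂ (RStalk (holSheaf n M) y.1) (RStalk (holSheaf n M) y.1) :=
  Derivation.mk'
    { toFun := dpartFun i y
      map_add' := dpartFun_add i y
      map_smul' := fun c r => by
        rw [Algebra.smul_def, dpartFun_mul, dpartFun_algebraMap, mul_zero, add_zero,
          ← Algebra.smul_def, RingHom.id_apply] }
    (dpartFun_mul i y)

theorem rep_dpart (i : Fin n) (y : chartDom n x₀) (r : RStalk (holSheaf n M) y.1) :
    rep y (dpart i y r) =ᶠ[𝓝 (chart n x₀ y.1)] pd i (rep y r) := rep_dpartFun i y r

theorem contDiffAt_coord (i : Fin n) (w : EuclideanSpace ℂ (Fin n)) :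
    ContDiffAt ℂ ∞ (fun w : EuclideanSpace ℂ (Fin n) => w i) w :=
  (EuclideanSpace.proj (𝕜 := ℂ) i).contDiff.contDiffAt

variable (x₀) in
/-- The coordinate functions as sections over the domain of the chart. -/
def coordSec (i : Fin n) : ((holSheaf n M).obj.obj (op (chartDom n x₀)) : CommRingCat) :=
  chartSec x₀ (fun w => w i) fun _ hz => ⟨hz, contDiffAt_coord i _⟩

/-- The germs of the coordinate functions. -/
def coordGerm (i : Fin n) (y : chartDom n x₀) : RStalk (holSheaf n M) y.1 :=
  rgerm (holSheaf n M) y (coordSec x₀ i)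

theorem rep_coordGerm (i : Fin n) (y : chartDom n x₀) :
    rep y (coordGerm i y) =ᶠ[𝓝 (chart n x₀ y.1)] fun w => w i :=
  (rep_rgerm y y.2 (coordSec x₀ i)).trans (chartFun_chartSec _ _ y.2)

theorem dpart_coordGerm (i j : Fin n) (y : chartDom n x₀) :
    dpart i y (coordGerm j y) = if i = j then 1 else 0 := by
  have h : pd i (fun w : EuclideanSpace ℂ (Fin n) => w j) = fun _ => if i = j then (1 : ℂ) else 0 := by
    funext w
    have : HasFDerivAt (fun w : EuclideanSpace ℂ (Fin n) => w j)
        (EuclideanSpace.proj (𝕜 := ℂ) j) w := (EuclideanSpace.proj (𝕜 := ℂ) j).hasFDerivAt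
    rw [pd, this.fderiv]
    simp [eq_comm]
  have h2 := rep_algebraMap y (if i = j then (1 : ℂ) else 0)
  have h3 : algebraMap ℂ (RStalk (holSheaf n M) y.1) (if i = j then (1 : ℂ) else 0) =
      if i = j then 1 else 0 := by split_ifs <;> simp
  rw [← h3]
  refine rep_injective y ((rep_dpart i y _).trans ((pd_congr i (rep_coordGerm j y)).trans ?_))
  rw [h]
  exact h2.symm

/-- The coordinate functions centered at a point. -/
def centered (y : chartDom n x₀) (i : Fin n) : RStalk (holSheaf n M) y.1 :=
  coordGerm i y - algebraMap ℂ _ (chart n x₀ y.1 i)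

theorem rep_centered (y : chartDom n x₀) (i : Fin n) :
    rep y (centered y i) =ᶠ[𝓝 (chart n x₀ y.1)] fun w => w i - chart n x₀ y.1 i := by
  have h := rep_add y (centered y i) (algebraMap ℂ _ (chart n x₀ y.1 i))
  rw [centered, sub_add_cancel] at h
  filter_upwards [h, rep_coordGerm i y, rep_algebraMap y (chart n x₀ y.1 i)] with w h1 h2 h3
  rw [Pi.add_apply, h2, h3] at h1
  rw [h1, centered]
  ring

theorem exists_expansion (y : chartDom n x₀) (r : RStalk (holSheaf n M) y.1) :
    ∃ (c : ℂ) (s : Fin n → RStalk (holSheaf n M) y.1),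
      r = algebraMap ℂ _ c + ∑ i, centered y i * s i := by
  obtain ⟨g, hg, e⟩ := hadamard (eventually_contDiffAt_rep y r)
  have hs : ∀ i : Fin n, ∀ᶠ w in 𝓝 (chart n x₀ y.1),
      ContDiffAt ℂ ∞ (fun w => g w (EuclideanSpace.single i 1)) w := fun i =>
    hg.mono fun w h => h.clm_apply contDiffAt_const
  refine ⟨rep y r (chart n x₀ y.1), fun i => ofRep y (hs i), rep_injective y ?_⟩
  refine Filter.EventuallyEq.trans ?_ ((rep_add y _ _).trans
    ((rep_algebraMap y _).add (rep_sum y _ _))).symm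
  have h1 : ∀ᶠ w in 𝓝 (chart n x₀ y.1), ∀ i, rep y (centered y i * ofRep y (hs i)) w =
      (w i - chart n x₀ y.1 i) * g w (EuclideanSpace.single i 1) := by
    rw [Filter.eventually_all]
    intro i
    exact (rep_mul y _ _).trans ((rep_centered y i).mul (rep_ofRep y (hs i)))
  filter_upwards [e, h1] with w h2 h3
  rw [h2, Pi.add_apply, Finset.sum_apply, Finset.sum_congr rfl fun i _ => h3 i]
  congr 1
  -- Splitting `w` minus the base point along the standard basis turns the linear form of Hadamard's
  -- lemma into a sum over the coordinates.
  conv_lhs => rw [← (EuclideanSpace.basisFun (Fin n) ℂ).sum_repr (w - chart n x₀ y.1)]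
  rw [map_sum]
  exact Finset.sum_congr rfl fun i _ => by simp

/-- The ideal of the germs vanishing to order `k`. -/
def orderIdeal (y : chartDom n x₀) (k : ℕ) : Ideal (RStalk (holSheaf n M) y.1) where
  carrier := {r | rep y r =O[𝓝 (chart n x₀ y.1)] fun w => ‖w - chart n x₀ y.1‖ ^ k}
  zero_mem' := by
    refine Asymptotics.IsBigO.congr' (Asymptotics.isBigO_zero _ _) ?_ Filter.EventuallyEq.rfl
    exact (map_zero (algebraMap ℂ (RStalk (holSheaf n M) y.1)) ▸ rep_algebraMap y 0).symm
  add_mem' hr hs := (hr.add hs).congr' (rep_add y _ _).symm Filter.EventuallyEq.rfl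
  smul_mem' a r hr := by
    have ha : rep y a =O[𝓝 (chart n x₀ y.1)] fun _ => (1 : ℝ) :=
      ((eventually_contDiffAt_rep y a).self_of_nhds.continuousAt).isBigO_one ℝ
    refine (ha.mul hr).congr' (rep_mul y a r).symm ?_
    simp

/-- A centered coordinate is bounded by the distance to the base point, and orders of vanishing add
under multiplication. -/
theorem span_centered_pow_le (y : chartDom n x₀) (k : ℕ) :
    Ideal.span (Set.range (centered y)) ^ k ≤ orderIdeal y k := by
  induction k with
  | zero =>
    intro r _
    change rep y r =O[𝓝 (chart n x₀ y.1)] fun w => ‖w - chart n x₀ y.1‖ ^ 0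
    simp only [pow_zero]
    exact ((eventually_contDiffAt_rep y r).self_of_nhds.continuousAt).isBigO_one ℝ
  | succ k ih =>
    rw [pow_succ, Ideal.mul_le]
    intro r hr s hs
    have h1 : s ∈ orderIdeal y 1 := by
      refine Ideal.span_le.2 ?_ hs
      rintro _ ⟨i, rfl⟩
      change rep y (centered y i) =O[𝓝 (chart n x₀ y.1)] fun w => ‖w - chart n x₀ y.1‖ ^ 1
      refine Asymptotics.IsBigO.congr' (Asymptotics.IsBigO.of_norm_le fun w => ?_)
        (rep_centered y i).symm Filter.EventuallyEq.rfl
      rw [pow_one]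
      exact PiLp.norm_apply_le (w - chart n x₀ y.1) i
    refine (Asymptotics.IsBigO.mul (ih hr) h1).congr' (rep_mul y r s).symm ?_
    exact Filter.Eventually.of_forall fun w => (pow_add _ k 1).symm

theorem eq_zero_of_forall_mem_pow (y : chartDom n x₀) (r : RStalk (holSheaf n M) y.1)
    (h : ∀ k : ℕ, r ∈ Ideal.span (Set.range (centered y)) ^ k) : r = 0 := by
  refine rep_injective y (Filter.EventuallyEq.trans ?_
    (map_zero (algebraMap ℂ (RStalk (holSheaf n M) y.1)) ▸ rep_algebraMap y 0).symm)
  exact eventually_eq_zero_of_isBigO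
    ((eventually_contDiffAt_rep y r).mono fun w hw => hw.differentiableAt (by simp))
    fun k => span_centered_pow_le y k (h k)

theorem derivation_eq_zero (y : chartDom n x₀)
    (D : Derivation ℂ (RStalk (holSheaf n M) y.1) (RStalk (holSheaf n M) y.1))
    (hD : ∀ i, D (coordGerm i y) = 0) : D = 0 :=
  derivation_eq_zero_of_expansion (centered y) (exists_expansion y) (eq_zero_of_forall_mem_pow y) D
    fun i => by rw [centered, map_sub, hD, Derivation.map_algebraMap, sub_zero]

/-- The basis of the derivations of the stalk given by the partial derivatives. -/
def dpartBasis (y : chartDom n x₀) : Module.Basis (Fin n) (RStalk (holSheaf n M) y.1)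
    (Derivation ℂ (RStalk (holSheaf n M) y.1) (RStalk (holSheaf n M) y.1)) :=
  basisOfDual (fun i => dpart i y)
    (fun i =>
      { toFun := fun D => D (coordGerm i y)
        map_add' := fun _ _ => rfl
        map_smul' := fun _ _ => rfl })
    (fun i => (dpart_coordGerm i i y).trans (if_pos rfl))
    (fun i j h => (dpart_coordGerm j i y).trans (if_neg h.symm))
    (derivation_eq_zero y)

/-- One function on `V`, the partial derivative of `g` in the chart, represents the derivative of
the germ of `g` at every point. Hence the stalkwise partial derivatives take sections to sections.
-/
theorem dpart_rgerm (i : Fin n) {V : Opens (TopCat.of M)} (j : V ⟶ chartDom n x₀)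
    (g : ((holSheaf n M).obj.obj (op V) : CommRingCat)) (z : V) :
    dpart i (⟨z.1, j.le z.2⟩ : chartDom n x₀) (rgerm (holSheaf n M) z g) =
      rgerm (holSheaf n M) z (chartSec x₀ (pd i (chartFun x₀ g)) fun _ hz => ⟨j.le hz,
        contDiffAt_pd i (contDiffAt_chartFun g hz (j.le hz))⟩) := by
  let y : chartDom n x₀ := ⟨z.1, j.le z.2⟩
  refine rep_injective y ((rep_dpart i y _).trans ((pd_congr i (rep_rgerm y z.2 g)).trans
    (Filter.EventuallyEq.symm ?_)))
  exact (rep_rgerm y z.2 _).trans (chartFun_chartSec _ _ z.2)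

variable (n x₀) in
/-- The coordinate frame given by a chart. -/
def chartCoordFrame : CoordFrame (holSheaf n M) (chartDom n x₀) n where
  frame :=
    { basis := fun y => dpartBasis y
      sec_basis := fun i V j s hs => by
        obtain ⟨g, hg⟩ := exists_rgerm hs
        refine ringSec_iff.2 ⟨chartSec x₀ (pd i (chartFun x₀ g)) fun _ hz => ⟨j.le hz,
          contDiffAt_pd i (contDiffAt_chartFun g hz (j.le hz))⟩, fun z => ?_⟩
        refine Eq.trans ?_ (dpart_rgerm i j g z)
        rw [← hg z]
        exact DFunLike.congr_fun (basisOfDual_apply _ _ _ _ _ i) (s z)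
      sec_repr := fun {V} j f hf i => hf V (𝟙 V) _ ((ringSec _).res j _
        (ringSec_rgerm (coordSec x₀ i))) }
  z := coordSec x₀
  repr_eq _ _ _ := rfl

variable (n) in
theorem exists_coordFrame (x : TopCat.of M) : ∃ U : Opens (TopCat.of M), x ∈ U ∧
    Nonempty (CoordFrame (holSheaf n M) U n) :=
  ⟨chartDom n x, mem_chart_source (EuclideanSpace ℂ (Fin n)) (x : M), ⟨chartCoordFrame n x⟩⟩

end ChartStalk

end SplitSuper

end

theorem mainTheorem4 (n m : ℕ) (M : Type) [TopologicalSpace M]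
    [ChartedSpace (EuclideanSpace ℂ (Fin n)) M]
    [IsManifold 𝓘(ℂ, EuclideanSpace ℂ (Fin n)) ω M]
    (F : ModSheaf (holSheaf n M)) (hF : IsLocallyFreeOfRank F m) :
    -- the sheaves `Der_p Λ(F)` are locally free (of finite rank)
    (∀ p : ℤ, ∃ r : ℕ, IsLocallyFreeOfRank (derSheaf F p) r) ∧
    -- `Der_{-1} Λ(F) ≅ F^*`, by restriction of derivations to `F`
    (∃ e : derSheaf F (-1) ≅ dualSheaf F,
      ∀ (U : Opens (TopCat.of M)) (δ : (derSheaf F (-1)).val.obj (op U)) (x : U)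
        (s : Stalk F x.1),
        derAt δ x (ExteriorAlgebra.ι _ s) =
          algebraMap _ (ExtStalk F x.1) (dualAt (e.hom.val.app (op U) δ) x s)) ∧
    -- the exact sequence `0 → F^* ⊗ Λ^{p+1}(F) → Der_p Λ(F) → T ⊗ Λ^p(F) → 0` for `p ≥ 0`
    (∀ p : ℕ,
      ∃ (β : tensor (dualSheaf F) (extPowerSheaf F (p + 1)) ⟶ derSheaf F p)
        (α : derSheaf F p ⟶ tensor (tangentSheaf (holSheaf n M)) (extPowerSheaf F p))
        (w : β ≫ α = 0),
        (ShortComplex.mk β α w).ShortExact ∧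
        -- `β (φ ⊗ η)` is the derivation that vanishes on `O` and maps `s ∈ F` to `φ(s) η`
        (∀ (U : Opens (TopCat.of M)) (φ : (dualSheaf F).val.obj (op U))
          (η : (extPowerSheaf F (p + 1)).val.obj (op U)) (x : U),
          (∀ g : RStalk (holSheaf n M) x.1,
            derAt (β.val.app (op U) (tensorSection _ _ U (φ ⊗ₜ η))) x (algebraMap _ _ g) = 0) ∧
          (∀ s : Stalk F x.1,
            derAt (β.val.app (op U) (tensorSection _ _ U (φ ⊗ₜ η))) x (ExteriorAlgebra.ι _ s) =
              dualAt φ x s • extAt η x)) ∧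
        -- `α δ = ∑ ξ_k ⊗ η_k` if and only if the restriction of `δ` to `O` is `g ↦ ∑ ξ_k(g) η_k`
        (∀ (U : Opens (TopCat.of M)) (δ : (derSheaf F p).val.obj (op U)) (N : ℕ)
          (ξ : Fin N → (tangentSheaf (holSheaf n M)).val.obj (op U))
          (η : Fin N → (extPowerSheaf F p).val.obj (op U)),
          α.val.app (op U) δ = ∑ k, tensorSection _ _ U (ξ k ⊗ₜ η k) ↔
            ∀ (x : U) (g : RStalk (holSheaf n M) x.1),
              derAt δ x (algebraMap _ _ g) = ∑ k, tangentAt (ξ k) x g • extAt (η k) x)) := by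
  exact ⟨derSheaf_isLocallyFree hF (exists_coordFrame n),
    ⟨derNegOneIso F, fun _ δ x s => derNegOneIso_spec δ x s⟩,
    exists_shortExact hF (exists_coordFrame n)⟩
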